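/- **Setting.** Let $n\ge 2$ users minimize $f(x)=\frac1n\sum_{i=1}^n f_i(x)$ over $x\in\mathbb R^d$, where $f_i(x)=\mathbb E_{s\sim\mathcal D_i}[\ell(x;s)]$. Starting from deterministic models $x_i^1$, equal for all users, decentralized SGD runs, for $t\ge1$, $$x_i^{t+1}=\sum_{j}w_{ij}\big(x_j^t-\alpha_t\nabla\ell(x_j^t;\xi_j^t)\big),$$ with samples $\xi_i^t\sim\mathcal D_i$ independent across users and iterations. Let $\mathcal F_t$ be the $\sigma$-algebra generated by all models in iterations $1,\dots,t$. Assume: 1. $W=(w_{ij})$ is doubly stochastic and primitive, with $w_{ii}>0$ for all $i$; $\lambda$ is its second largest singular value (then $\lambda\in[0,1)$). 2. Each $\nabla f_i$ is $L$-Lipschitz ($L>0$), and each $f_i$ is twice continuously differentiable and $\mu$-strongly convex ($\mu>0$). Let $\kappa=L/\mu$, let $x^\star$ be the global minimizer of $f$, and $f^\star=f(x^\star)$. 3. For all $i$, $t\ge1$ and $\mathcal F_t$-measurable $x$: $\mathbb E[\nabla\ell(x;\xi_i^t)\mid\mathcal F_t]=\nabla f_i(x)$ (whenever $\nabla\ell(x;\xi_i^t)$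 is integrable), and $\mathbb E\big[\exp(\|\nabla\ell(x;\xi_i^t)-\nabla f_i(x)\|^2/\sigma_i^2)\mid\mathcal F_t\big]\le e$, where $\sigma_i>0$. Let $\sigma^2=\frac1n\sum_i\sigma_i^2$ and $\overline\sigma=\max_i\sigma_i$. Write $a=\frac6\mu$, $H=\sum_i\|\nabla f_i(x^\star)\|^2$, $R=\sum_i\|x_i^1-x^\star\|^2$, $\overline x^1=\frac1n\sum_i x_i^1$ and $\Delta_f=f(\overline x^1)-f^\star$. **Theorem.** There is a universal constant $C>0$ such that the following holds. Let the step-size be $\alpha_t=\frac{a}{t+t_0}$, where $$t_0\ge\max\Big\{6,\ \frac{17280d\sigma^2\kappa}{\mu},\ \frac{432\overline\sigma^2\kappa^2}{\mu},\ \frac{12\kappa\lambda\sqrt{10}}{1-\lambda},\ \frac{5184\overline\sigma^2\lambda^2\kappa^2}{\mu(1-\lambda)},\ \frac{3+\lambda}{1-\lambda}\Big\}$$ and $t_0$ is such that $\alpha_t\le\frac1{2L}$ for all $t\ge1$. Let $\nu=\min\big\{1,\frac{\mu}{432\sigma^2\kappa^2},\frac{\mu}{72\kappa}\big\}$. Then,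 for every $\delta\in(0,1)$ and every $T\ge1$, with probability at least $1-\delta$, $$\begin{aligned}\frac1n\sum_{i=1}^n\big(f(x_i^T)-f^\star\big)\le C\Bigg(&\frac{\nu^{-1}\log(2/\delta)+d\sigma^2\kappa/\mu}{n(T+t_0)}+\frac{\lambda^2a^2L(1+aL)\big(n\sigma^2+\frac{H(1+\kappa^2)}{1-\lambda}\big)}{(1-\lambda)\,n\,(T+t_0)^2}+\frac{(1+t_0)^3\Delta_f}{(T+t_0)^3}\\&+\frac{\sigma^2\lambda^2a^4L^3\big(aL\log(T+t_0)+1\big)}{(1-\lambda)^2(T+t_0)^3}+\frac{\lambda^2a^2L^3(1+aL)(1+t_0)R}{(1-\lambda)^2\,n\,(T+t_0)^3}\Bigg).\end{aligned}$$ In particular no bound on the heterogeneity of the users' gradients is assumed, and the leading term decays with the number $n$ of users (linear speed-up). -/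

import Mathlib

open MeasureTheory ProbabilityTheory
open scoped Gradient

noncomputable section

/-- The parameter space `ℝ^d` with the Euclidean norm. -/
abbrev Vec (d : ℕ) : Type := EuclideanSpace ℝ (Fin d)

/-- The cost of user `i`: `f_i(x) = E_{s ∼ D_i} [ℓ(x; s)]`. -/
def localCost {n d : ℕ} {Ξ : Type*} [MeasurableSpace Ξ]
    (loss : Vec d → Ξ → ℝ) (D : Fin n → Measure Ξ) (i : Fin n) (x : Vec d) : ℝ :=
  ∫ s, loss x s ∂(D i)

/-- The global cost `f(x) = (1/n) ∑_i f_i(x)`. -/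
def globalCost {n d : ℕ} {Ξ : Type*} [MeasurableSpace Ξ]
    (loss : Vec d → Ξ → ℝ) (D : Fin n → Measure Ξ) (x : Vec d) : ℝ :=
  (1 / (n : ℝ)) * ∑ i, localCost loss D i x

/-- The stochastic gradient `∇ℓ(x; s)`, the gradient being taken in `x`. -/
def stochGrad {d : ℕ} {Ξ : Type*} (loss : Vec d → Ξ → ℝ) (x : Vec d) (s : Ξ) : Vec d :=
  ∇ (fun y => loss y s) x

/-- The average of a family of vectors, one for each user. -/
def netAvg {n d : ℕ} (x : Fin n → Vec d) : Vec d :=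
  (1 / (n : ℝ)) • ∑ i, x i

/-- The models of decentralized SGD (adapt-then-combine). Iterations are numbered from `1`, and
the model of user `i` in iteration `1` is `x₁ i`; the value at `0` is a placeholder that is never
used. In iteration `t ≥ 1`,
`x_i^{t+1} = ∑_j w_{ij} (x_j^t - α_t ∇ℓ(x_j^t; ξ_j^t))`.
The sum runs over all users: the neighbours of `i` are the `j` with `w_{ij} ≠ 0`. -/
def dsgd {n d : ℕ} {Ω Ξ : Type*} (W : Matrix (Fin n) (Fin n) ℝ) (α : ℕ → ℝ)
    (loss : Vec d → Ξ → ℝ) (ξ : ℕ → Fin n → Ω → Ξ) (x₁ : Fin n → Vec d) :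
    ℕ → Fin n → Ω → Vec d
  | 0 => fun i _ => x₁ i
  | 1 => fun i _ => x₁ i
  | t + 2 => fun i ω =>
      ∑ j, W i j • (dsgd W α loss ξ x₁ (t + 1) j ω -
        α (t + 1) • stochGrad loss (dsgd W α loss ξ x₁ (t + 1) j ω) (ξ (t + 1) j ω))

/-- The σ-algebra `F_t` generated by the models of all users in iterations `1, …, t`. -/
abbrev modelFiltration {n d : ℕ} {Ω : Type*} (x : ℕ → Fin n → Ω → Vec d) (t : ℕ) :
    MeasurableSpace Ω :=
  ⨆ s ∈ Set.Icc 1 t, ⨆ i : Fin n, MeasurableSpace.comap (x s i) inferInstance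

/-- The step-size schedule `α_t = a / (t + t₀)`. -/
def stepSize (a t₀ : ℝ) (t : ℕ) : ℝ := a / ((t : ℝ) + t₀)

/-- The second largest singular value of `W` (singular values are listed in decreasing order,
with multiplicity, starting at index `0`). -/
def secondSingularValue {n : ℕ} (W : Matrix (Fin n) (Fin n) ℝ) : ℝ :=
  (Matrix.toEuclideanLin W).singularValues 1

/-- Conditions on the network matrix: it is primitive and doubly stochastic, and every user gives
its own model a positive weight (each user is a neighbour of itself, and weights of neighbours are
positive). -/
structure IsNetworkMatrix {n : ℕ} (W : Matrix (Fin n) (Fin n) ℝ) : Prop where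
  primitive : W.IsPrimitive
  doublyStochastic : W ∈ doublyStochastic ℝ (Fin n)
  diag_pos : ∀ i, 0 < W i i

/-- Well-posedness of the stochastic objective: the loss is differentiable in the model and
integrable in the sample, and the stochastic gradient is jointly measurable. -/
structure IsLoss {n d : ℕ} {Ξ : Type*} [MeasurableSpace Ξ]
    (loss : Vec d → Ξ → ℝ) (D : Fin n → Measure Ξ) : Prop where
  differentiable : ∀ s, Differentiable ℝ (fun x => loss x s)
  integrable : ∀ i x, Integrable (loss x) (D i)
  measurable_grad : Measurable (fun p : Vec d × Ξ => stochGrad loss p.1 p.2)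

/-- Each local cost has `L`-Lipschitz gradients. -/
def LipschitzGradients {n d : ℕ} (f : Fin n → Vec d → ℝ) (L : ℝ) : Prop :=
  ∀ i, ∀ x y : Vec d, ‖∇ (f i) x - ∇ (f i) y‖ ≤ L * ‖x - y‖

/-- Each local cost is twice continuously differentiable and `μ`-strongly convex. -/
structure SmoothStronglyConvex {n d : ℕ} (f : Fin n → Vec d → ℝ) (μ : ℝ) : Prop where
  contDiff : ∀ i, ContDiff ℝ 2 (f i)
  strong : ∀ i, ∀ x y : Vec d,
    f i y + inner ℝ (∇ (f i) y) (x - y) + μ / 2 * ‖x - y‖ ^ 2 ≤ f i x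

/-- Conditions on the random samples `ξ_i^t`, `t ≥ 1`, and on the stochastic gradients, relative
to the filtration `F`. Unbiasedness is required of every `F_t`-measurable query point for which
the conditional expectation is defined. -/
structure IsSubGaussianOracle {n d : ℕ} {Ω Ξ : Type*} [MeasurableSpace Ω] [MeasurableSpace Ξ]
    (P : Measure Ω) (loss : Vec d → Ξ → ℝ) (D : Fin n → Measure Ξ) (ξ : ℕ → Fin n → Ω → Ξ)
    (F : ℕ → MeasurableSpace Ω) (σ : Fin n → ℝ) : Prop where
  measurable_sample : ∀ t, 1 ≤ t → ∀ i, Measurable (ξ t i)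
  law_sample : ∀ t, 1 ≤ t → ∀ i, P.map (ξ t i) = D i
  indep : iIndepFun (fun (p : ℕ × Fin n) => ξ (p.1 + 1) p.2) P
  unbiased : ∀ t, 1 ≤ t → ∀ i, ∀ X : Ω → Vec d, Measurable[F t] X →
    Integrable (fun ω => stochGrad loss (X ω) (ξ t i ω)) P →
    P[fun ω => stochGrad loss (X ω) (ξ t i ω) | F t] =ᵐ[P]
      fun ω => ∇ (localCost loss D i) (X ω)
  subGaussian : ∀ t, 1 ≤ t → ∀ i, ∀ X : Ω → Vec d, Measurable[F t] X →
    Integrable (fun ω => Real.exp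
      (‖stochGrad loss (X ω) (ξ t i ω) - ∇ (localCost loss D i) (X ω)‖ ^ 2 / σ i ^ 2)) P ∧
    P[fun ω => Real.exp
      (‖stochGrad loss (X ω) (ξ t i ω) - ∇ (localCost loss D i) (X ω)‖ ^ 2 / σ i ^ 2) | F t]
      ≤ᵐ[P] fun _ => Real.exp 1

/-- The average noise parameter `σ² = (1/n) ∑_i σ_i²`. -/
def avgNoiseSq {n : ℕ} (σ : Fin n → ℝ) : ℝ := (1 / (n : ℝ)) * ∑ i, σ i ^ 2

/-- The largest noise parameter `max_i σ_i`. -/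
def maxNoise {n : ℕ} (σ : Fin n → ℝ) : ℝ := ⨆ i, σ i

/-- The rate of the last iterate at `S = T + t₀`, for the step-size numerator `a`, with
`H = ∑_i ‖∇f_i(x⋆)‖²`, `R = ∑_i ‖x_i^1 - x⋆‖²` and `Δ = f(x̄^1) - f⋆`. -/
def lastIterateRate (n d : ℕ) (a t₀ S ν δ sigmaSq μ L lam H R Δ : ℝ) : ℝ :=
  (ν⁻¹ * Real.log (2 / δ) + d * sigmaSq * (L / μ) / μ) / (n * S)
  + lam ^ 2 * a ^ 2 * L * (1 + a * L) * (n * sigmaSq + H * (1 + (L / μ) ^ 2) / (1 - lam))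
      / ((1 - lam) * n * S ^ 2)
  + (1 + t₀) ^ 3 * Δ / S ^ 3
  + sigmaSq * lam ^ 2 * a ^ 4 * L ^ 3 * (a * L * Real.log S + 1) / ((1 - lam) ^ 2 * S ^ 3)
  + lam ^ 2 * a ^ 2 * L ^ 3 * (1 + a * L) * (1 + t₀) * R / ((1 - lam) ^ 2 * n * S ^ 3)

end

/-! The proof controls the exponential moment of one scalar `potential`. It adds up the
suboptimality of the averaged model (weight A), n times its squared distance to the minimizer
(weight E) and the disagreement between users (weight B), with weights that depend on S = t + t₀ and
on the horizon T. If one iteration raises the logarithm of this moment by at most a deterministic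
amount, then induction over t and a single use of Markov's inequality at time T give a bound in
which log(2/δ) enters only once, additively.

Deterministic part. Averaging over the network contracts the disagreement by λ², because only
constant vectors keep their energy under W. With b = 1 - λ, the disagreement after a gradient step
satisfies a contracting recursion, driven by the suboptimality of the average and by the gradients
at the minimizer. Heterogeneity therefore enters only through H. The suboptimality contracts by the
Polyak–Łojasiewicz inequality, up to a multiple of the disagreement. The distance term is present
because its contraction also yields a gain -2/3 α n (f - f⋆), which pays for the suboptimality that
the disagreement recursion feeds back.

Noise. Given the current models, the noise enters linearly and quadratically.
`lintegral_exp_noise_le` bounds its exponential moment. The linear part costs the squared norm of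
its coefficient times σ_i², and each such square is absorbed by slack kept in the corresponding
contraction. The averaged noise is sub-Gaussian with parameter σ²/n, which is the source of the
linear speed-up.

Weights. A ≈ w n S³ can grow because αμ = 6/S outweighs the growth of S³. At time T the potential
must also dominate (L/2) w S³ times the disagreement, to pass from the average to the individual
users. Keeping such a weight at all times would cost too much noise, so B carries S³ψ with ψ = (1 -
7b/50)^(T-t), which decays geometrically away from the horizon. The factor 1 + (1-ψ)/2 in A pays for
it. The scale w = ν/(2000 (T+t₀)²) is small enough for the linear noise in A to be absorbed, and
division by w n (T+t₀)³ produces the stated rate. The one-step estimate is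
`lintegral_exp_potential_step_le`; `weightA_step_le`, `weightE_step_le` and `weightB_step_le` show
that the weights are admissible. -/

/-! ### Spectral gap of the network matrix. -/

section Network

variable {n : ℕ} {W : Matrix (Fin n) (Fin n) ℝ}

/-- The loss of energy under one averaging step, as a weighted variance. -/
lemma doublyStochastic_energy (hW : W ∈ doublyStochastic ℝ (Fin n)) (v : Fin n → ℝ) :
    ∑ i, v i ^ 2 - ∑ i, (∑ j, W i j * v j) ^ 2
      = ∑ i, ∑ j, W i j * (v j - ∑ k, W i k * v k) ^ 2 := by
  obtain ⟨-, hr, hc⟩ := mem_doublyStochastic_iff_sum.1 hW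
  have h1 : ∑ i, v i ^ 2 = ∑ i, ∑ j, W i j * v j ^ 2 := by
    rw [Finset.sum_comm]
    refine Finset.sum_congr rfl fun j _ => ?_
    rw [← Finset.sum_mul, hc, one_mul]
  rw [h1, ← Finset.sum_sub_distrib]
  refine Finset.sum_congr rfl fun i _ => ?_
  obtain ⟨m, hm⟩ : ∃ m, m = ∑ k, W i k * v k := ⟨_, rfl⟩
  rw [← hm]
  have : ∑ j, W i j * (v j - m) ^ 2
      = ∑ j, W i j * v j ^ 2 - 2 * m * ∑ j, W i j * v j + m ^ 2 * ∑ j, W i j := by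
    simp only [Finset.mul_sum, ← Finset.sum_sub_distrib, ← Finset.sum_add_distrib]
    exact Finset.sum_congr rfl fun j _ => by ring
  rw [this, hr, ← hm]; ring

/-- If no energy is lost, the sum of weighted variances vanishes, hence so does each of its
nonnegative terms. -/
lemma doublyStochastic_eq_of_energy_le (hW : W ∈ doublyStochastic ℝ (Fin n)) {v : Fin n → ℝ}
    (hv : ∑ i, v i ^ 2 ≤ ∑ i, (∑ j, W i j * v j) ^ 2) {i j : Fin n} (hij : 0 < W i j) :
    v j = ∑ k, W i k * v k := by
  have h0 : ∀ i j, 0 ≤ W i j * (v j - ∑ k, W i k * v k) ^ 2 := fun i j =>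
    mul_nonneg (nonneg_of_mem_doublyStochastic hW) (sq_nonneg _)
  have hle : ∑ i, ∑ j, W i j * (v j - ∑ k, W i k * v k) ^ 2 ≤ 0 := by
    rw [← doublyStochastic_energy hW]; linarith
  have h1 : W i j * (v j - ∑ k, W i k * v k) ^ 2 ≤ 0 := by
    refine le_trans ?_ hle
    refine le_trans ?_ (Finset.single_le_sum (fun i _ => Finset.sum_nonneg fun j _ => h0 i j)
      (Finset.mem_univ i))
    exact Finset.single_le_sum (f := fun j => W i j * (v j - ∑ k, W i k * v k) ^ 2)
      (fun j _ => h0 i j) (Finset.mem_univ j)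
  have h2 : (v j - ∑ k, W i k * v k) ^ 2 = 0 := by
    have := mul_eq_zero.1 (le_antisymm h1 (h0 i j))
    exact this.resolve_left hij.ne'
  exact sub_eq_zero.1 (pow_eq_zero_iff two_ne_zero |>.1 h2)

/-- The positive diagonal turns equality in the energy identity into W v = v. Then a power of W with
positive entries also fixes v, and the same equality case for that power links every pair of users.
-/
lemma IsNetworkMatrix.const_of_energy_le (hW : IsNetworkMatrix W) {v : Fin n → ℝ}
    (hv : ∑ i, v i ^ 2 ≤ ∑ i, (∑ j, W i j * v j) ^ 2) (i j : Fin n) : v i = v j := by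
  have hfix : W.mulVec v = v := by
    funext i
    exact (doublyStochastic_eq_of_energy_le hW.doublyStochastic hv (hW.diag_pos i)).symm
  obtain ⟨k, -, hk⟩ := hW.primitive.exists_pos_pow
  have hfix' : (W ^ k).mulVec v = v := by
    clear hk
    induction k with
    | zero => simp
    | succ k ih => rw [pow_succ, ← Matrix.mulVec_mulVec, hfix, ih]
  have hk' : W ^ k ∈ _root_.doublyStochastic ℝ (Fin n) := pow_mem hW.doublyStochastic k
  have hv' : ∑ i, v i ^ 2 ≤ ∑ i, (∑ j, (W ^ k) i j * v j) ^ 2 := by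
    refine le_of_eq (Finset.sum_congr rfl fun i _ => ?_)
    rw [show ∑ j, (W ^ k) i j * v j = v i from congrFun hfix' i]
  rw [doublyStochastic_eq_of_energy_le hk' hv' (hk i i),
    doublyStochastic_eq_of_energy_le hk' hv' (hk i j)]

open Module LinearMap in
/-- If the vectors that `T` does not shrink are the multiples of a fixed point `u` of `T* T`, then
the second singular value is below `1`, and bounds `T` on the orthogonal complement of `u`. -/
lemma singularValues_one_bound {E : Type*} [NormedAddCommGroup E] [InnerProductSpace ℝ E]
    [FiniteDimensional ℝ E] (T : E →ₗ[ℝ] E) {n : ℕ} (hn : finrank ℝ E = n) (h2 : 2 ≤ n) {u : E}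
    (hu0 : u ≠ 0) (hu : adjoint T (T u) = u) (hshrink : ∀ v, ‖v‖ ≤ ‖T v‖ → ∃ c : ℝ, v = c • u) :
    T.singularValues 1 < 1 ∧ ∀ y, inner ℝ u y = 0 → ‖T y‖ ≤ T.singularValues 1 * ‖y‖ := by
  set hS := T.isSymmetric_adjoint_comp_self
  set b := hS.eigenvectorBasis hn
  set ev := hS.eigenvalues hn with hev
  have hb : ∀ k, adjoint T (T (b k)) = ev k • b k := fun k => hS.apply_eigenvectorBasis hn k
  have hcoord : ∀ v k, inner ℝ (b k) (adjoint T (T v)) = ev k * inner ℝ (b k) v := by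
    intro v k
    rw [adjoint_inner_right, ← adjoint_inner_left, hb, real_inner_smul_left]
  have hnorm : ∀ v, ‖T v‖ ^ 2 = ∑ k, ev k * inner ℝ (b k) v ^ 2 := by
    intro v
    rw [← real_inner_self_eq_norm_sq, ← adjoint_inner_right,
      ← b.sum_inner_mul_inner v (adjoint T (T v))]
    refine Finset.sum_congr rfl fun k _ => ?_
    rw [hcoord, real_inner_comm]; ring
  have hev0 : ∀ k, 0 ≤ ev k := fun k => T.isPositive_adjoint_comp_self.nonneg_eigenvalues hn k
  have hanti : Antitone ev := hS.eigenvalues_antitone hn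
  have h1n : 1 < n := h2
  have hsq : T.singularValues 1 ^ 2 = ev ⟨1, h1n⟩ := T.sq_singularValues_of_lt hn h1n
  have hs0 : 0 ≤ T.singularValues 1 := T.singularValues_nonneg 1
  have hTb : ∀ k, ‖T (b k)‖ ^ 2 = ev k := by
    intro k
    rw [← real_inner_self_eq_norm_sq, ← adjoint_inner_right, hb, real_inner_smul_right,
      real_inner_self_eq_norm_sq, b.norm_eq_one]; ring
  -- Otherwise two orthonormal eigenvectors are not shrunk, so both are multiples of `u`, which is
  -- absurd.
  have hlt : ev ⟨1, h1n⟩ < 1 := by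
    by_contra hcon
    push Not at hcon
    have hge : ∀ k, 1 ≤ ev k → ‖b k‖ ≤ ‖T (b k)‖ := by
      intro k hk
      rw [b.norm_eq_one]
      nlinarith [hTb k, norm_nonneg (T (b k))]
    have h0 : 1 ≤ ev ⟨0, by omega⟩ := hcon.trans (hanti (by simp [Fin.le_def]))
    obtain ⟨c0, hc0⟩ := hshrink _ (hge _ h0)
    obtain ⟨c1, hc1⟩ := hshrink _ (hge _ hcon)
    have horth : inner ℝ (b ⟨0, by omega⟩) (b ⟨1, h1n⟩) = (0 : ℝ) :=
      b.orthonormal.2 (by simp [Fin.ext_iff])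
    have hn0 := b.norm_eq_one ⟨0, by omega⟩
    have hn1 := b.norm_eq_one ⟨1, h1n⟩
    rw [hc0, norm_smul] at hn0
    rw [hc1, norm_smul] at hn1
    rw [hc0, hc1, real_inner_smul_left, real_inner_smul_right, real_inner_self_eq_norm_sq] at horth
    have hne0 : c0 ≠ 0 := by rintro rfl; simp at hn0
    have hne1 : c1 ≠ 0 := by rintro rfl; simp at hn1
    have hneu : ‖u‖ ≠ 0 := by intro h; simp [h] at hn0
    exact (mul_ne_zero hne0 (mul_ne_zero hne1 (pow_ne_zero 2 hneu))) horth
  have hlt' : T.singularValues 1 < 1 := by nlinarith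
  refine ⟨hlt', fun y hy => ?_⟩
  have hle : ∀ k : Fin n, k ≠ ⟨0, by omega⟩ → ev k ≤ ev ⟨1, h1n⟩ := by
    intro k hk
    refine hanti ?_
    have : k.val ≠ 0 := fun h => hk (Fin.ext h)
    rw [Fin.le_def]; change 1 ≤ k.val; omega
  have huk : ∀ k : Fin n, k ≠ ⟨0, by omega⟩ → inner ℝ (b k) u = (0 : ℝ) := by
    intro k hk
    have := hcoord u k
    rw [hu] at this
    have h3 : (1 - ev k) * inner ℝ (b k) u = 0 := by linarith
    exact (mul_eq_zero.1 h3).resolve_left (by linarith [hle k hk])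
  -- Since `u` is orthogonal to every eigenvector but the first, orthogonality of `u` and `y` says
  -- that the product of their first coordinates is zero; that of `u` is nonzero.
  have hsum := b.sum_inner_mul_inner u y
  rw [hy, Finset.sum_eq_single (⟨0, by omega⟩ : Fin n)
    (fun k _ hk => by rw [real_inner_comm, huk k hk, zero_mul]) (by simp)] at hsum
  have hmain : ∀ k : Fin n, ev k * inner ℝ (b k) y ^ 2
      ≤ T.singularValues 1 ^ 2 * (inner ℝ y (b k) * inner ℝ (b k) y) := by
    intro k
    rw [real_inner_comm y, ← pow_two, hsq, real_inner_comm]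
    by_cases hk : k = ⟨0, by omega⟩
    · rcases mul_eq_zero.1 hsum with h | h
      · refine absurd ?_ hu0
        rw [← b.sum_repr' u]
        refine Finset.sum_eq_zero fun j _ => ?_
        by_cases hj : j = ⟨0, by omega⟩
        · rw [hj, real_inner_comm, h, zero_smul]
        · rw [huk j hj, zero_smul]
      · rw [hk, real_inner_comm y] at *
        simp [h]
    · rw [real_inner_comm]
      exact mul_le_mul_of_nonneg_right (hle k hk) (sq_nonneg _)
  have : ‖T y‖ ^ 2 ≤ (T.singularValues 1 * ‖y‖) ^ 2 := by
    rw [hnorm, mul_pow, ← real_inner_self_eq_norm_sq y, ← b.sum_inner_mul_inner y y, Finset.mul_sum]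
    exact Finset.sum_le_sum fun k _ => hmain k
  exact abs_le_of_sq_le_sq' this (by positivity) |>.2

lemma IsNetworkMatrix.secondSingularValue_bound (hn : 2 ≤ n) (hW : IsNetworkMatrix W) :
    secondSingularValue W < 1 ∧ ∀ y : Fin n → ℝ, ∑ i, y i = 0 →
      ∑ i, (∑ j, W i j * y j) ^ 2 ≤ secondSingularValue W ^ 2 * ∑ i, y i ^ 2 := by
  obtain ⟨-, hr, hc⟩ := mem_doublyStochastic_iff_sum.1 hW.doublyStochastic
  have hT : ∀ v : EuclideanSpace ℝ (Fin n), ‖Matrix.toEuclideanLin W v‖ ^ 2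
      = ∑ i, (∑ j, W i j * v j) ^ 2 := by
    intro v
    rw [EuclideanSpace.real_norm_sq_eq]
    rfl
  have key := singularValues_one_bound (Matrix.toEuclideanLin W) (n := n) (by simp) hn
    (u := WithLp.toLp 2 (fun _ => 1)) ?_ ?_ ?_
  · refine ⟨key.1, fun y hy => ?_⟩
    have h := key.2 (WithLp.toLp 2 y) (by simpa [PiLp.inner_apply] using hy)
    have h' := pow_le_pow_left₀ (norm_nonneg _) h 2
    rw [hT, mul_pow, EuclideanSpace.real_norm_sq_eq] at h'
    exact h'
  · intro h
    have := congrFun (congrArg WithLp.ofLp h) ⟨0, by omega⟩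
    simp at this
  · rw [← Matrix.toEuclideanLin_conjTranspose_eq_adjoint]
    ext i
    simp only [Matrix.toLpLin_apply, Matrix.mulVec, dotProduct, mul_one, hr,
      Matrix.conjTranspose_apply, star_trivial, hc]
  · intro v hv
    have hv' := pow_le_pow_left₀ (norm_nonneg _) hv 2
    rw [hT, EuclideanSpace.real_norm_sq_eq] at hv'
    refine ⟨v ⟨0, by omega⟩, ?_⟩
    ext i
    simpa using hW.const_of_energy_le hv' i ⟨0, by omega⟩

lemma secondSingularValue_nonneg : 0 ≤ secondSingularValue W :=
  LinearMap.singularValues_nonneg _ 1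

end Network

/-! ### Consequences of smoothness and strong convexity. -/

section QuadraticBounds

variable {E : Type*} [NormedAddCommGroup E] [InnerProductSpace ℝ E]

/-- Two-sided quadratic bounds on `f` around the tangent planes given by the vector field `g`. -/
structure HasQuadraticBounds (f : E → ℝ) (g : E → E) (μ L : ℝ) : Prop where
  lower : ∀ x y, f y + inner ℝ (g y) (x - y) + μ / 2 * ‖x - y‖ ^ 2 ≤ f x
  upper : ∀ x y, f x ≤ f y + inner ℝ (g y) (x - y) + L / 2 * ‖x - y‖ ^ 2

/-- The descent lemma. -/
lemma le_add_inner_gradient [CompleteSpace E] {f : E → ℝ} {L : ℝ} (hf : Differentiable ℝ f)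
    (hL : ∀ x y, ‖∇ f x - ∇ f y‖ ≤ L * ‖x - y‖) (x y : E) :
    f x ≤ f y + inner ℝ (∇ f y) (x - y) + L / 2 * ‖x - y‖ ^ 2 := by
  set v := x - y with hv
  set h : ℝ → ℝ := fun s => f (y + s • v) - s * inner ℝ (∇ f y) v - L / 2 * ‖v‖ ^ 2 * s ^ 2 with hh
  have hderiv : ∀ s, HasDerivAt h
      (inner ℝ (∇ f (y + s • v)) v - inner ℝ (∇ f y) v - L / 2 * ‖v‖ ^ 2 * (2 * s)) s := by
    intro s
    have h1 : HasDerivAt (fun s : ℝ => y + s • v) v s := by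
      simpa using ((hasDerivAt_id s).smul_const v).const_add y
    have h2 := ((hf (y + s • v)).hasGradientAt.hasFDerivAt).comp_hasDerivAt s h1
    have h3 : HasDerivAt (fun s : ℝ => f (y + s • v)) (inner ℝ (∇ f (y + s • v)) v) s := h2
    have h4 : HasDerivAt (fun s : ℝ => s * inner ℝ (∇ f y) v) (inner ℝ (∇ f y) v) s := by
      simpa using (hasDerivAt_id s).mul_const (inner ℝ (∇ f y) v)
    have h5 : HasDerivAt (fun s : ℝ => L / 2 * ‖v‖ ^ 2 * s ^ 2) (L / 2 * ‖v‖ ^ 2 * (2 * s)) s := by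
      simpa using (hasDerivAt_pow 2 s).const_mul (L / 2 * ‖v‖ ^ 2)
    exact (h3.sub h4).sub h5
  have hanti : AntitoneOn h (Set.Icc 0 1) := by
    refine antitoneOn_of_deriv_nonpos (convex_Icc 0 1)
      (fun s _ => (hderiv s).continuousAt.continuousWithinAt)
      (fun s _ => (hderiv s).differentiableAt.differentiableWithinAt) ?_
    intro s hs
    rw [interior_Icc] at hs
    rw [(hderiv s).deriv, ← inner_sub_left]
    have h1 := real_inner_le_norm (∇ f (y + s • v) - ∇ f y) v
    have h2 := hL (y + s • v) y
    rw [add_sub_cancel_left, norm_smul, Real.norm_of_nonneg hs.1.le] at h2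
    nlinarith [norm_nonneg v, mul_le_mul_of_nonneg_right h2 (norm_nonneg v)]
  have h01 := hanti (Set.left_mem_Icc.2 zero_le_one) (Set.right_mem_Icc.2 zero_le_one) zero_le_one
  simp only [hh, one_smul, zero_smul, add_zero] at h01
  rw [show y + v = x by rw [hv]; abel] at h01
  linarith

variable {f : E → ℝ} {g : E → E} {μ L : ℝ}

/-- Compare the upper bound at y with the lower bound at x, both evaluated at the point reached from
y by a step 1/L along the gradient difference. -/
lemma HasQuadraticBounds.norm_sub_sq_le (h : HasQuadraticBounds f g μ L) (hμ : 0 ≤ μ) (hL : 0 < L)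
    (x y : E) : ‖g y - g x‖ ^ 2 ≤ 2 * L * (f y - f x - inner ℝ (g x) (y - x)) := by
  have h1 := h.lower (y - (1 / L) • (g y - g x)) x
  have h2 := h.upper (y - (1 / L) • (g y - g x)) y
  rw [show y - (1 / L) • (g y - g x) - x = (y - x) - (1 / L) • (g y - g x) by abel,
    inner_sub_right, inner_smul_right] at h1
  rw [sub_sub_cancel_left, inner_neg_right, inner_smul_right, norm_neg, norm_smul, mul_pow,
    Real.norm_of_nonneg (by positivity)] at h2
  have h3 : inner ℝ (g y) (g y - g x) - inner ℝ (g x) (g y - g x) = ‖g y - g x‖ ^ 2 := by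
    rw [← inner_sub_left, real_inner_self_eq_norm_sq]
  have h4 : 0 ≤ μ / 2 * ‖y - x - (1 / L) • (g y - g x)‖ ^ 2 := by positivity
  have h5 : L / 2 * ((1 / L) ^ 2 * ‖g y - g x‖ ^ 2) = 1 / L * ‖g y - g x‖ ^ 2 / 2 := by
    field_simp
  have h6 : 1 / L * ‖g y - g x‖ ^ 2 / 2 ≤ f y - f x - inner ℝ (g x) (y - x) := by
    rw [h5, ← h3] at h2
    rw [← h3]
    linarith
  have h7 := mul_le_mul_of_nonneg_left h6 (by positivity : 0 ≤ 2 * L)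
  rwa [show 2 * L * (1 / L * ‖g y - g x‖ ^ 2 / 2) = ‖g y - g x‖ ^ 2 by field_simp] at h7

lemma HasQuadraticBounds.norm_sq_le (h : HasQuadraticBounds f g μ L) (hL : 0 < L) {xs : E}
    (hmin : ∀ y, f xs ≤ f y) (x : E) : ‖g x‖ ^ 2 ≤ 2 * L * (f x - f xs) := by
  have h2 := (hmin _).trans (h.upper (x - (1 / L) • g x) x)
  rw [sub_sub_cancel_left, inner_neg_right, inner_smul_right, norm_neg, norm_smul, mul_pow,
    Real.norm_of_nonneg (by positivity), real_inner_self_eq_norm_sq] at h2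
  have h5 : L / 2 * ((1 / L) ^ 2 * ‖g x‖ ^ 2) = 1 / L * ‖g x‖ ^ 2 / 2 := by field_simp
  have h7 := mul_le_mul_of_nonneg_left (show 1 / L * ‖g x‖ ^ 2 / 2 ≤ f x - f xs by linarith)
    (by positivity : 0 ≤ 2 * L)
  rwa [show 2 * L * (1 / L * ‖g x‖ ^ 2 / 2) = ‖g x‖ ^ 2 by field_simp] at h7

lemma HasQuadraticBounds.eq_zero_of_min (h : HasQuadraticBounds f g μ L) (hL : 0 < L) {xs : E}
    (hmin : ∀ y, f xs ≤ f y) : g xs = 0 := by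
  have := h.norm_sq_le hL hmin xs
  rw [sub_self, mul_zero] at this
  exact norm_eq_zero.1 (pow_eq_zero_iff two_ne_zero |>.1 (le_antisymm this (sq_nonneg _)))

/-- The Polyak–Łojasiewicz inequality: minimize the quadratic lower bound over the distance. -/
lemma HasQuadraticBounds.le_norm_sq (h : HasQuadraticBounds f g μ L) (hμ : 0 < μ) (x y : E) :
    2 * μ * (f x - f y) ≤ ‖g x‖ ^ 2 := by
  have h1 := h.lower y x
  have h2 := neg_le_of_abs_le (abs_real_inner_le_norm (g x) (y - x))
  nlinarith [sq_nonneg (‖g x‖ - μ * ‖y - x‖), norm_nonneg (y - x)]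

end QuadraticBounds

/-! ### Averages over users and contraction of the disagreement. -/

section Averages

variable {n d : ℕ}

lemma sum_sub_netAvg (hn : 0 < n) (y : Fin n → Vec d) : ∑ i, (y i - netAvg y) = 0 := by
  have : (n : ℝ) ≠ 0 := by positivity
  rw [Finset.sum_sub_distrib, Finset.sum_const, Finset.card_univ, Fintype.card_fin, netAvg,
    ← Nat.cast_smul_eq_nsmul ℝ, smul_smul, mul_one_div_cancel this, one_smul, sub_self]

lemma nsmul_netAvg (hn : 0 < n) (y : Fin n → Vec d) : (n : ℝ) • netAvg y = ∑ i, y i := by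
  have : (n : ℝ) ≠ 0 := by positivity
  rw [netAvg, smul_smul, mul_one_div_cancel this, one_smul]

lemma sum_norm_sub_sq (hn : 0 < n) (y : Fin n → Vec d) (c : Vec d) :
    ∑ i, ‖y i - c‖ ^ 2 = ∑ i, ‖y i - netAvg y‖ ^ 2 + n * ‖netAvg y - c‖ ^ 2 := by
  have h : ∀ i, ‖y i - c‖ ^ 2 = ‖y i - netAvg y‖ ^ 2
      + 2 * inner ℝ (y i - netAvg y) (netAvg y - c) + ‖netAvg y - c‖ ^ 2 := by
    intro i
    rw [← norm_add_sq_real, sub_add_sub_cancel]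
  simp only [h, Finset.sum_add_distrib, ← Finset.mul_sum, ← sum_inner, sum_sub_netAvg hn,
    inner_zero_left, Finset.sum_const, Finset.card_univ, Fintype.card_fin, nsmul_eq_mul]
  ring

lemma netAvg_norm_sq_le (hn : 0 < n) (y : Fin n → Vec d) :
    n * ‖netAvg y‖ ^ 2 ≤ ∑ i, ‖y i‖ ^ 2 := by
  have := sum_norm_sub_sq hn y 0
  simp only [sub_zero] at this
  rw [this]
  exact le_add_of_nonneg_left (by positivity)

lemma sum_norm_sub_netAvg_sq_le (hn : 0 < n) (y : Fin n → Vec d) (c : Vec d) :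
    ∑ i, ‖y i - netAvg y‖ ^ 2 ≤ ∑ i, ‖y i - c‖ ^ 2 := by
  rw [sum_norm_sub_sq hn y c]
  exact le_add_of_nonneg_right (by positivity)

lemma netAvg_add (x y : Fin n → Vec d) : netAvg (fun i => x i + y i) = netAvg x + netAvg y := by
  simp [netAvg, Finset.sum_add_distrib]

lemma netAvg_sub (x y : Fin n → Vec d) : netAvg (fun i => x i - y i) = netAvg x - netAvg y := by
  simp [netAvg, Finset.sum_sub_distrib, smul_sub]

lemma netAvg_smul (c : ℝ) (x : Fin n → Vec d) : netAvg (fun i => c • x i) = c • netAvg x := by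
  rw [netAvg, ← Finset.smul_sum, smul_comm, netAvg]

lemma inner_netAvg (hn : 0 < n) (x : Fin n → Vec d) (v : Vec d) :
    n * inner ℝ (netAvg x) v = ∑ i, inner ℝ (x i) v := by
  rw [← sum_inner, ← nsmul_netAvg hn, real_inner_smul_left]

variable {W : Matrix (Fin n) (Fin n) ℝ}

lemma netAvg_mix (hW : W ∈ doublyStochastic ℝ (Fin n)) (y : Fin n → Vec d) :
    netAvg (fun i => ∑ j, W i j • y j) = netAvg y := by
  obtain ⟨-, -, hc⟩ := mem_doublyStochastic_iff_sum.1 hW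
  rw [netAvg, netAvg, Finset.sum_comm]
  simp only [← Finset.sum_smul, hc, one_smul]

/-- One averaging step contracts the disagreement. -/
lemma IsNetworkMatrix.sum_norm_mix_sq_le (hn : 2 ≤ n) (hW : IsNetworkMatrix W)
    (y : Fin n → Vec d) :
    ∑ i, ‖(∑ j, W i j • y j) - netAvg y‖ ^ 2
      ≤ secondSingularValue W ^ 2 * ∑ i, ‖y i - netAvg y‖ ^ 2 := by
  obtain ⟨-, hr, -⟩ := mem_doublyStochastic_iff_sum.1 hW.doublyStochastic
  have h0 := sum_sub_netAvg (by omega : 0 < n) y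
  have hmix : ∀ i, (∑ j, W i j • y j) - netAvg y = ∑ j, W i j • (y j - netAvg y) := by
    intro i
    simp only [smul_sub, Finset.sum_sub_distrib, ← Finset.sum_smul, hr, one_smul]
  simp only [hmix, EuclideanSpace.real_norm_sq_eq]
  rw [Finset.sum_comm, Finset.sum_comm (γ := Fin n), Finset.mul_sum]
  refine Finset.sum_le_sum fun k _ => ?_
  have := (hW.secondSingularValue_bound hn).2 (fun j => (y j - netAvg y) k) (by
    have := congrFun (congrArg WithLp.ofLp h0) k
    simpa using this)
  simpa using this

end Averages

/-! ### Deterministic estimates for one iteration. -/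

section OneStep

variable {n d : ℕ} {f : Fin n → Vec d → ℝ} {g : Fin n → Vec d → Vec d} {μ L : ℝ}

lemma hasQuadraticBounds_avg (hn : 0 < n) (h : ∀ i, HasQuadraticBounds (f i) (g i) μ L) :
    HasQuadraticBounds (fun x => (1 / (n : ℝ)) * ∑ i, f i x) (fun x => netAvg (fun i => g i x))
      μ L := by
  have hn' : (0 : ℝ) < n := by positivity
  have key : ∀ (x y : Vec d) (c : ℝ), (1 / (n : ℝ)) * ∑ i, f i y
      + inner ℝ (netAvg (fun i => g i y)) (x - y) + c
      = (1 / (n : ℝ)) * ∑ i, (f i y + inner ℝ (g i y) (x - y) + c) := by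
    intro x y c
    rw [Finset.sum_add_distrib, Finset.sum_add_distrib, ← inner_netAvg hn]
    simp only [Finset.sum_const, Finset.card_univ, Fintype.card_fin, nsmul_eq_mul]
    field_simp
  constructor
  · intro x y
    rw [key]
    exact mul_le_mul_of_nonneg_left (Finset.sum_le_sum fun i _ => (h i).lower x y) (by positivity)
  · intro x y
    rw [key]
    exact mul_le_mul_of_nonneg_left (Finset.sum_le_sum fun i _ => (h i).upper x y) (by positivity)

/-- Gradient at disagreeing models against the gradient at their average. -/
lemma norm_netAvg_grad_sub_sq_le (hn : 0 < n) (hlip : ∀ i x y, ‖g i x - g i y‖ ≤ L * ‖x - y‖)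
    (X : Fin n → Vec d) (c : Vec d) :
    n * ‖netAvg (fun i => g i (X i)) - netAvg (fun i => g i c)‖ ^ 2
      ≤ L ^ 2 * ∑ i, ‖X i - c‖ ^ 2 := by
  rw [← netAvg_sub]
  refine (netAvg_norm_sq_le hn _).trans ?_
  rw [Finset.mul_sum]
  refine Finset.sum_le_sum fun i _ => ?_
  rw [← mul_pow]
  exact pow_le_pow_left₀ (norm_nonneg _) (hlip i _ _) 2

/-- Each local gradient is taken at the user's own model: strong convexity goes from there to the
minimizer, smoothness from there to the average. The difference of the two bounds isolates the inner
product. -/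
lemma le_inner_netAvg_grad (hn : 0 < n) (h : ∀ i, HasQuadraticBounds (f i) (g i) μ L)
    (hμ : 0 ≤ μ) (X : Fin n → Vec d) (xs : Vec d) :
    ∑ i, f i (netAvg X) - ∑ i, f i xs + n * (μ / 2 * ‖netAvg X - xs‖ ^ 2)
        - L / 2 * ∑ i, ‖X i - netAvg X‖ ^ 2
      ≤ n * inner ℝ (netAvg (fun i => g i (X i))) (netAvg X - xs) := by
  have hi : ∀ i, f i (netAvg X) - f i xs + μ / 2 * ‖X i - xs‖ ^ 2
      - L / 2 * ‖X i - netAvg X‖ ^ 2 ≤ inner ℝ (g i (X i)) (netAvg X - xs) := by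
    intro i
    have h1 := (h i).lower xs (X i)
    have h2 := (h i).upper (netAvg X) (X i)
    rw [norm_sub_rev xs] at h1
    rw [norm_sub_rev (netAvg X)] at h2
    have h3 : inner ℝ (g i (X i)) (netAvg X - xs) = inner ℝ (g i (X i)) (netAvg X - X i)
        - inner ℝ (g i (X i)) (xs - X i) := by
      rw [← inner_sub_right]; congr 1; abel
    rw [h3]; linarith
  rw [inner_netAvg hn]
  refine le_trans ?_ (Finset.sum_le_sum fun i _ => hi i)
  rw [Finset.sum_sub_distrib, Finset.sum_add_distrib, Finset.sum_sub_distrib, ← Finset.mul_sum,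
    ← Finset.mul_sum, sum_norm_sub_sq hn X xs]
  have : 0 ≤ μ / 2 * ∑ i, ‖X i - netAvg X‖ ^ 2 := by positivity
  linarith

/-- A noiseless step of the averaged model contracts the distance to the minimizer. -/
lemma norm_avg_step_sub_sq_le (hn : 0 < n) (h : ∀ i, HasQuadraticBounds (f i) (g i) μ L)
    (hlip : ∀ i x y, ‖g i x - g i y‖ ≤ L * ‖x - y‖) (hμ : 0 ≤ μ) (hL : 0 < L) {α : ℝ}
    (hα0 : 0 ≤ α) (hα : α * L ≤ 1 / 2) {xs : Vec d}
    (hmin : ∀ y, (1 / (n : ℝ)) * ∑ i, f i xs ≤ (1 / (n : ℝ)) * ∑ i, f i y) (X : Fin n → Vec d) :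
    n * ‖netAvg X - α • netAvg (fun i => g i (X i)) - xs‖ ^ 2
      ≤ (1 - α * μ) * (n * ‖netAvg X - xs‖ ^ 2)
        - 2 / 3 * α * (n * ((1 / (n : ℝ)) * ∑ i, f i (netAvg X) - (1 / (n : ℝ)) * ∑ i, f i xs))
        + 3 * α * L * ∑ i, ‖X i - netAvg X‖ ^ 2 := by
  have hn' : (0 : ℝ) < n := by positivity
  have hin := le_inner_netAvg_grad hn h hμ X xs
  have hd := norm_netAvg_grad_sub_sq_le hn hlip X (netAvg X)
  have hF := (hasQuadraticBounds_avg hn h).norm_sq_le hL hmin (netAvg X)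
  set D := (1 / (n : ℝ)) * ∑ i, f i (netAvg X) - (1 / (n : ℝ)) * ∑ i, f i xs with hD
  set G := netAvg (fun i => g i (X i))
  set G0 := netAvg (fun i => g i (netAvg X))
  set Q := ∑ i, ‖X i - netAvg X‖ ^ 2
  have hnD : ∑ i, f i (netAvg X) - ∑ i, f i xs = n * D := by
    rw [hD]; field_simp
  rw [hnD] at hin
  have hQ : 0 ≤ Q := Finset.sum_nonneg fun i _ => sq_nonneg _
  have hD0 : 0 ≤ D := sub_nonneg.2 (hmin _)
  clear_value Q G G0 D
  have hexp : ‖netAvg X - α • G - xs‖ ^ 2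
      = ‖netAvg X - xs‖ ^ 2 - 2 * α * inner ℝ G (netAvg X - xs) + α ^ 2 * ‖G‖ ^ 2 := by
    rw [show netAvg X - α • G - xs = (netAvg X - xs) - α • G by abel, norm_sub_sq_real,
      inner_smul_right, real_inner_comm, norm_smul, mul_pow, Real.norm_of_nonneg hα0]
    ring
  -- Young's inequality with factors 1 + 1/3 and 1 + 3. With αL ≤ 1/2 the first uses up only 4/3 of
  -- the gain 2α n D, which leaves 2/3.
  have hG : ‖G‖ ^ 2 ≤ 4 / 3 * ‖G0‖ ^ 2 + 4 * ‖G - G0‖ ^ 2 := by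
    have h1 : ‖G‖ ≤ ‖G0‖ + ‖G - G0‖ := by
      simpa using norm_add_le G0 (G - G0)
    have h2 := pow_le_pow_left₀ (norm_nonneg _) h1 2
    nlinarith [sq_nonneg (‖G0‖ - 3 * ‖G - G0‖)]
  have hG' : n * ‖G‖ ^ 2 ≤ 4 / 3 * (n * (2 * L * D)) + 4 * (L ^ 2 * Q) := by
    have a1 := mul_le_mul_of_nonneg_left hF hn'.le
    have a2 := mul_le_mul_of_nonneg_left hG hn'.le
    have a3 : n * (4 / 3 * ‖G0‖ ^ 2 + 4 * ‖G - G0‖ ^ 2)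
        = 4 / 3 * (n * ‖G0‖ ^ 2) + 4 * (n * ‖G - G0‖ ^ 2) := by ring
    linarith
  have h1 : α ^ 2 * (n * ‖G‖ ^ 2) ≤ 4 / 3 * α * (n * D) + 2 * α * L * Q := by
    refine (mul_le_mul_of_nonneg_left hG' (sq_nonneg α)).trans ?_
    have e1 : 0 ≤ α * (n * D) * (1 - 2 * (α * L)) := by
      have : 0 ≤ 1 - 2 * (α * L) := by linarith
      positivity
    have e2 : 0 ≤ α * L * Q * (1 - 2 * (α * L)) := by
      have : 0 ≤ 1 - 2 * (α * L) := by linarith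
      positivity
    linarith
  rw [hexp]
  have h2 := mul_le_mul_of_nonneg_left hin (by positivity : 0 ≤ 2 * α)
  linarith

/-- Descent of the global cost along a noisy step of the averaged model. -/
lemma avg_step_cost_le (hn : 0 < n) (h : ∀ i, HasQuadraticBounds (f i) (g i) μ L)
    (hlip : ∀ i x y, ‖g i x - g i y‖ ≤ L * ‖x - y‖) (hL : 0 < L) {α : ℝ}
    (hα0 : 0 ≤ α) (hα : α * L ≤ 1 / 2) (X : Fin n → Vec d) (z : Vec d) :
    (1 / (n : ℝ)) * ∑ i, f i (netAvg X - α • (netAvg (fun i => g i (X i)) + z))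
      ≤ (1 / (n : ℝ)) * ∑ i, f i (netAvg X)
        - α / 2 * ‖netAvg (fun i => g i (netAvg X))‖ ^ 2
        + α * L ^ 2 / (2 * n) * ∑ i, ‖X i - netAvg X‖ ^ 2
        - α * inner ℝ (netAvg (fun i => g i (netAvg X))) z + α ^ 2 * L * ‖z‖ ^ 2 := by
  have hn' : (0 : ℝ) < n := by positivity
  have hd := norm_netAvg_grad_sub_sq_le hn hlip X (netAvg X)
  have hup := (hasQuadraticBounds_avg hn h).upper
    (netAvg X - α • (netAvg (fun i => g i (X i)) + z)) (netAvg X)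
  set G := netAvg (fun i => g i (X i))
  set G0 := netAvg (fun i => g i (netAvg X))
  set Q := ∑ i, ‖X i - netAvg X‖ ^ 2
  rw [sub_sub_cancel_left, inner_neg_right, inner_smul_right, norm_neg, norm_smul, mul_pow,
    Real.norm_of_nonneg hα0, inner_add_right] at hup
  have h1 : ‖G + z‖ ^ 2 ≤ 2 * ‖G‖ ^ 2 + 2 * ‖z‖ ^ 2 := by
    have := pow_le_pow_left₀ (norm_nonneg _) (norm_add_le G z) 2
    nlinarith [sq_nonneg (‖G‖ - ‖z‖)]
  -- Polarization of -α⟨G0, G⟩ supplies -α/2 ‖G‖², which cancels the second-order term since αL ≤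
  -- 1/2.
  have h2 : ‖G - G0‖ ^ 2 = ‖G‖ ^ 2 - 2 * inner ℝ G0 G + ‖G0‖ ^ 2 := by
    rw [norm_sub_sq_real, real_inner_comm]
  have h3 : ‖G - G0‖ ^ 2 ≤ L ^ 2 / n * Q := by
    rw [div_mul_eq_mul_div, le_div_iff₀ hn']; linarith
  have h4 : L / 2 * (α ^ 2 * ‖G + z‖ ^ 2) ≤ α / 2 * ‖G‖ ^ 2 + α ^ 2 * L * ‖z‖ ^ 2 := by
    have e1 := mul_le_mul_of_nonneg_left h1 (by positivity : 0 ≤ L / 2 * α ^ 2)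
    have e2 : 0 ≤ α * ‖G‖ ^ 2 * (1 / 2 - α * L) := by
      have : 0 ≤ 1 / 2 - α * L := by linarith
      positivity
    linarith
  have h5 := mul_le_mul_of_nonneg_left h3 (by positivity : 0 ≤ α / 2)
  have h6 : α / 2 * (L ^ 2 / n * Q) = α * L ^ 2 / (2 * n) * Q := by field_simp
  rw [h6, h2] at h5
  linarith

/-- Disagreement after a noiseless gradient step. -/
lemma disagreement_step_le (hn : 0 < n) (h : ∀ i, HasQuadraticBounds (f i) (g i) μ L)
    (hlip : ∀ i x y, ‖g i x - g i y‖ ≤ L * ‖x - y‖) (hμ : 0 ≤ μ) (hL : 0 < L) {α lam : ℝ}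
    (hα0 : 0 ≤ α) (hl0 : 0 ≤ lam) (hl1 : lam < 1) (hα : α * L * lam ≤ 4 / 25 * (1 - lam))
    {xs : Vec d}
    (hmin : ∀ y, (1 / (n : ℝ)) * ∑ i, f i xs ≤ (1 / (n : ℝ)) * ∑ i, f i y) (X : Fin n → Vec d) :
    lam ^ 2 * ∑ i, ‖(X i - α • g i (X i)) - netAvg (fun j => X j - α • g j (X j))‖ ^ 2
      ≤ (1 - 21 / 25 * (1 - lam)) ^ 2 / (1 - 7 / 10 * (1 - lam)) * ∑ i, ‖X i - netAvg X‖ ^ 2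
        + 10 / (7 * (1 - lam)) * (lam ^ 2 * α ^ 2)
          * (5 / 2 * L * (n * ((1 / (n : ℝ)) * ∑ i, f i (netAvg X) - (1 / (n : ℝ)) * ∑ i, f i xs))
            + 5 * ∑ i, ‖g i xs‖ ^ 2) := by
  have hn' : (0 : ℝ) < n := by positivity
  set c := netAvg X
  obtain ⟨b, hb⟩ : ∃ b, b = 1 - lam := ⟨_, rfl⟩
  have hb0 : 0 < b := by linarith
  have hb1 : b ≤ 1 := by linarith
  rw [← hb] at hα ⊢
  have hd : 0 < 1 - 7 / 10 * b := by linarith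
  -- The local gradients at the minimizer need not vanish, but their sum does; summing over users
  -- therefore removes the linear terms of the local Bregman divergences.
  have hzero : ∑ i, inner ℝ (g i xs) (c - xs) = (0 : ℝ) := by
    rw [← inner_netAvg hn]
    have : netAvg (fun i => g i xs) = 0 := (hasQuadraticBounds_avg hn h).eq_zero_of_min hL hmin
    rw [this]; simp
  have hG : ∑ i, ‖g i c - g i xs‖ ^ 2
      ≤ 2 * L * (n * ((1 / (n : ℝ)) * ∑ i, f i c - (1 / (n : ℝ)) * ∑ i, f i xs)) := by
    refine (Finset.sum_le_sum fun i _ => (h i).norm_sub_sq_le hμ hL xs c).trans (le_of_eq ?_)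
    rw [← Finset.mul_sum, Finset.sum_sub_distrib, hzero, Finset.sum_sub_distrib]
    field_simp
    ring
  have hG2 : ∑ i, ‖g i c‖ ^ 2 ≤ 5 / 4 * ∑ i, ‖g i c - g i xs‖ ^ 2 + 5 * ∑ i, ‖g i xs‖ ^ 2 := by
    rw [Finset.mul_sum, Finset.mul_sum, ← Finset.sum_add_distrib]
    refine Finset.sum_le_sum fun i _ => ?_
    have h1 : ‖g i c‖ ≤ ‖g i c - g i xs‖ + ‖g i xs‖ := by
      simpa using norm_add_le (g i c - g i xs) (g i xs)
    have h2 := pow_le_pow_left₀ (norm_nonneg _) h1 2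
    nlinarith [sq_nonneg (‖g i c - g i xs‖ - 4 * ‖g i xs‖)]
  have hstep : ∀ i, lam ^ 2 * ‖(X i - α • g i (X i)) - c‖ ^ 2
      ≤ (1 - 21 / 25 * b) ^ 2 / (1 - 7 / 10 * b) * ‖X i - c‖ ^ 2
        + 10 / (7 * b) * (lam ^ 2 * α ^ 2) * ‖g i c‖ ^ 2 := by
    intro i
    have h1 : ‖(X i - α • g i (X i)) - c‖ ≤ ‖X i - c‖ + α * (L * ‖X i - c‖) + α * ‖g i c‖ := by
      have e : (X i - α • g i (X i)) - c = (X i - c) - α • (g i (X i) - g i c) - α • g i c := by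
        rw [smul_sub]; abel
      rw [e]
      refine (norm_sub_le _ _).trans ?_
      rw [norm_smul, Real.norm_of_nonneg hα0]
      gcongr
      refine (norm_sub_le _ _).trans ?_
      rw [norm_smul, Real.norm_of_nonneg hα0]
      gcongr
      exact hlip i _ _
    -- The step-size condition gives λ(1 + αL) ≤ 1 - b + 4b/25 = 1 - 21b/25.
    have h2 : lam * ‖(X i - α • g i (X i)) - c‖
        ≤ (1 - 21 / 25 * b) * ‖X i - c‖ + lam * α * ‖g i c‖ := by
      have := mul_le_mul_of_nonneg_left h1 hl0
      have e : lam = 1 - b := by linarith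
      have h' := mul_le_mul_of_nonneg_right hα (norm_nonneg (X i - c))
      have e' : lam * ‖X i - c‖ = (1 - b) * ‖X i - c‖ := by rw [e]
      linarith
    have h3 := pow_le_pow_left₀ (by positivity) h2 2
    -- Young's inequality with the convex weights 1 - 7b/10 and 7b/10, which keeps the factor of the
    -- disagreement below 1.
    have h4 : ∀ p q : ℝ, (p + q) ^ 2 ≤ p ^ 2 / (1 - 7 / 10 * b) + 10 / (7 * b) * q ^ 2 := by
      intro p q
      have : p ^ 2 / (1 - 7 / 10 * b) + 10 / (7 * b) * q ^ 2 - (p + q) ^ 2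
          = (7 / 10 * b * p - (1 - 7 / 10 * b) * q) ^ 2 / ((1 - 7 / 10 * b) * (7 / 10 * b)) := by
        have hd' : 10 - 7 * b ≠ 0 := by linarith
        have hd2 : 1 - 7 / 10 * b = (10 - 7 * b) / 10 := by ring
        rw [hd2]
        field_simp
        ring
      have h0 : 0 ≤ (7 / 10 * b * p - (1 - 7 / 10 * b) * q) ^ 2
          / ((1 - 7 / 10 * b) * (7 / 10 * b)) := by positivity
      linarith
    have h5 := h4 ((1 - 21 / 25 * b) * ‖X i - c‖) (lam * α * ‖g i c‖)
    rw [mul_pow] at h3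
    refine (h3.trans h5).trans (le_of_eq ?_)
    ring
  calc lam ^ 2 * ∑ i, ‖(X i - α • g i (X i)) - netAvg (fun j => X j - α • g j (X j))‖ ^ 2
      ≤ lam ^ 2 * ∑ i, ‖(X i - α • g i (X i)) - c‖ ^ 2 :=
        mul_le_mul_of_nonneg_left (sum_norm_sub_netAvg_sq_le hn _ c) (sq_nonneg _)
    _ ≤ ∑ i, ((1 - 21 / 25 * b) ^ 2 / (1 - 7 / 10 * b) * ‖X i - c‖ ^ 2
        + 10 / (7 * b) * (lam ^ 2 * α ^ 2) * ‖g i c‖ ^ 2) := by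
        rw [Finset.mul_sum]; exact Finset.sum_le_sum fun i _ => hstep i
    _ = (1 - 21 / 25 * b) ^ 2 / (1 - 7 / 10 * b) * ∑ i, ‖X i - c‖ ^ 2
        + 10 / (7 * b) * (lam ^ 2 * α ^ 2) * ∑ i, ‖g i c‖ ^ 2 := by
        rw [Finset.sum_add_distrib, ← Finset.mul_sum, ← Finset.mul_sum]
    _ ≤ _ := by
        gcongr
        linarith

/-- Disagreement after a noisy gradient step followed by averaging. -/
lemma IsNetworkMatrix.disagreement_mix_le {W : Matrix (Fin n) (Fin n) ℝ} (hn : 2 ≤ n)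
    (hW : IsNetworkMatrix W) (α : ℝ) (y z : Fin n → Vec d) :
    ∑ i, ‖(∑ j, W i j • (y j - α • z j)) - netAvg (fun j => y j - α • z j)‖ ^ 2
      ≤ secondSingularValue W ^ 2 * (∑ i, ‖y i - netAvg y‖ ^ 2
        - 2 * α * ∑ i, inner ℝ (y i - netAvg y) (z i) + α ^ 2 * ∑ i, ‖z i‖ ^ 2) := by
  have hn0 : 0 < n := by omega
  refine (hW.sum_norm_mix_sq_le hn _).trans (mul_le_mul_of_nonneg_left ?_ (sq_nonneg _))
  refine (sum_norm_sub_netAvg_sq_le hn0 _ (netAvg y)).trans (le_of_eq ?_)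
  rw [Finset.mul_sum, Finset.mul_sum, ← Finset.sum_sub_distrib, ← Finset.sum_add_distrib]
  refine Finset.sum_congr rfl fun i _ => ?_
  rw [show y i - α • z i - netAvg y = (y i - netAvg y) - α • z i by abel, norm_sub_sq_real,
    inner_smul_right, norm_smul, mul_pow, Real.norm_eq_abs, sq_abs]
  ring

/-- Expanding around the average makes the linear terms cancel, so passing from the average to the
users costs only disagreement. -/
lemma avg_cost_le (hn : 0 < n) (h : ∀ i, HasQuadraticBounds (f i) (g i) μ L) (X : Fin n → Vec d)
    (c : ℝ) :
    (1 / (n : ℝ)) * ∑ j, ((1 / (n : ℝ)) * ∑ i, f i (X j) - c)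
      ≤ (1 / (n : ℝ)) * ∑ i, f i (netAvg X) - c + L / (2 * n) * ∑ i, ‖X i - netAvg X‖ ^ 2 := by
  have hn' : (0 : ℝ) < n := by positivity
  have h1 := Finset.sum_le_sum fun j (_ : j ∈ Finset.univ) =>
    sub_le_sub_right ((hasQuadraticBounds_avg hn h).upper (X j) (netAvg X)) c
  have h2 := mul_le_mul_of_nonneg_left h1 (by positivity : 0 ≤ 1 / (n : ℝ))
  refine h2.trans (le_of_eq ?_)
  rw [Finset.sum_sub_distrib, Finset.sum_add_distrib, Finset.sum_add_distrib, ← inner_sum,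
    sum_sub_netAvg hn, inner_zero_right]
  simp only [← Finset.mul_sum, Finset.sum_const, Finset.card_univ, Fintype.card_fin, nsmul_eq_mul]
  field_simp
  ring

end OneStep

/-! ### Exponential moments of a single sub-Gaussian vector. -/

section Noise

variable {Ω : Type*} [MeasurableSpace Ω] {P : Measure Ω}

lemma lintegral_ofReal_exp_le {u h : Ω → ℝ} {C : ℝ} (hle : ∀ ω, Real.exp (u ω) ≤ h ω)
    (hh : Integrable h P) (hC : ∫ ω, h ω ∂P ≤ C) :
    ∫⁻ ω, ENNReal.ofReal (Real.exp (u ω)) ∂P ≤ ENNReal.ofReal C := by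
  refine (lintegral_mono fun ω => ENNReal.ofReal_le_ofReal (hle ω)).trans ?_
  rw [← ofReal_integral_eq_lintegral_ofReal hh
    (Filter.Eventually.of_forall fun ω => (Real.exp_pos _).le.trans (hle ω))]
  exact ENNReal.ofReal_le_ofReal hC

lemma exp_le_add_exp_sq (x : ℝ) : Real.exp x ≤ x + Real.exp (x ^ 2) := by
  have h2 := Real.add_one_le_exp (x ^ 2)
  rcases le_or_gt |x| 1 with h | h
  · have := (abs_le.1 (Real.abs_exp_sub_one_sub_id_le h)).2
    linarith
  · rcases lt_abs.1 h with h | h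
    · have : Real.exp x ≤ Real.exp (x ^ 2) := Real.exp_le_exp.2 (by nlinarith)
      linarith
    · have : Real.exp x ≤ 1 := Real.exp_le_one_iff.2 (by linarith)
      nlinarith

/-- A pointwise form of Jensen's inequality: if E exp(y) ≤ e, the right side has expectation at most
exp(c). It is convexity of exp between 0 and y - 1. -/
lemma exp_mul_le_affine {c : ℝ} (hc0 : 0 ≤ c) (hc1 : c ≤ 1) (y : ℝ) :
    Real.exp (c * y) ≤ Real.exp c * (c * Real.exp (-1) * Real.exp y + (1 - c)) := by
  have h := convexOn_exp.2 (Set.mem_univ (y - 1)) (Set.mem_univ 0) hc0 (by linarith : 0 ≤ 1 - c)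
    (by ring)
  simp only [smul_eq_mul, mul_zero, add_zero, Real.exp_zero, mul_one] at h
  have e1 : Real.exp (c * y) = Real.exp c * Real.exp (c * (y - 1)) := by
    rw [← Real.exp_add]; congr 1; ring
  have e2 : Real.exp (y - 1) = Real.exp (-1) * Real.exp y := by
    rw [← Real.exp_add]; congr 1; ring
  rw [e1, mul_assoc c, ← e2]
  exact mul_le_mul_of_nonneg_left h (Real.exp_pos _).le

variable {d : ℕ}

/-- A centred random vector `z` with `E exp(‖z‖² / s²) ≤ e`. -/
structure IsSubGaussianNoise (P : Measure Ω) (z : Ω → Vec d) (s : ℝ) : Prop where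
  measurable : Measurable z
  integrable : Integrable z P
  integral_eq_zero : ∫ ω, z ω ∂P = 0
  integrable_exp : Integrable (fun ω => Real.exp (‖z ω‖ ^ 2 / s ^ 2)) P
  integral_exp_le : ∫ ω, Real.exp (‖z ω‖ ^ 2 / s ^ 2) ∂P ≤ Real.exp 1

variable {z : Ω → Vec d} {s : ℝ}

lemma IsSubGaussianNoise.integral_affine [IsProbabilityMeasure P] (h : IsSubGaussianNoise P z s)
    {c : ℝ} (hc0 : 0 ≤ c) :
    Integrable (fun ω => Real.exp c *
        (c * Real.exp (-1) * Real.exp (‖z ω‖ ^ 2 / s ^ 2) + (1 - c))) P ∧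
      ∫ ω, Real.exp c * (c * Real.exp (-1) * Real.exp (‖z ω‖ ^ 2 / s ^ 2) + (1 - c)) ∂P
        ≤ Real.exp c := by
  have h1 := (h.integrable_exp.const_mul (c * Real.exp (-1)))
  refine ⟨(h1.add (integrable_const _)).const_mul _, ?_⟩
  rw [integral_const_mul, integral_add h1 (integrable_const _), integral_const_mul, integral_const,
    probReal_univ, one_smul]
  have h2 : c * Real.exp (-1) * ∫ ω, Real.exp (‖z ω‖ ^ 2 / s ^ 2) ∂P ≤ c := by
    refine (mul_le_mul_of_nonneg_left h.integral_exp_le (by positivity)).trans (le_of_eq ?_)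
    rw [mul_assoc, ← Real.exp_add]; simp
  have := mul_le_mul_of_nonneg_left (show c * Real.exp (-1) *
    ∫ ω, Real.exp (‖z ω‖ ^ 2 / s ^ 2) ∂P + (1 - c) ≤ 1 by linarith) (Real.exp_pos c).le
  linarith

lemma IsSubGaussianNoise.lintegral_exp_norm_sq_le [IsProbabilityMeasure P]
    (h : IsSubGaussianNoise P z s) (hs : 0 < s) {γ : ℝ} (hγ : 0 ≤ γ) (hγs : γ * s ^ 2 ≤ 1) :
    ∫⁻ ω, ENNReal.ofReal (Real.exp (γ * ‖z ω‖ ^ 2)) ∂P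
      ≤ ENNReal.ofReal (Real.exp (γ * s ^ 2)) := by
  obtain ⟨h1, h2⟩ := h.integral_affine (c := γ * s ^ 2) (by positivity)
  refine lintegral_ofReal_exp_le (fun ω => ?_) h1 h2
  have := exp_mul_le_affine (by positivity) hγs (‖z ω‖ ^ 2 / s ^ 2)
  rwa [show γ * s ^ 2 * (‖z ω‖ ^ 2 / s ^ 2) = γ * ‖z ω‖ ^ 2 by field_simp] at this

/-- For small v, use exp(x) ≤ x + exp(x²), whose linear term has mean zero. For large v centring is
not needed: by Young, ⟨v, z⟩ ≤ ‖v‖²s²/2 + ‖z‖²/(2s²), and the resulting extra 1/2 in the exponent is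
at most ‖v‖²s²/2. -/
lemma IsSubGaussianNoise.lintegral_exp_inner_le [IsProbabilityMeasure P]
    (h : IsSubGaussianNoise P z s) (hs : 0 < s) (v : Vec d) :
    ∫⁻ ω, ENNReal.ofReal (Real.exp (inner ℝ v (z ω))) ∂P
      ≤ ENNReal.ofReal (Real.exp (‖v‖ ^ 2 * s ^ 2)) := by
  rcases le_or_gt (‖v‖ ^ 2 * s ^ 2) 1 with hv | hv
  · obtain ⟨h1, h2⟩ := h.integral_affine (c := ‖v‖ ^ 2 * s ^ 2) (by positivity)
    have hi : Integrable (fun ω => inner ℝ v (z ω)) P := h.integrable.const_inner v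
    have hi0 : ∫ ω, inner ℝ v (z ω) ∂P = 0 := by
      rw [integral_inner h.integrable, h.integral_eq_zero, inner_zero_right]
    refine lintegral_ofReal_exp_le (fun ω => ?_) (hi.add h1) ?_
    · have h3 := exp_le_add_exp_sq (inner ℝ v (z ω))
      have h4 : Real.exp (inner ℝ v (z ω) ^ 2)
          ≤ Real.exp (‖v‖ ^ 2 * s ^ 2 * (‖z ω‖ ^ 2 / s ^ 2)) := by
        refine Real.exp_le_exp.2 ?_
        rw [show ‖v‖ ^ 2 * s ^ 2 * (‖z ω‖ ^ 2 / s ^ 2) = (‖v‖ * ‖z ω‖) ^ 2 by field_simp]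
        exact sq_le_sq' (neg_le_of_abs_le (abs_real_inner_le_norm _ _)) (real_inner_le_norm _ _)
      have h5 := exp_mul_le_affine (by positivity) hv (‖z ω‖ ^ 2 / s ^ 2)
      simp only [Pi.add_apply]
      linarith
    · simp only [Pi.add_apply]
      rw [integral_add hi h1, hi0, zero_add]
      exact h2
  · obtain ⟨h1, h2⟩ := h.integral_affine (c := 1 / 2) (by norm_num)
    refine lintegral_ofReal_exp_le (fun ω => ?_) (h1.const_mul (Real.exp (‖v‖ ^ 2 * s ^ 2 / 2))) ?_
    · have h5 := exp_mul_le_affine (c := 1 / 2) (by norm_num) (by norm_num) (‖z ω‖ ^ 2 / s ^ 2)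
      refine le_trans ?_ (mul_le_mul_of_nonneg_left h5 (Real.exp_pos _).le)
      rw [← Real.exp_add]
      refine Real.exp_le_exp.2 ((real_inner_le_norm _ _).trans ?_)
      have : ‖z ω‖ = s * (‖z ω‖ / s) := by field_simp
      rw [← div_pow]
      obtain ⟨w, hw⟩ : ∃ w, w = ‖z ω‖ / s := ⟨_, rfl⟩
      rw [← hw] at this ⊢
      rw [this]
      nlinarith [sq_nonneg (‖v‖ * s - w)]
    · rw [integral_const_mul]
      refine (mul_le_mul_of_nonneg_left h2 (Real.exp_pos _).le).trans ?_
      rw [← Real.exp_add]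
      exact Real.exp_le_exp.2 (by linarith)

/-- The moment generating function of the square of a sub-Gaussian variable, by averaging the
linear bound against a Gaussian. -/
lemma lintegral_exp_sq_le [SFinite P] {Y : Ω → ℝ} (hY : Measurable Y) {τ : ℝ} (hτ : 0 ≤ τ)
    (hmgf : ∀ r : ℝ, ∫⁻ ω, ENNReal.ofReal (Real.exp (r * Y ω)) ∂P
      ≤ ENNReal.ofReal (Real.exp (r ^ 2 * τ)))
    {c : ℝ} (hc : 0 ≤ c) (hcτ : c * τ ≤ 1 / 8) :
    ∫⁻ ω, ENNReal.ofReal (Real.exp (c * Y ω ^ 2)) ∂P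
      ≤ ENNReal.ofReal (Real.exp (4 * c * τ)) := by
  have hg : ∀ y : ℝ, ENNReal.ofReal (Real.exp (c * y ^ 2))
      = ∫⁻ x, ENNReal.ofReal (Real.exp (√(2 * c) * x * y)) ∂(gaussianReal 0 1) := by
    intro y
    have h1 : Integrable (fun x => Real.exp (√(2 * c) * y * x)) (gaussianReal 0 1) :=
      integrable_exp_mul_gaussianReal _
    have h2 := congrFun (mgf_id_gaussianReal (μ := 0) (v := 1)) (√(2 * c) * y)
    rw [mgf] at h2
    simp only [id] at h2
    simp only [mul_right_comm _ _ y]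
    rw [← ofReal_integral_eq_lintegral_ofReal h1
      (Filter.Eventually.of_forall fun x => (Real.exp_pos _).le), h2]
    congr 2
    rw [mul_pow, Real.sq_sqrt (by positivity)]
    simp; ring
  have hk : 4 * c * τ ≤ 1 / 2 := by linarith
  have hint : ∫⁻ x, ENNReal.ofReal (Real.exp (2 * c * τ * x ^ 2)) ∂(gaussianReal 0 1)
      ≤ ENNReal.ofReal (Real.exp (4 * c * τ)) := by
    rw [gaussianReal_of_var_ne_zero _ one_ne_zero,
      lintegral_withDensity_eq_lintegral_mul _ (measurable_gaussianPDF _ _) (by fun_prop)]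
    have e : ∀ x : ℝ, (gaussianPDF 0 1 * fun x => ENNReal.ofReal (Real.exp (2 * c * τ * x ^ 2))) x
        = ENNReal.ofReal ((√(2 * Real.pi))⁻¹ * Real.exp (-(1 / 2 - 2 * c * τ) * x ^ 2)) := by
      intro x
      rw [Pi.mul_apply, gaussianPDF, ← ENNReal.ofReal_mul (gaussianPDFReal_nonneg _ _ _),
        gaussianPDFReal, mul_assoc, ← Real.exp_add]
      simp only [NNReal.coe_one, mul_one, sub_zero]
      congr 3
      ring
    simp only [e]
    have hb : 0 < 1 / 2 - 2 * c * τ := by linarith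
    rw [← ofReal_integral_eq_lintegral_ofReal ((integrable_exp_neg_mul_sq hb).const_mul _)
      (Filter.Eventually.of_forall fun x => by positivity), integral_const_mul, integral_gaussian]
    refine ENNReal.ofReal_le_ofReal ?_
    rw [← Real.sqrt_inv, ← Real.sqrt_mul (by positivity)]
    refine Real.sqrt_le_iff.2 ⟨(Real.exp_pos _).le, ?_⟩
    rw [← Real.exp_nat_mul]
    have h1 := Real.add_one_le_exp (((2 : ℕ) : ℝ) * (4 * c * τ))
    refine le_trans ?_ h1
    have e2 : (2 * Real.pi)⁻¹ * (Real.pi / (1 / 2 - 2 * c * τ)) = 1 / (1 - 4 * c * τ) := by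
      have := Real.pi_pos.ne'
      have h3 : 1 - 4 * c * τ ≠ 0 := by linarith
      have h4 : (1 / 2 - 2 * c * τ) = (1 - 4 * c * τ) / 2 := by ring
      rw [h4]
      field_simp
    -- With k = 4cτ ≤ 1/2, this is 1/(1 - k) ≤ 1 + 2k.
    rw [e2, div_le_iff₀ (by linarith)]
    push_cast
    nlinarith [mul_nonneg hc hτ]
  calc ∫⁻ ω, ENNReal.ofReal (Real.exp (c * Y ω ^ 2)) ∂P
      = ∫⁻ ω, ∫⁻ x, ENNReal.ofReal (Real.exp (√(2 * c) * x * Y ω)) ∂(gaussianReal 0 1) ∂P := by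
        simp only [hg]
    _ = ∫⁻ x, ∫⁻ ω, ENNReal.ofReal (Real.exp (√(2 * c) * x * Y ω)) ∂P ∂(gaussianReal 0 1) := by
        refine lintegral_lintegral_swap (Measurable.aemeasurable ?_)
        fun_prop
    _ ≤ ∫⁻ x, ENNReal.ofReal (Real.exp (2 * c * τ * x ^ 2)) ∂(gaussianReal 0 1) := by
        refine lintegral_mono fun x => (hmgf _).trans (le_of_eq ?_)
        rw [mul_pow, Real.sq_sqrt (by positivity)]
        congr 2; ring
    _ ≤ _ := hint

/-- Convexity of exp with equal weights 1/d reduces the squared norm to single coordinates, which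
need not be independent. The price is the factor d. -/
lemma lintegral_exp_norm_sq_le_of_mgf [IsProbabilityMeasure P] {Y : Ω → Vec d} (hY : Measurable Y)
    {τ : ℝ} (hτ : 0 ≤ τ)
    (hmgf : ∀ v : Vec d, ∫⁻ ω, ENNReal.ofReal (Real.exp (inner ℝ v (Y ω))) ∂P
      ≤ ENNReal.ofReal (Real.exp (‖v‖ ^ 2 * τ)))
    {c : ℝ} (hc : 0 ≤ c) (hcτ : c * d * τ ≤ 1 / 8) :
    ∫⁻ ω, ENNReal.ofReal (Real.exp (c * ‖Y ω‖ ^ 2)) ∂P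
      ≤ ENNReal.ofReal (Real.exp (4 * c * d * τ)) := by
  rcases Nat.eq_zero_or_pos d with rfl | hd
  · have : ∀ ω, ‖Y ω‖ = 0 := fun ω => by rw [Subsingleton.elim (Y ω) 0, norm_zero]
    simp [this]
  have hd' : (0 : ℝ) < d := by positivity
  have hpt : ∀ ω, ENNReal.ofReal (Real.exp (c * ‖Y ω‖ ^ 2))
      ≤ ∑ k : Fin d, ENNReal.ofReal (1 / d) * ENNReal.ofReal (Real.exp (c * d * Y ω k ^ 2)) := by
    intro ω
    have h := convexOn_exp.map_sum_le (t := Finset.univ) (w := fun _ : Fin d => 1 / (d : ℝ))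
      (p := fun k => c * d * Y ω k ^ 2) (fun _ _ => by positivity)
      (by simp [hd'.ne']) (fun _ _ => Set.mem_univ _)
    simp only [smul_eq_mul] at h
    have e : ∑ k : Fin d, 1 / (d : ℝ) * (c * d * Y ω k ^ 2) = c * ‖Y ω‖ ^ 2 := by
      rw [EuclideanSpace.real_norm_sq_eq, Finset.mul_sum]
      exact Finset.sum_congr rfl fun k _ => by field_simp
    rw [e] at h
    refine (ENNReal.ofReal_le_ofReal h).trans (le_of_eq ?_)
    rw [ENNReal.ofReal_sum_of_nonneg fun _ _ => by positivity]
    exact Finset.sum_congr rfl fun k _ => ENNReal.ofReal_mul (by positivity)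
  have hYk : ∀ k, Measurable fun ω => Y ω k := fun k => by fun_prop
  refine (lintegral_mono hpt).trans ?_
  rw [lintegral_finsetSum _ fun k _ => by have := hYk k; fun_prop]
  have hk : ∀ k : Fin d, ∫⁻ ω, ENNReal.ofReal (1 / d)
      * ENNReal.ofReal (Real.exp (c * d * Y ω k ^ 2)) ∂P
      ≤ ENNReal.ofReal (1 / d) * ENNReal.ofReal (Real.exp (4 * c * d * τ)) := by
    intro k
    rw [lintegral_const_mul _ (by have := hYk k; fun_prop)]
    gcongr
    have := lintegral_exp_sq_le (P := P) (hYk k) hτ (fun r => ?_) (by positivity : 0 ≤ c * d) hcτ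
    · rwa [← mul_assoc] at this
    · have h := hmgf (EuclideanSpace.single k r)
      simpa [EuclideanSpace.inner_single_left] using h
  refine (Finset.sum_le_sum fun k _ => hk k).trans (le_of_eq ?_)
  rw [Finset.sum_const, Finset.card_univ, Fintype.card_fin, nsmul_eq_mul, ← mul_assoc,
    ← ENNReal.ofReal_natCast, ← ENNReal.ofReal_mul hd'.le, mul_one_div_cancel hd'.ne',
    ENNReal.ofReal_one, one_mul]

end Noise

/-! ### Noise that is independent across users. -/

section IndependentNoise

variable {Ω : Type*} [MeasurableSpace Ω] {P : Measure Ω} {n d : ℕ}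
  {z : Fin n → Ω → Vec d} {s : Fin n → ℝ}

lemma lintegral_exp_sum_le (hind : iIndepFun z P) (hz : ∀ i, Measurable (z i))
    {u : Fin n → Vec d → ℝ} (hu : ∀ i, Measurable (u i)) {b : Fin n → ℝ}
    (hle : ∀ i, ∫⁻ ω, ENNReal.ofReal (Real.exp (u i (z i ω))) ∂P
      ≤ ENNReal.ofReal (Real.exp (b i))) :
    ∫⁻ ω, ENNReal.ofReal (Real.exp (∑ i, u i (z i ω))) ∂P
      ≤ ENNReal.ofReal (Real.exp (∑ i, b i)) := by
  have h := lintegral_prod_eq_prod_lintegral_of_indepFun Finset.univ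
    (fun i ω => ENNReal.ofReal (Real.exp (u i (z i ω))))
    (hind.comp (fun i v => ENNReal.ofReal (Real.exp (u i v)))
      (fun i => by have := hu i; fun_prop))
    (fun i => by have := hu i; have := hz i; fun_prop)
  simp only [Real.exp_sum, ENNReal.ofReal_prod_of_nonneg fun i _ => (Real.exp_pos _).le]
  rw [h]
  exact Finset.prod_le_prod' fun i _ => hle i

variable [IsProbabilityMeasure P]

lemma lintegral_exp_sum_inner_le (hind : iIndepFun z P)
    (hz : ∀ i, IsSubGaussianNoise P (z i) (s i)) (hs : ∀ i, 0 < s i) (v : Fin n → Vec d) :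
    ∫⁻ ω, ENNReal.ofReal (Real.exp (∑ i, inner ℝ (v i) (z i ω))) ∂P
      ≤ ENNReal.ofReal (Real.exp (∑ i, ‖v i‖ ^ 2 * s i ^ 2)) :=
  lintegral_exp_sum_le hind (fun i => (hz i).measurable) (u := fun i x => inner ℝ (v i) x)
    (fun i => by fun_prop) fun i => (hz i).lintegral_exp_inner_le (hs i) (v i)

lemma lintegral_exp_sum_norm_sq_le (hind : iIndepFun z P)
    (hz : ∀ i, IsSubGaussianNoise P (z i) (s i)) (hs : ∀ i, 0 < s i) {γ : ℝ} (hγ : 0 ≤ γ)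
    (hγs : ∀ i, γ * s i ^ 2 ≤ 1) :
    ∫⁻ ω, ENNReal.ofReal (Real.exp (γ * ∑ i, ‖z i ω‖ ^ 2)) ∂P
      ≤ ENNReal.ofReal (Real.exp (γ * ∑ i, s i ^ 2)) := by
  simp only [Finset.mul_sum]
  exact lintegral_exp_sum_le hind (fun i => (hz i).measurable) (u := fun i x => γ * ‖x‖ ^ 2)
    (fun i => by fun_prop) fun i => (hz i).lintegral_exp_norm_sq_le (hs i) hγ (hγs i)

/-- By independence the parameters of the users add up, and the prefactor 1/n of the average enters
squared; together they give σ²/n. -/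
lemma lintegral_exp_netAvg_sq_le (hn : 0 < n) (hind : iIndepFun z P)
    (hz : ∀ i, IsSubGaussianNoise P (z i) (s i)) (hs : ∀ i, 0 < s i) {β : ℝ} (hβ : 0 ≤ β)
    (hβs : β * d * (avgNoiseSq s / n) ≤ 1 / 8) :
    ∫⁻ ω, ENNReal.ofReal (Real.exp (β * ‖netAvg fun i => z i ω‖ ^ 2)) ∂P
      ≤ ENNReal.ofReal (Real.exp (4 * β * d * (avgNoiseSq s / n))) := by
  have hzm := fun i => (hz i).measurable
  have hn' : (0 : ℝ) < n := by positivity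
  refine lintegral_exp_norm_sq_le_of_mgf (by unfold netAvg; fun_prop) ?_ (fun v => ?_) hβ hβs
  · unfold avgNoiseSq; positivity
  · have h := lintegral_exp_sum_inner_le hind hz hs (fun _ => (1 / (n : ℝ)) • v)
    have e1 : ∀ ω, ∑ i, inner ℝ ((1 / (n : ℝ)) • v) (z i ω)
        = inner ℝ v (netAvg fun i => z i ω) := by
      intro ω
      rw [netAvg, inner_smul_right, inner_sum, Finset.mul_sum]
      simp only [real_inner_smul_left]
    have e2 : ∑ i, ‖(1 / (n : ℝ)) • v‖ ^ 2 * s i ^ 2 = ‖v‖ ^ 2 * (avgNoiseSq s / n) := by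
      rw [← Finset.mul_sum, norm_smul, mul_pow, Real.norm_of_nonneg (by positivity), avgNoiseSq]
      field_simp
    simpa only [e1, e2] using h

/-- The joint exponential moment of linear and quadratic functionals of independent noise. -/
lemma lintegral_exp_noise_le (hn : 0 < n) (hind : iIndepFun z P)
    (hz : ∀ i, IsSubGaussianNoise P (z i) (s i)) (hs : ∀ i, 0 < s i) (v : Fin n → Vec d)
    {β γ : ℝ} (hβ : 0 ≤ β) (hβs : 3 * β * d * (avgNoiseSq s / n) ≤ 1 / 8) (hγ : 0 ≤ γ)
    (hγs : ∀ i, 3 * γ * s i ^ 2 ≤ 1) :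
    ∫⁻ ω, ENNReal.ofReal (Real.exp (∑ i, inner ℝ (v i) (z i ω)
        + β * ‖netAvg fun i => z i ω‖ ^ 2 + γ * ∑ i, ‖z i ω‖ ^ 2)) ∂P
      ≤ ENNReal.ofReal (Real.exp (9 * ∑ i, ‖v i‖ ^ 2 * s i ^ 2
        + 12 * β * d * (avgNoiseSq s / n) + 3 * γ * ∑ i, s i ^ 2)) := by
  have hzm := fun i => (hz i).measurable
  have h1 := lintegral_exp_sum_inner_le hind hz hs (fun i => (3 : ℝ) • v i)
  have h2 := lintegral_exp_netAvg_sq_le hn hind hz hs (by positivity : 0 ≤ 3 * β) hβs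
  have h3 := lintegral_exp_sum_norm_sq_le hind hz hs (by positivity : 0 ≤ 3 * γ) hγs
  have hσ : 0 ≤ avgNoiseSq s := by unfold avgNoiseSq; positivity
  set p := 9 * ∑ i, ‖v i‖ ^ 2 * s i ^ 2 with hp
  set q := 12 * β * d * (avgNoiseSq s / n) with hq
  set r := 3 * γ * ∑ i, s i ^ 2 with hr
  have hp0 : 0 ≤ p := by positivity
  have hq0 : 0 ≤ q := by positivity
  have hr0 : 0 ≤ r := by positivity
  have e1 : ∑ i, ‖(3 : ℝ) • v i‖ ^ 2 * s i ^ 2 = p := by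
    rw [hp, Finset.mul_sum]
    refine Finset.sum_congr rfl fun i _ => ?_
    rw [norm_smul, Real.norm_of_nonneg (by norm_num)]; ring
  have e2 : ∀ ω, ∑ i, inner ℝ ((3 : ℝ) • v i) (z i ω) = 3 * ∑ i, inner ℝ (v i) (z i ω) := by
    intro ω
    rw [Finset.mul_sum]
    simp only [real_inner_smul_left]
  rw [e1] at h1
  simp only [e2] at h1
  rw [show 4 * (3 * β) * d * (avgNoiseSq s / n) = q by rw [hq]; ring] at h2
  -- The three functionals depend on the same noise. Convexity separates them at the price of
  -- tripling each, whence 9 = 3² for the linear one.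
  have key : ∀ x y w : ℝ, ENNReal.ofReal (Real.exp (x + y + w))
      ≤ ENNReal.ofReal (1 / 3) * (ENNReal.ofReal (Real.exp (3 * x))
        + ENNReal.ofReal (Real.exp (3 * y)) + ENNReal.ofReal (Real.exp (3 * w))) := by
    intro x y w
    rw [← ENNReal.ofReal_add (Real.exp_pos _).le (Real.exp_pos _).le,
      ← ENNReal.ofReal_add (by positivity) (Real.exp_pos _).le, ← ENNReal.ofReal_mul (by norm_num)]
    refine ENNReal.ofReal_le_ofReal ?_
    have h := convexOn_exp.map_sum_le (t := Finset.univ) (w := fun _ : Fin 3 => 1 / (3 : ℝ))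
      (p := ![3 * x, 3 * y, 3 * w]) (fun _ _ => by norm_num) (by simp)
      (fun _ _ => Set.mem_univ _)
    simp only [smul_eq_mul, Fin.sum_univ_three, Matrix.cons_val] at h
    rw [show x + y + w = 1 / 3 * (3 * x) + 1 / 3 * (3 * y) + 1 / 3 * (3 * w) by ring]
    linarith
  refine (lintegral_mono fun ω => key _ _ _).trans ?_
  have m1 : Measurable fun ω => ENNReal.ofReal (Real.exp (3 * ∑ i, inner ℝ (v i) (z i ω))) := by
    fun_prop
  have m2 : Measurable fun ω =>
      ENNReal.ofReal (Real.exp (3 * (β * ‖netAvg fun i => z i ω‖ ^ 2))) := by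
    unfold netAvg; fun_prop
  have m12 : Measurable fun ω => ENNReal.ofReal (Real.exp (3 * ∑ i, inner ℝ (v i) (z i ω)))
      + ENNReal.ofReal (Real.exp (3 * (β * ‖netAvg fun i => z i ω‖ ^ 2))) := m1.add m2
  rw [lintegral_const_mul' _ _ ENNReal.ofReal_ne_top, lintegral_add_left m12,
    lintegral_add_left m1]
  simp only [← mul_assoc] at h2 h3 ⊢
  have hmono : ∀ {x : ℝ}, x ≤ p + q + r →
      ENNReal.ofReal (Real.exp x) ≤ ENNReal.ofReal (Real.exp (p + q + r)) := fun hx =>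
    ENNReal.ofReal_le_ofReal (Real.exp_le_exp.2 hx)
  calc _ ≤ ENNReal.ofReal (1 / 3) * (ENNReal.ofReal (Real.exp (p + q + r))
        + ENNReal.ofReal (Real.exp (p + q + r)) + ENNReal.ofReal (Real.exp (p + q + r))) := by
        gcongr
        · exact h1.trans (hmono (by linarith))
        · exact h2.trans (hmono (by linarith))
        · exact h3.trans (hmono (by linarith))
    _ = _ := by
        rw [← ENNReal.ofReal_add (Real.exp_pos _).le (Real.exp_pos _).le,
          ← ENNReal.ofReal_add (by positivity) (Real.exp_pos _).le,
          ← ENNReal.ofReal_mul (by norm_num)]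
        congr 1; ring

end IndependentNoise

/-! ### Independence of fresh samples from the current models. -/

section SgdProcess

variable {n d : ℕ} {Ω Ξ : Type*} [MeasurableSpace Ξ]
  {loss : Vec d → Ξ → ℝ} {D : Fin n → Measure Ξ} {ξ : ℕ → Fin n → Ω → Ξ}
  {W : Matrix (Fin n) (Fin n) ℝ} {α : ℕ → ℝ} {x₁ : Fin n → Vec d}

/-- The models of iteration `t` depend on the samples of earlier iterations only. -/
lemma dsgd_measurable_past (hloss : IsLoss loss D) (t : ℕ) (i : Fin n) :
    Measurable[⨆ p ∈ {p : ℕ × Fin n | p.1 + 1 < t},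
      MeasurableSpace.comap (ξ (p.1 + 1) p.2) inferInstance] (dsgd W α loss ξ x₁ t i) := by
  induction t using Nat.strong_induction_on generalizing i with
  | _ t ih =>
    match t with
    | 0 => exact measurable_const
    | 1 => exact measurable_const
    | t + 2 =>
      have hξ : ∀ j, Measurable[⨆ p ∈ {p : ℕ × Fin n | p.1 + 1 < t + 2},
          MeasurableSpace.comap (ξ (p.1 + 1) p.2) inferInstance] (ξ (t + 1) j) := by
        intro j
        refine Measurable.mono (comap_measurable (ξ (t + 1) j)) ?_ le_rfl
        exact le_iSup₂_of_le (f := fun (p : ℕ × Fin n) (_ : p ∈ {p : ℕ × Fin n | p.1 + 1 < t + 2}) =>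
          MeasurableSpace.comap (ξ (p.1 + 1) p.2) inferInstance) (t, j) (by simp) le_rfl
      have hx : ∀ j, Measurable[⨆ p ∈ {p : ℕ × Fin n | p.1 + 1 < t + 2},
          MeasurableSpace.comap (ξ (p.1 + 1) p.2) inferInstance]
          (dsgd W α loss ξ x₁ (t + 1) j) := by
        intro j
        refine Measurable.mono (ih (t + 1) (by omega) j) ?_ le_rfl
        exact biSup_mono fun p hp => by
          simp only [Set.mem_ofPred_eq] at hp ⊢; omega
      have hg : ∀ j, Measurable[⨆ p ∈ {p : ℕ × Fin n | p.1 + 1 < t + 2},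
          MeasurableSpace.comap (ξ (p.1 + 1) p.2) inferInstance]
          (fun ω => stochGrad loss (dsgd W α loss ξ x₁ (t + 1) j ω) (ξ (t + 1) j ω)) :=
        fun j => hloss.measurable_grad.comp ((hx j).prodMk (hξ j))
      refine Finset.measurable_fun_sum _ fun j _ => ?_
      exact ((hx j).sub ((hg j).const_smul (α (t + 1)))).const_smul (W i j)

variable [MeasurableSpace Ω] {P : Measure Ω} {F : ℕ → MeasurableSpace Ω} {σ : Fin n → ℝ}

lemma IsSubGaussianOracle.comap_le (hor : IsSubGaussianOracle P loss D ξ F σ) (p : ℕ × Fin n) :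
    MeasurableSpace.comap (ξ (p.1 + 1) p.2) inferInstance ≤ ‹MeasurableSpace Ω› :=
  (hor.measurable_sample (p.1 + 1) (by omega) p.2).comap_le

lemma IsSubGaussianOracle.measurable_dsgd (hor : IsSubGaussianOracle P loss D ξ F σ)
    (hloss : IsLoss loss D) (t : ℕ) (i : Fin n) : Measurable (dsgd W α loss ξ x₁ t i) :=
  (dsgd_measurable_past hloss t i).mono (iSup₂_le fun p _ => hor.comap_le p) le_rfl

/-- The pair (t, i) indexes the sample of iteration t + 1, so the models of iteration t + 1 use
pairs with first entry below t, a set disjoint from the pairs with first entry t. -/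
lemma IsSubGaussianOracle.indepFun_dsgd (hor : IsSubGaussianOracle P loss D ξ F σ)
    (hloss : IsLoss loss D) (t : ℕ) :
    IndepFun (fun ω i => dsgd W α loss ξ x₁ (t + 1) i ω) (fun ω i => ξ (t + 1) i ω) P := by
  have h := indep_iSup_of_disjoint hor.comap_le hor.indep.iIndep
    (S := {p : ℕ × Fin n | p.1 + 1 < t + 1}) (T := {p : ℕ × Fin n | p.1 = t})
    (Set.disjoint_left.2 fun p hp hp' => by simp only [Set.mem_ofPred_eq] at hp hp'; omega)
  refine indep_of_indep_of_le_left (indep_of_indep_of_le_right h ?_) ?_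
  · rw [← measurable_iff_comap_le]
    refine @measurable_pi_lambda _ _ _ (_) _ _ fun i => ?_
    refine Measurable.mono (comap_measurable (ξ (t + 1) i)) ?_ le_rfl
    exact le_iSup₂_of_le (f := fun (p : ℕ × Fin n) (_ : p ∈ {p : ℕ × Fin n | p.1 = t}) =>
      MeasurableSpace.comap (ξ (p.1 + 1) p.2) inferInstance) (t, i) (by simp) le_rfl
  · rw [← measurable_iff_comap_le]
    exact @measurable_pi_lambda _ _ _ (_) _ _ fun i => dsgd_measurable_past hloss (t + 1) i

/-- Conditioning on the current models: they may be frozen when integrating over fresh samples. -/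
lemma lintegral_le_of_indepFun [IsProbabilityMeasure P] {A B : Type*} [MeasurableSpace A]
    [MeasurableSpace B] {X : Ω → A} {Y : Ω → B} (hX : Measurable X) (hY : Measurable Y)
    (hind : IndepFun X Y P) {h : A → B → ENNReal} (hh : Measurable (Function.uncurry h))
    {b : A → ENNReal} (hb : Measurable b) (hle : ∀ c, ∫⁻ ω, h c (Y ω) ∂P ≤ b c) :
    ∫⁻ ω, h (X ω) (Y ω) ∂P ≤ ∫⁻ ω, b (X ω) ∂P := by
  have hmap := (indepFun_iff_map_prod_eq_prod_map_map hX.aemeasurable hY.aemeasurable).1 hind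
  have : IsProbabilityMeasure (P.map X) := Measure.isProbabilityMeasure_map hX.aemeasurable
  have : IsProbabilityMeasure (P.map Y) := Measure.isProbabilityMeasure_map hY.aemeasurable
  calc ∫⁻ ω, h (X ω) (Y ω) ∂P = ∫⁻ p, Function.uncurry h p ∂(P.map fun ω => (X ω, Y ω)) := by
        rw [lintegral_map hh (hX.prodMk hY)]; rfl
    _ = ∫⁻ c, ∫⁻ y, h c y ∂(P.map Y) ∂(P.map X) := by
        rw [hmap, lintegral_prod _ hh.aemeasurable]; rfl
    _ ≤ ∫⁻ c, b c ∂(P.map X) := by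
        refine lintegral_mono fun c => ?_
        exact (lintegral_map (f := h c) (hh.comp measurable_prodMk_left) hY).trans_le (hle c)
    _ = ∫⁻ ω, b (X ω) ∂P := lintegral_map hb hX

lemma IsSubGaussianOracle.iIndepFun_noise (hor : IsSubGaussianOracle P loss D ξ F σ)
    (hloss : IsLoss loss D) (t : ℕ) (c m : Fin n → Vec d) :
    iIndepFun (fun i ω => stochGrad loss (c i) (ξ (t + 1) i ω) - m i) P := by
  have h := hor.indep.precomp (g := fun i : Fin n => (t, i)) (fun i j hij => by simpa using hij)
  exact h.comp (fun i s => stochGrad loss (c i) s - m i) fun i =>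
    (hloss.measurable_grad.comp measurable_prodMk_left).sub_const _

/-- A constant query point is measurable for every σ-algebra, so the conditional assumptions apply
to it and can be integrated. This suffices because the models are frozen by independence. -/
lemma IsSubGaussianOracle.isSubGaussianNoise [IsProbabilityMeasure P]
    (hor : IsSubGaussianOracle P loss D ξ F σ) (hloss : IsLoss loss D) {t : ℕ}
    (hF : F (t + 1) ≤ ‹MeasurableSpace Ω›) (i : Fin n) (hσ : 0 < σ i) (c : Vec d) :
    IsSubGaussianNoise P
      (fun ω => stochGrad loss c (ξ (t + 1) i ω) - ∇ (localCost loss D i) c) (σ i) := by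
  have ht : 1 ≤ t + 1 := by omega
  have hm : Measurable fun ω => stochGrad loss c (ξ (t + 1) i ω) - ∇ (localCost loss D i) c :=
    ((hloss.measurable_grad.comp measurable_prodMk_left).comp
      (hor.measurable_sample _ ht i)).sub_const _
  obtain ⟨h1, h2⟩ := hor.subGaussian (t + 1) ht i (fun _ => c) measurable_const
  have hint : Integrable
      (fun ω => stochGrad loss c (ξ (t + 1) i ω) - ∇ (localCost loss D i) c) P := by
    refine Integrable.mono' (h1.const_mul (σ i)) hm.aestronglyMeasurable
      (Filter.Eventually.of_forall fun ω => ?_)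
    set w := ‖stochGrad loss c (ξ (t + 1) i ω) - ∇ (localCost loss D i) c‖
    have e : w = σ i * (w / σ i) := by field_simp
    have h3 := Real.add_one_le_exp (w ^ 2 / σ i ^ 2)
    rw [← div_pow] at h3 ⊢
    rw [e]
    refine mul_le_mul_of_nonneg_left ?_ hσ.le
    rw [← e]
    nlinarith [sq_nonneg (w / σ i - 1)]
  have hint' : Integrable (fun ω => stochGrad loss c (ξ (t + 1) i ω)) P := by
    refine (hint.add (integrable_const (∇ (localCost loss D i) c))).congr
      (Filter.Eventually.of_forall fun ω => ?_)
    simp only [Pi.add_apply, sub_add_cancel]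
  refine ⟨hm, hint, ?_, h1, ?_⟩
  · have h3 := hor.unbiased (t + 1) ht i (fun _ => c) measurable_const hint'
    have h4 := integral_congr_ae h3
    rw [integral_condExp hF, integral_const, probReal_univ, one_smul] at h4
    rw [integral_sub hint' (integrable_const _), h4, integral_const, probReal_univ, one_smul,
      sub_self]
  · have h3 := integral_mono_ae integrable_condExp (integrable_const _) h2
    rwa [integral_condExp hF, integral_const, probReal_univ, one_smul] at h3

lemma modelFiltration_le {x : ℕ → Fin n → Ω → Vec d} (hx : ∀ t i, Measurable (x t i)) (t : ℕ) :
    modelFiltration x t ≤ ‹MeasurableSpace Ω› :=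
  iSup₂_le fun s _ => iSup_le fun i => (hx s i).comap_le

end SgdProcess

/-! ### One-step bound for the exponential moment of the potential. -/

section Potential

variable {n d : ℕ} {f : Fin n → Vec d → ℝ} {g : Fin n → Vec d → Vec d} {μ L : ℝ}

/-- Suboptimality and distance to `xs` of the averaged model, and disagreement between users,
combined with weights `A`, `E` and `B`. -/
noncomputable def potential (f : Fin n → Vec d → ℝ) (xs : Vec d) (A E B : ℝ) (X : Fin n → Vec d) : ℝ :=
  A * ((1 / (n : ℝ)) * ∑ i, f i (netAvg X) - (1 / (n : ℝ)) * ∑ i, f i xs)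
    + E * (n * ‖netAvg X - xs‖ ^ 2) + B * ∑ i, ‖X i - netAvg X‖ ^ 2

/-- The change of the potential in one iteration, with the noise terms separated. -/
lemma potential_step_le {W : Matrix (Fin n) (Fin n) ℝ} (hn : 2 ≤ n) (hW : IsNetworkMatrix W)
    (h : ∀ i, HasQuadraticBounds (f i) (g i) μ L)
    (hlip : ∀ i x y, ‖g i x - g i y‖ ≤ L * ‖x - y‖) (hL : 0 < L) {α : ℝ}
    (hα0 : 0 ≤ α) (hα : α * L ≤ 1 / 2) {A E B : ℝ} (hA : 0 ≤ A) (hB : 0 ≤ B)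
    (xs : Vec d) (X z : Fin n → Vec d) :
    potential f xs A E B (fun i => ∑ j, W i j • (X j - α • (g j (X j) + z j)))
      ≤ A * ((1 / (n : ℝ)) * ∑ i, f i (netAvg X) - (1 / (n : ℝ)) * ∑ i, f i xs
          - α / 2 * ‖netAvg (fun i => g i (netAvg X))‖ ^ 2
          + α * L ^ 2 / (2 * n) * ∑ i, ‖X i - netAvg X‖ ^ 2)
        + E * (n * ‖netAvg X - α • netAvg (fun i => g i (X i)) - xs‖ ^ 2)
        + B * (secondSingularValue W ^ 2 *
          ∑ i, ‖(X i - α • g i (X i)) - netAvg (fun j => X j - α • g j (X j))‖ ^ 2)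
        + (∑ i, inner ℝ (-(A * α / n) • netAvg (fun i => g i (netAvg X))
            - (2 * E * α) • (netAvg X - α • netAvg (fun i => g i (X i)) - xs)
            - (2 * B * secondSingularValue W ^ 2 * α) •
              ((X i - α • g i (X i)) - netAvg (fun j => X j - α • g j (X j)))) (z i)
          + (A * α ^ 2 * L + E * n * α ^ 2) * ‖netAvg z‖ ^ 2
          + B * secondSingularValue W ^ 2 * α ^ 2 * ∑ i, ‖z i‖ ^ 2) := by
  have hn0 : 0 < n := by omega
  have hn' : (0 : ℝ) < n := by positivity
  have hy : ∀ j, X j - α • (g j (X j) + z j) = (X j - α • g j (X j)) - α • z j := by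
    intro j; rw [smul_add]; abel
  have hmix := hW.disagreement_mix_le hn α (fun j => X j - α • g j (X j)) z
  have havg : netAvg (fun i => ∑ j, W i j • (X j - α • (g j (X j) + z j)))
      = netAvg X - α • (netAvg (fun i => g i (X i)) + netAvg z) := by
    rw [netAvg_mix hW.doublyStochastic, netAvg_sub, netAvg_smul, netAvg_add]
  have havg' : netAvg (fun i => (X i - α • g i (X i)) - α • z i)
      = netAvg X - α • (netAvg (fun i => g i (X i)) + netAvg z) := by
    rw [← havg, netAvg_mix hW.doublyStochastic]
    simp only [hy]
  have hcost := avg_step_cost_le hn0 h hlip hL hα0 hα X (netAvg z)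
  rw [potential, havg]
  rw [havg'] at hmix
  simp only [hy]
  set l2 := secondSingularValue W ^ 2
  set G := netAvg (fun i => g i (X i))
  set G0 := netAvg (fun i => g i (netAvg X))
  set u := netAvg X - α • G - xs with hu
  set q : Fin n → Vec d := fun i => (X i - α • g i (X i)) - netAvg (fun j => X j - α • g j (X j))
    with hq
  have hdist : ‖netAvg X - α • (G + netAvg z) - xs‖ ^ 2
      = ‖u‖ ^ 2 - 2 * α * inner ℝ u (netAvg z) + α ^ 2 * ‖netAvg z‖ ^ 2 := by
    rw [show netAvg X - α • (G + netAvg z) - xs = u - α • netAvg z by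
      rw [hu, smul_add]; abel, norm_sub_sq_real, inner_smul_right, norm_smul, mul_pow,
      Real.norm_of_nonneg hα0]
    ring
  have hlin : ∑ i, inner ℝ (-(A * α / n) • G0 - (2 * E * α) • u - (2 * B * l2 * α) • q i) (z i)
      = -(A * α) * inner ℝ G0 (netAvg z) - 2 * E * α * n * inner ℝ u (netAvg z)
        - 2 * B * l2 * α * ∑ i, inner ℝ (q i) (z i) := by
    have e : ∀ v : Vec d, ∑ i, inner ℝ v (z i) = n * inner ℝ v (netAvg z) := by
      intro v
      rw [real_inner_comm, inner_netAvg hn0]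
      exact Finset.sum_congr rfl fun i _ => real_inner_comm _ _
    simp only [inner_sub_left, real_inner_smul_left, Finset.sum_sub_distrib, ← Finset.mul_sum, e]
    field_simp
  rw [hlin, hdist]
  have h1 := mul_le_mul_of_nonneg_left hcost hA
  have h2 := mul_le_mul_of_nonneg_left hmix hB
  linarith

lemma norm_sub_three_sq_le {E : Type*} [NormedAddCommGroup E] [InnerProductSpace ℝ E]
    (a b c : E) : ‖a - b - c‖ ^ 2 ≤ 3 * (‖a‖ ^ 2 + ‖b‖ ^ 2 + ‖c‖ ^ 2) := by
  have h1 : ‖a - b - c‖ ≤ ‖a‖ + ‖b‖ + ‖c‖ :=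
    (norm_sub_le _ _).trans (by gcongr; exact norm_sub_le _ _)
  have h2 := pow_le_pow_left₀ (norm_nonneg _) h1 2
  nlinarith [sq_nonneg (‖a‖ - ‖b‖), sq_nonneg (‖a‖ - ‖c‖), sq_nonneg (‖b‖ - ‖c‖)]

/-- One iteration increases the logarithmic exponential moment of the potential by a constant
only. -/
lemma lintegral_exp_potential_step_le {Ω : Type*} [MeasurableSpace Ω] {P : Measure Ω}
    [IsProbabilityMeasure P] {W : Matrix (Fin n) (Fin n) ℝ} (hn : 2 ≤ n) (hW : IsNetworkMatrix W)
    (h : ∀ i, HasQuadraticBounds (f i) (g i) μ L)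
    (hlip : ∀ i x y, ‖g i x - g i y‖ ≤ L * ‖x - y‖) (hμ : 0 < μ) (hL : 0 < L) {α lam : ℝ}
    (hlam : lam = secondSingularValue W)
    (hα0 : 0 ≤ α) (hα : α * L ≤ 1 / 2) (hαlam : α * L * lam ≤ 4 / 25 * (1 - lam))
    {xs : Vec d}
    (hmin : ∀ y, (1 / (n : ℝ)) * ∑ i, f i xs ≤ (1 / (n : ℝ)) * ∑ i, f i y)
    {A E B A' E' B' η : ℝ} (hA : 0 ≤ A) (hE : 0 ≤ E) (hB : 0 ≤ B) (hη : 0 ≤ η)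
    {z : Fin n → Ω → Vec d} {σ : Fin n → ℝ} (hind : iIndepFun z P)
    (hz : ∀ i, IsSubGaussianNoise P (z i) (σ i)) (hσ : ∀ i, 0 < σ i)
    (hnoiseA : 216 * (A * α) * (avgNoiseSq σ / n) ≤ 1)
    (hnoiseE : 108 * (E * α ^ 2) * avgNoiseSq σ ≤ η)
    (hnoiseB : ∀ i, 10800 * (B * lam ^ 2 * α ^ 2) * σ i ^ 2 ≤ 1 - lam)
    (hnoiseQ : 24 * (A * α ^ 2 * L + E * n * α ^ 2) * d * (avgNoiseSq σ / n) ≤ 1)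
    (hcoefA : A * (1 - 3 / 4 * (α * μ))
      + B * (1 + (1 - lam) / 100) * (10 / (7 * (1 - lam)) * (lam ^ 2 * α ^ 2) * (5 / 2 * L * n))
      ≤ A' + E * (1 + η) * (2 / 3 * α * n))
    (hcoefE : E * (1 + η) * (1 - α * μ) ≤ E')
    (hcoefB : A * (α * L ^ 2 / (2 * n)) + E * (1 + η) * (3 * α * L)
      + B * (1 + (1 - lam) / 100) * ((1 - 21 / 25 * (1 - lam)) ^ 2 / (1 - 7 / 10 * (1 - lam)))
      ≤ B')
    (X : Fin n → Vec d) :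
    ∫⁻ ω, ENNReal.ofReal (Real.exp (potential f xs A E B
        (fun i => ∑ j, W i j • (X j - α • (g j (X j) + z j ω))))) ∂P
      ≤ ENNReal.ofReal (Real.exp (potential f xs A' E' B' X
        + (B * (1 + (1 - lam) / 100) * (50 / (7 * (1 - lam)) * (lam ^ 2 * α ^ 2))
            * ∑ i, ‖g i xs‖ ^ 2
          + 12 * (A * α ^ 2 * L + E * n * α ^ 2) * d * (avgNoiseSq σ / n)
          + 3 * (B * lam ^ 2 * α ^ 2) * (n * avgNoiseSq σ)))) := by
  have hn0 : 0 < n := by omega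
  have hn' : (0 : ℝ) < n := by positivity
  have hl0 : 0 ≤ lam := hlam ▸ secondSingularValue_nonneg
  have hl1 : lam < 1 := hlam ▸ (hW.secondSingularValue_bound hn).1
  have hnoise := lintegral_exp_noise_le hn0 hind hz hσ
    (fun i => -(A * α / n) • netAvg (fun i => g i (netAvg X))
            - (2 * E * α) • (netAvg X - α • netAvg (fun i => g i (X i)) - xs)
            - (2 * B * lam ^ 2 * α) •
              ((X i - α • g i (X i)) - netAvg (fun j => X j - α • g j (X j))))
    (β := A * α ^ 2 * L + E * n * α ^ 2) (γ := B * lam ^ 2 * α ^ 2) (by positivity)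
    (by linarith) (by positivity) (fun i => by
      have := hnoiseB i
      have h0 : 0 ≤ B * lam ^ 2 * α ^ 2 * σ i ^ 2 := by positivity
      linarith)
  have hdist := norm_avg_step_sub_sq_le hn0 h hlip hμ.le hL hα0 hα hmin X
  have hdis := disagreement_step_le hn0 h hlip hμ.le hL hα0 hl0 hl1 hαlam hmin X
  have hPL := (hasQuadraticBounds_avg hn0 h).le_norm_sq hμ (netAvg X) xs
  have hstep := fun ω => potential_step_le hn hW h hlip hL hα0 hα (E := E) hA hB xs X
    (fun i => z i ω)
  simp only [← hlam] at hstep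
  have hD0 : 0 ≤ (1 / (n : ℝ)) * ∑ i, f i (netAvg X) - (1 / (n : ℝ)) * ∑ i, f i xs :=
    sub_nonneg.2 (hmin _)
  have hQ0 : 0 ≤ ∑ i, ‖X i - netAvg X‖ ^ 2 := Finset.sum_nonneg fun i _ => sq_nonneg _
  have hH0 : 0 ≤ ∑ i, ‖g i xs‖ ^ 2 := Finset.sum_nonneg fun i _ => sq_nonneg _
  have hσsum : ∑ i, σ i ^ 2 = n * avgNoiseSq σ := by
    rw [avgNoiseSq, ← mul_assoc, mul_one_div_cancel hn'.ne', one_mul]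
  have hσ0 : 0 ≤ avgNoiseSq σ := by unfold avgNoiseSq; positivity
  rw [potential]
  set F := (1 / (n : ℝ)) * ∑ i, f i (netAvg X) - (1 / (n : ℝ)) * ∑ i, f i xs
  set Q := ∑ i, ‖X i - netAvg X‖ ^ 2
  set H := ∑ i, ‖g i xs‖ ^ 2
  set G0 := netAvg (fun i => g i (netAvg X))
  set u := netAvg X - α • netAvg (fun i => g i (X i)) - xs
  set q : Fin n → Vec d := fun i => (X i - α • g i (X i)) - netAvg (fun j => X j - α • g j (X j))
    with hq
  set s2 := avgNoiseSq σ
  set r2 := ‖netAvg X - xs‖ ^ 2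
  -- The noise conditions are linear in A, E and B, whereas the linear functional costs their
  -- squares. One factor of each square is traded for slack: α/8 of the gradient term, η of the
  -- distance, (1 - λ)/100 of the disagreement.
  have hv : 9 * ∑ i, ‖-(A * α / n) • G0 - (2 * E * α) • u - (2 * B * lam ^ 2 * α) • q i‖ ^ 2
        * σ i ^ 2 ≤ A * (α / 8) * ‖G0‖ ^ 2 + E * η * (n * ‖u‖ ^ 2)
          + B * ((1 - lam) / 100) * (lam ^ 2 * ∑ i, ‖q i‖ ^ 2) := by
    have h1 : ∀ i, ‖-(A * α / n) • G0 - (2 * E * α) • u - (2 * B * lam ^ 2 * α) • q i‖ ^ 2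
        * σ i ^ 2 ≤ (3 * (A * α / n) ^ 2 * ‖G0‖ ^ 2 + 12 * (E * α) ^ 2 * ‖u‖ ^ 2) * σ i ^ 2
          + B * ((1 - lam) / 900) * (lam ^ 2 * ‖q i‖ ^ 2) := by
      intro i
      have h2 := norm_sub_three_sq_le (-(A * α / n) • G0) ((2 * E * α) • u)
        ((2 * B * lam ^ 2 * α) • q i)
      simp only [norm_smul, mul_pow, Real.norm_eq_abs, sq_abs] at h2
      have h3 := mul_le_mul_of_nonneg_right h2 (sq_nonneg (σ i))
      have h4 := mul_le_mul_of_nonneg_left (hnoiseB i)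
        (by positivity : 0 ≤ B * lam ^ 2 * ‖q i‖ ^ 2 / 900)
      refine h3.trans ?_
      linarith
    have h2 := mul_le_mul_of_nonneg_left (Finset.sum_le_sum fun i (_ : i ∈ Finset.univ) => h1 i)
      (by norm_num : (0 : ℝ) ≤ 9)
    refine h2.trans ?_
    rw [Finset.sum_add_distrib, ← Finset.mul_sum, hσsum, ← Finset.mul_sum, ← Finset.mul_sum]
    have h5 := mul_le_mul_of_nonneg_left hnoiseA
      (by positivity : 0 ≤ A * α * ‖G0‖ ^ 2 / 8)
    have h6 := mul_le_mul_of_nonneg_left hnoiseE (by positivity : 0 ≤ E * (n * ‖u‖ ^ 2))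
    have h7 : (A * α / n) ^ 2 * ‖G0‖ ^ 2 * (n * s2) = A * α * (A * α) * (s2 / n) * ‖G0‖ ^ 2 := by
      field_simp
    linarith
  have hmain : A * (F - α / 2 * ‖G0‖ ^ 2 + α * L ^ 2 / (2 * n) * Q) + E * (n * ‖u‖ ^ 2)
      + B * (lam ^ 2 * ∑ i, ‖q i‖ ^ 2)
      + 9 * ∑ i, ‖-(A * α / n) • G0 - (2 * E * α) • u - (2 * B * lam ^ 2 * α) • q i‖ ^ 2
        * σ i ^ 2
      ≤ A' * F + E' * (n * r2) + B' * Q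
        + B * (1 + (1 - lam) / 100) * (50 / (7 * (1 - lam)) * (lam ^ 2 * α ^ 2)) * H := by
    -- Of the descent α/2 ‖G0‖², noise has taken 1/8. The remaining 3/8 becomes 3/4 αμ by
    -- Polyak–Łojasiewicz.
    have k1 := mul_le_mul_of_nonneg_left hdist (by positivity : 0 ≤ E * (1 + η))
    have k2 := mul_le_mul_of_nonneg_left
      (show lam ^ 2 * ∑ i, ‖q i‖ ^ 2 ≤ _ from hdis)
      (by have : 0 ≤ 1 - lam := by linarith
          positivity : 0 ≤ B * (1 + (1 - lam) / 100))
    have k3 := mul_le_mul_of_nonneg_left hPL (by positivity : 0 ≤ A * (α * (3 / 8)))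
    have k4 := mul_le_mul_of_nonneg_right hcoefA hD0
    have k5 := mul_le_mul_of_nonneg_right hcoefE (by positivity : 0 ≤ n * r2)
    have k6 := mul_le_mul_of_nonneg_right hcoefB hQ0
    have k7 : 50 / (7 * (1 - lam)) = 5 * (10 / (7 * (1 - lam))) := by ring
    rw [k7]
    clear_value F Q H G0 u q s2 r2
    generalize (1 - 21 / 25 * (1 - lam)) ^ 2 / (1 - 7 / 10 * (1 - lam)) = ρ at *
    generalize 10 / (7 * (1 - lam)) = w at *
    generalize α * L ^ 2 / (2 * n) = y at *
    generalize ∑ i, ‖q i‖ ^ 2 = Qq at *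
    linarith
  have hexp : ∀ ω, ENNReal.ofReal (Real.exp (potential f xs A E B
        (fun i => ∑ j, W i j • (X j - α • (g j (X j) + z j ω)))))
      ≤ ENNReal.ofReal (Real.exp (A * (F - α / 2 * ‖G0‖ ^ 2 + α * L ^ 2 / (2 * n) * Q)
          + E * (n * ‖u‖ ^ 2) + B * (lam ^ 2 * ∑ i, ‖q i‖ ^ 2)))
        * ENNReal.ofReal (Real.exp (∑ i, inner ℝ (-(A * α / n) • G0 - (2 * E * α) • u
            - (2 * B * lam ^ 2 * α) • q i) (z i ω)
          + (A * α ^ 2 * L + E * n * α ^ 2) * ‖netAvg fun i => z i ω‖ ^ 2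
          + B * lam ^ 2 * α ^ 2 * ∑ i, ‖z i ω‖ ^ 2)) := by
    intro ω
    rw [← ENNReal.ofReal_mul (Real.exp_pos _).le, ← Real.exp_add]
    exact ENNReal.ofReal_le_ofReal (Real.exp_le_exp.2 (hstep ω))
  refine (lintegral_mono hexp).trans ?_
  rw [lintegral_const_mul' _ _ ENNReal.ofReal_ne_top]
  refine (mul_le_mul_right hnoise _).trans ?_
  rw [← ENNReal.ofReal_mul (Real.exp_pos _).le, ← Real.exp_add, hσsum]
  refine ENNReal.ofReal_le_ofReal (Real.exp_le_exp.2 ?_)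
  linarith

end Potential

/-! ### The weights satisfy the backward recursions. -/

section Weights

/-- Weight of the suboptimality. -/
noncomputable def weightA (w n S ψ : ℝ) : ℝ := w * n * S ^ 3 * (1 + (1 - ψ) / 2)

/-- Weight of the squared distance to the minimizer. -/
noncomputable def weightE (w L e S : ℝ) : ℝ := w * L * e * S

/-- Weight of the disagreement between users. -/
noncomputable def weightB (w L κ b e S ψ : ℝ) : ℝ :=
  w * L * (6 * κ / b * (3 * S ^ 2 + 9 / 2 * e) + 1 / 2 * S ^ 3 * ψ)

lemma contraction_factor_le {b : ℝ} (hb0 : 0 < b) (hb1 : b ≤ 1) :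
    (1 + b / 100) * ((1 - 21 / 25 * b) ^ 2 / (1 - 7 / 10 * b)) ≤ 1 - 89 / 100 * b := by
  have hd : 0 < 1 - 7 / 10 * b := by linarith
  rw [← mul_div_assoc, div_le_iff₀ hd]
  nlinarith [mul_nonneg hb0.le (sub_nonneg.2 hb1), mul_nonneg (mul_nonneg hb0.le hb0.le)
    (sub_nonneg.2 hb1)]

/-- The factor (1 + b/4)² accounts for the growth of S² in one iteration, as 1/S ≤ b/4. -/
lemma contraction_factor_growth_le {b : ℝ} (hb0 : 0 < b) (hb1 : b ≤ 1) :
    (1 + b / 4) ^ 2 * ((1 + b / 100) * ((1 - 21 / 25 * b) ^ 2 / (1 - 7 / 10 * b)))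
      ≤ 1 - 39 / 100 * b := by
  have hd : 0 < 1 - 7 / 10 * b := by linarith
  rw [← mul_div_assoc, ← mul_div_assoc, div_le_iff₀ hd]
  have h2 : 0 ≤ b ^ 2 * (1 - b) := by have := sub_nonneg.2 hb1; positivity
  have h3 : 0 ≤ b ^ 3 * (1 - b) := by have := sub_nonneg.2 hb1; positivity
  have h4 : 0 ≤ b ^ 4 * (1 - b) := by have := sub_nonneg.2 hb1; positivity
  have h5 : 0 ≤ b * (1 - b) := by have := sub_nonneg.2 hb1; positivity
  nlinarith

variable {w n S ψ L μ κ b e lam : ℝ}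

lemma weightE_step_le (hw : 0 ≤ w) (hL : 0 ≤ L) (he : 0 ≤ e) (hS : 7 ≤ S) (hμ : 0 < μ) :
    weightE w L e (S + 1) * (1 + 1 / S) * (1 - 6 / (μ * S) * μ) ≤ weightE w L e S := by
  have hS0 : 0 < S := by linarith
  have e1 : weightE w L e (S + 1) * (1 + 1 / S) * (1 - 6 / (μ * S) * μ)
      = w * L * e * ((S + 1) ^ 2 * (S - 6) / S ^ 2) := by
    rw [weightE]; field_simp
  rw [e1, weightE]
  refine mul_le_mul_of_nonneg_left ?_ (by positivity)
  rw [div_le_iff₀ (by positivity)]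
  nlinarith

/-- Each part of B has its own task: 3S² absorbs what A feeds into the disagreement, 9e/2 absorbs
what E feeds in, and the S³ part only has to sustain itself. The latter contracts by (1 + b/4)(1 -
39b/100) ≤ 1 - 7b/50, the ratio that defines ψ. -/
lemma weightB_step_le (hw : 0 ≤ w) (hn : 0 < n) (hμ : 0 < μ) (hκ : 1 ≤ κ) (hL : L = κ * μ)
    (he : 0 ≤ e) (hb0 : 0 < b) (hb1 : b ≤ 1) (hS : 7 ≤ S) (hbS : 4 ≤ b * S)
    (hψ0 : 0 ≤ ψ) (hψ1 : ψ ≤ 1) :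
    weightA w n (S + 1) ψ * (6 / (μ * S) * L ^ 2 / (2 * n))
      + weightE w L e (S + 1) * (1 + 1 / S) * (3 * (6 / (μ * S)) * L)
      + weightB w L κ b e (S + 1) ψ * (1 + b / 100)
        * ((1 - 21 / 25 * b) ^ 2 / (1 - 7 / 10 * b))
      ≤ weightB w L κ b e S ((1 - 7 / 50 * b) * ψ) := by
  have hS0 : 0 < S := by linarith
  have hL0 : 0 ≤ L := by rw [hL]; positivity
  have hR1 := contraction_factor_le hb0 hb1
  have hR2 := contraction_factor_growth_le hb0 hb1
  have hR0 : 0 ≤ (1 + b / 100) * ((1 - 21 / 25 * b) ^ 2 / (1 - 7 / 10 * b)) := by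
    have hd : 0 < 1 - 7 / 10 * b := by linarith
    positivity
  rw [mul_assoc (weightB w L κ b e (S + 1) ψ)]
  generalize (1 + b / 100) * ((1 - 21 / 25 * b) ^ 2 / (1 - 7 / 10 * b)) = R at *
  have hg1 : S + 1 ≤ S * (1 + b / 4) := by nlinarith
  have hg2 : S + 1 ≤ 8 / 7 * S := by linarith
  have hsq1 : (S + 1) ^ 2 ≤ S ^ 2 * (1 + b / 4) ^ 2 := by
    rw [← mul_pow]; exact pow_le_pow_left₀ (by positivity) hg1 2
  have hsq2 : (S + 1) ^ 2 ≤ 64 / 49 * S ^ 2 := by nlinarith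
  have hcu : (S + 1) ^ 3 ≤ 512 / 343 * S ^ 3 := by
    have := pow_le_pow_left₀ (by positivity) hg2 3
    linarith
  have hsqR : (S + 1) ^ 2 * R ≤ S ^ 2 * (1 - 39 / 100 * b) := by
    have h1 := mul_le_mul_of_nonneg_right hsq1 hR0
    have h2 := mul_le_mul_of_nonneg_left hR2 (sq_nonneg S)
    linarith
  have hcuR : (S + 1) ^ 3 * R ≤ S ^ 3 * (1 - 7 / 50 * b) := by
    have h0 : 0 ≤ S ^ 2 * (1 - 39 / 100 * b) := by
      have : 0 ≤ 1 - 39 / 100 * b := by linarith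
      positivity
    have h1 := mul_le_mul hg1 hsqR (by positivity) (by positivity)
    have h2 : 0 ≤ S ^ 3 * (b * b) := by positivity
    nlinarith
  have e1 : weightA w n (S + 1) ψ * (6 / (μ * S) * L ^ 2 / (2 * n))
      = w * L * (3 * κ * ((S + 1) ^ 3 / S) * (1 + (1 - ψ) / 2)) := by
    rw [weightA, hL]; field_simp; ring
  have e2 : weightE w L e (S + 1) * (1 + 1 / S) * (3 * (6 / (μ * S)) * L)
      = w * L * (18 * κ * e * ((S + 1) ^ 2 / S ^ 2)) := by
    rw [weightE, hL]; field_simp; ring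
  have t1 : (S + 1) ^ 3 / S ≤ 512 / 343 * S ^ 2 := by
    rw [div_le_iff₀ hS0]; linarith
  have t2 : (S + 1) ^ 2 / S ^ 2 ≤ 64 / 49 := by
    rw [div_le_iff₀ (by positivity)]; linarith
  have k1 : 3 * κ * ((S + 1) ^ 3 / S) * (1 + (1 - ψ) / 2)
      + 6 * κ / b * (3 * (S + 1) ^ 2) * R ≤ 6 * κ / b * (3 * S ^ 2) := by
    have h1 : 3 * κ * ((S + 1) ^ 3 / S) * (1 + (1 - ψ) / 2)
        ≤ 3 * κ * (512 / 343 * S ^ 2) * (3 / 2) := by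
      gcongr
      linarith
    have h2 := mul_le_mul_of_nonneg_left hsqR (by positivity : 0 ≤ 18 * κ / b)
    have h3 : 18 * κ / b * (S ^ 2 * (1 - 39 / 100 * b))
        = 6 * κ / b * (3 * S ^ 2) - 351 / 50 * κ * S ^ 2 := by
      field_simp; ring
    have h4 : 6 * κ / b * (3 * (S + 1) ^ 2) * R = 18 * κ / b * ((S + 1) ^ 2 * R) := by ring
    have h5 : 0 ≤ κ * S ^ 2 := by positivity
    rw [h4]
    linarith
  have k2 : 18 * κ * e * ((S + 1) ^ 2 / S ^ 2) + 6 * κ / b * (9 / 2 * e) * R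
      ≤ 6 * κ / b * (9 / 2 * e) := by
    have h1 := mul_le_mul_of_nonneg_left t2 (by positivity : 0 ≤ 18 * κ * e)
    have h2 := mul_le_mul_of_nonneg_left hR1 (by positivity : 0 ≤ 6 * κ / b * (9 / 2 * e))
    have h3 : 6 * κ / b * (9 / 2 * e) * (1 - 89 / 100 * b)
        = 6 * κ / b * (9 / 2 * e) - 2403 / 100 * κ * e := by
      field_simp; ring
    have h5 : 0 ≤ κ * e := by positivity
    linarith
  have k3 := mul_le_mul_of_nonneg_left hcuR (by positivity : 0 ≤ 1 / 2 * ψ)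
  rw [e1, e2, weightB, weightB, mul_assoc (w * L) (_ + _) R, ← mul_add, ← mul_add]
  refine mul_le_mul_of_nonneg_left ?_ (by positivity)
  linarith

lemma cube_succ_mul_le (hS : 0 < S) : (S + 1) ^ 3 * (1 - 9 / (2 * S)) ≤ S ^ 3 := by
  have e : (S + 1) ^ 3 * (1 - 9 / (2 * S)) = (S + 1) ^ 3 * (2 * S - 9) / (2 * S) := by
    field_simp
  rw [e, div_le_iff₀ (by positivity)]
  nlinarith [pow_pos hS 2, pow_pos hS 3]

lemma weightB_inflow_eq (hn : 0 < n) (hμ : 0 < μ) (hκ : 0 < κ) (hb : 0 < b) (hS : 0 < S) {y : ℝ}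
    (hy : κ ^ 2 * lam ^ 2 = y * S ^ 2 * b ^ 2) :
    weightB w (κ * μ) κ b e (S + 1) ψ * (1 + b / 100)
        * (10 / (7 * b) * (lam ^ 2 * (6 / (μ * S)) ^ 2) * (5 / 2 * (κ * μ) * n))
      = w * n * ((6 * κ / b * (3 * (S + 1) ^ 2 + 9 / 2 * e) + 1 / 2 * (S + 1) ^ 3 * ψ)
          * (1 + b / 100) * (900 / 7 * (b * y))) := by
  rw [weightB]
  generalize 6 * κ / b * (3 * (S + 1) ^ 2 + 9 / 2 * e) + 1 / 2 * (S + 1) ^ 3 * ψ = Y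
  have h : 10 / (7 * b) * (lam ^ 2 * (6 / (μ * S)) ^ 2) * (5 / 2 * (κ * μ) * n) * (κ * μ)
      = n * (900 / 7 * (b * y)) := by
    have : 10 / (7 * b) * (lam ^ 2 * (6 / (μ * S)) ^ 2) * (5 / 2 * (κ * μ) * n) * (κ * μ)
        = 900 / 7 * n * (κ ^ 2 * lam ^ 2) / (b * S ^ 2) := by
      field_simp; ring
    rw [this, hy]
    field_simp
  linear_combination w * Y * (1 + b / 100) * h

/-- The parts of B without ψ feed back suboptimality, paid for by the gain of the distance term. The
constant 2000 in e makes that gain large enough while 1440y ≤ 1 keeps the contribution of e itself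
under control. -/
lemma weightB_inflow_le (hκ : 0 < κ) (hb0 : 0 < b) (hb1 : b ≤ 1) (hS : 0 < S) {y : ℝ}
    (hy0 : 0 ≤ y) (hy1 : 1440 * y ≤ 1) :
    6 * κ / b * (3 * (S + 1) ^ 2 + 9 / 2 * (2000 * y * S ^ 2)) * (1 + b / 100)
        * (900 / 7 * (b * y))
      ≤ 4 * κ * (2000 * y * S ^ 2) * ((S + 1) ^ 2 / S ^ 2) := by
  have h1 : 6 * κ / b * (3 * (S + 1) ^ 2 + 9 / 2 * (2000 * y * S ^ 2)) * (1 + b / 100)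
        * (900 / 7 * (b * y))
      = 5400 / 7 * (1 + b / 100) * (κ * y) * (3 * (S + 1) ^ 2 + 9 / 2 * (2000 * y * S ^ 2)) := by
    field_simp; ring
  have h2 : 4 * κ * (2000 * y * S ^ 2) * ((S + 1) ^ 2 / S ^ 2)
      = 8000 * (κ * y) * (S + 1) ^ 2 := by
    field_simp; ring
  have hSS : S ^ 2 ≤ (S + 1) ^ 2 := by nlinarith
  have h3 : 9 / 2 * (2000 * y * S ^ 2) ≤ 25 / 4 * (S + 1) ^ 2 := by
    have := mul_le_mul_of_nonneg_right hy1 (sq_nonneg S)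
    linarith
  have hb101 : 1 + b / 100 ≤ 101 / 100 := by linarith
  rw [h1, h2]
  calc 5400 / 7 * (1 + b / 100) * (κ * y) * (3 * (S + 1) ^ 2 + 9 / 2 * (2000 * y * S ^ 2))
      ≤ 5400 / 7 * (101 / 100) * (κ * y) * (3 * (S + 1) ^ 2 + 25 / 4 * (S + 1) ^ 2) := by
        gcongr
    _ ≤ _ := by
        have : 0 ≤ κ * y * (S + 1) ^ 2 := by positivity
        linarith

/-- The decay 1 - 9/(2S) outweighs the growth of S³. Of the suboptimality returned by the
disagreement, the part with ψ is covered by the increase of the bracket in A as ψ shrinks backwards,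
the rest by the distance term. -/
lemma weightA_step_le (hw : 0 ≤ w) (hn : 0 < n) (hμ : 0 < μ) (hκ : 1 ≤ κ) (hL : L = κ * μ)
    (hb0 : 0 < b) (hb1 : b ≤ 1) (hS : 7 ≤ S)
    (he : e = 2000 * (κ * lam / b) ^ 2) (hkl : 1440 * (κ * lam / b) ^ 2 ≤ S ^ 2)
    (hψ0 : 0 ≤ ψ) (hψ1 : ψ ≤ 1) :
    weightA w n (S + 1) ψ * (1 - 3 / 4 * (6 / (μ * S) * μ))
      + weightB w L κ b e (S + 1) ψ * (1 + b / 100)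
        * (10 / (7 * b) * (lam ^ 2 * (6 / (μ * S)) ^ 2) * (5 / 2 * L * n))
      ≤ weightA w n S ((1 - 7 / 50 * b) * ψ)
        + weightE w L e (S + 1) * (1 + 1 / S) * (2 / 3 * (6 / (μ * S)) * n) := by
  have hS0 : 0 < S := by linarith
  have hκ0 : 0 < κ := by linarith
  obtain ⟨y, hy⟩ : ∃ y, y = (κ * lam / b) ^ 2 / S ^ 2 := ⟨_, rfl⟩
  have hy0 : 0 ≤ y := by rw [hy]; positivity
  have hyS : (κ * lam / b) ^ 2 = y * S ^ 2 := by rw [hy]; field_simp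
  have hy1 : 1440 * y ≤ 1 := by
    rw [hyS] at hkl
    have : 0 < S ^ 2 := by positivity
    nlinarith
  have hkl2 : κ ^ 2 * lam ^ 2 = y * S ^ 2 * b ^ 2 := by
    rw [← hyS]; field_simp
  have heS : e = 2000 * y * S ^ 2 := by rw [he, hyS]; ring
  have e1 : weightA w n (S + 1) ψ * (1 - 3 / 4 * (6 / (μ * S) * μ))
      = w * n * ((S + 1) ^ 3 * (1 - 9 / (2 * S)) * (1 + (1 - ψ) / 2)) := by
    have : 6 / (μ * S) * μ = 6 / S := by field_simp
    rw [weightA, this]; ring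
  have e3 : weightE w (κ * μ) e (S + 1) * (1 + 1 / S) * (2 / 3 * (6 / (μ * S)) * n)
      = w * n * (4 * κ * e * ((S + 1) ^ 2 / S ^ 2)) := by
    rw [weightE]; field_simp; ring
  subst hL
  rw [e1, weightB_inflow_eq hn hμ hκ0 hb0 hS0 hkl2, e3, weightA, mul_assoc (w * n) (S ^ 3),
    ← mul_add, ← mul_add]
  refine mul_le_mul_of_nonneg_left ?_ (by positivity)
  clear e1 e3 he hkl hkl2 hyS hy
  have hg2 : S + 1 ≤ 8 / 7 * S := by linarith
  have hcu : (S + 1) ^ 3 ≤ 512 / 343 * S ^ 3 := by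
    have := pow_le_pow_left₀ (by positivity) hg2 3
    linarith
  have k1 := mul_le_mul_of_nonneg_right (cube_succ_mul_le hS0) (by linarith : 0 ≤ 1 + (1 - ψ) / 2)
  -- Replacing ψ by (1 - 7b/50)ψ raises 1 + (1-ψ)/2 by exactly 7bψ/100.
  have k2 : 1 / 2 * (S + 1) ^ 3 * ψ * (1 + b / 100) * (900 / 7 * (b * y))
      ≤ 7 / 100 * b * ψ * S ^ 3 := by
    have h1 : 1 / 2 * (S + 1) ^ 3 * ψ * (1 + b / 100) * (900 / 7 * (b * y))
        = 450 / 7 * (b * ψ) * ((1 + b / 100) * y) * (S + 1) ^ 3 := by ring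
    have h2 : (1 + b / 100) * y ≤ 101 / 100 * (1 / 1440) :=
      mul_le_mul (by linarith) (by linarith) hy0 (by norm_num)
    have h3 := mul_le_mul h2 hcu (by positivity) (by norm_num)
    have h4 := mul_le_mul_of_nonneg_left h3 (by positivity : 0 ≤ 450 / 7 * (b * ψ))
    have hz : 0 ≤ b * ψ * S ^ 3 := by positivity
    rw [h1]
    linarith
  have k3 := weightB_inflow_le hκ0 hb0 hb1 hS0 hy0 hy1
  rw [← heS] at k3
  linarith

end Weights

/-! ### The weights are small enough for the noise. -/

section WeightBounds

variable {w n S ψ L μ κ b e lam d s2 θ : ℝ}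

lemma weightA_noise_le (hw : 0 ≤ w) (hn : 0 < n) (hμ : 0 < μ) (hκ : 1 ≤ κ) (hS : 7 ≤ S)
    (hψ0 : 0 ≤ ψ) (hs : 0 ≤ s2) (hwS : w * (S + 1) ^ 2 ≤ θ)
    (hθ : 864000 * θ * s2 * κ ^ 2 ≤ μ) :
    216 * (weightA w n (S + 1) ψ * (6 / (μ * S))) * (s2 / n) ≤ 1 := by
  have hS0 : 0 < S := by linarith
  have h1 : 216 * (weightA w n (S + 1) ψ * (6 / (μ * S))) * (s2 / n)
      = 1296 * (w * (S + 1) ^ 2) * ((S + 1) / S) * (1 + (1 - ψ) / 2) * s2 / μ := by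
    rw [weightA]; field_simp; ring
  have h2 : (S + 1) / S ≤ 8 / 7 := by rw [div_le_iff₀ hS0]; linarith
  have hθ0 : 0 ≤ θ := le_trans (by positivity) hwS
  -- With only `0 ≤ ψ` assumed, the bracket may be nonpositive; the claim is then trivial.
  rcases le_or_gt (1 + (1 - ψ) / 2) 0 with h0 | h0
  · rw [h1]
    have : 1296 * (w * (S + 1) ^ 2) * ((S + 1) / S) * (1 + (1 - ψ) / 2) * s2 / μ ≤ 0 :=
      div_nonpos_of_nonpos_of_nonneg
        (mul_nonpos_of_nonpos_of_nonneg (mul_nonpos_of_nonneg_of_nonpos (by positivity) h0) hs)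
        hμ.le
    linarith
  rw [h1, div_le_one hμ]
  have h3 : 1296 * (w * (S + 1) ^ 2) * ((S + 1) / S) * (1 + (1 - ψ) / 2) * s2
      ≤ 1296 * θ * (8 / 7) * (3 / 2) * s2 := by
    gcongr
    linarith
  have h4 : θ * s2 ≤ θ * s2 * κ ^ 2 := le_mul_of_one_le_right (by positivity) (by nlinarith)
  have h5 : 0 ≤ θ * s2 := by positivity
  linarith

lemma weightE_noise_le (hw : 0 ≤ w) (hμ : 0 < μ) (hκ : 1 ≤ κ) (hL : L = κ * μ) (hS : 7 ≤ S)
    (he : e ≤ 25 / 18 * S ^ 2) (hs : 0 ≤ s2) (hwS : w * (S + 1) ^ 2 ≤ θ)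
    (hθ : 864000 * θ * s2 * κ ^ 2 ≤ μ) :
    108 * (weightE w L e (S + 1) * (6 / (μ * S)) ^ 2) * s2 ≤ 1 / S := by
  have hS0 : 0 < S := by linarith
  have hθ0 : 0 ≤ θ := le_trans (by positivity) hwS
  have h1 : 108 * (weightE w L e (S + 1) * (6 / (μ * S)) ^ 2) * s2
      = 3888 * (w * (S + 1)) * κ * (e / S ^ 2) * s2 / μ := by
    rw [weightE, hL]; field_simp; ring
  have h2 : e / S ^ 2 ≤ 25 / 18 := by rw [div_le_iff₀ (by positivity)]; exact he
  rw [h1, div_le_div_iff₀ hμ hS0]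
  have h3 : 3888 * (w * (S + 1)) * κ * (e / S ^ 2) * s2 * S
      ≤ 3888 * (w * (S + 1)) * κ * (25 / 18) * s2 * (S + 1) := by
    gcongr
    linarith
  have h4 : w * (S + 1) ^ 2 * (κ * s2) ≤ θ * (κ * s2) :=
    mul_le_mul_of_nonneg_right hwS (by positivity)
  have h5 : θ * s2 * κ ≤ θ * s2 * κ ^ 2 :=
    mul_le_mul_of_nonneg_left (by nlinarith) (by positivity)
  have h6 : 0 ≤ θ * s2 * κ ^ 2 := by positivity
  linarith

/-- The quadratic weight of the disagreement noise. -/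
lemma weightB_quad_le (hw : 0 ≤ w) (hμ : 0 < μ) (hκ : 1 ≤ κ) (hL : L = κ * μ) (hb0 : 0 < b)
    (hS : 7 ≤ S) (he : e ≤ 25 / 18 * S ^ 2) (hψ0 : 0 ≤ ψ) :
    weightB w L κ b e (S + 1) ψ * lam ^ 2 * (6 / (μ * S)) ^ 2
      ≤ w * L * lam ^ 2 * (6 / μ) ^ 2 * (73 * κ / b + (S + 1) * ψ) := by
  have hS0 : 0 < S := by linarith
  have hL0 : 0 ≤ L := by rw [hL]; positivity
  have h1 : weightB w L κ b e (S + 1) ψ * lam ^ 2 * (6 / (μ * S)) ^ 2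
      = w * L * lam ^ 2 * (6 / μ) ^ 2 *
        ((6 * κ / b * (3 * (S + 1) ^ 2 + 9 / 2 * e) + 1 / 2 * (S + 1) ^ 3 * ψ) / S ^ 2) := by
    rw [weightB]
    generalize 6 * κ / b * (3 * (S + 1) ^ 2 + 9 / 2 * e) + 1 / 2 * (S + 1) ^ 3 * ψ = Y
    field_simp
  rw [h1]
  refine mul_le_mul_of_nonneg_left ?_ (by positivity)
  rw [div_le_iff₀ (by positivity)]
  have hsq : (S + 1) ^ 2 ≤ 64 / 49 * S ^ 2 := by nlinarith
  have h2 : 3 * (S + 1) ^ 2 + 9 / 2 * e ≤ 73 / 6 * S ^ 2 := by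
    have : 0 ≤ S ^ 2 := sq_nonneg S
    linarith
  have h3 := mul_le_mul_of_nonneg_left h2 (by positivity : 0 ≤ 6 * κ / b)
  have h4 := mul_le_mul_of_nonneg_left hsq (by positivity : 0 ≤ 1 / 2 * (S + 1) * ψ)
  have h5 : 0 ≤ (S + 1) * ψ * S ^ 2 := by positivity
  have h6 : 6 * κ / b * (73 / 6 * S ^ 2) = 73 * κ / b * S ^ 2 := by ring
  linarith

/-- Both 73κ/b and (S+1)ψ are at most multiples of κ(S+1), because 4 ≤ bS. The condition on s
removes s²λ²κ² in exchange for μbS, and only b·w·S(S+1) ≤ bθ is left. -/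
lemma weightB_noise_le (hw : 0 ≤ w) (hμ : 0 < μ) (hκ : 1 ≤ κ) (hL : L = κ * μ) (hb0 : 0 < b)
    (hS : 7 ≤ S) (hbS : 4 ≤ b * S) (he : e ≤ 25 / 18 * S ^ 2) (hψ0 : 0 ≤ ψ) (hψ1 : ψ ≤ 1)
    (hwS : w * (S + 1) ^ 2 ≤ θ) (hθ : 2000 * θ ≤ 1) {s : ℝ}
    (hs : 5184 * s ^ 2 * lam ^ 2 * κ ^ 2 ≤ μ * b * S) :
    10800 * (weightB w L κ b e (S + 1) ψ * lam ^ 2 * (6 / (μ * S)) ^ 2) * s ^ 2 ≤ b := by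
  have hS0 : 0 < S := by linarith
  have h1 := mul_le_mul_of_nonneg_right (weightB_quad_le (lam := lam) hw hμ hκ hL hb0 hS he hψ0)
    (by positivity : 0 ≤ 10800 * s ^ 2)
  have h2 : w * L * lam ^ 2 * (6 / μ) ^ 2 * (73 * κ / b + (S + 1) * ψ) * (10800 * s ^ 2)
      = w * (388800 / (κ * μ)) * (s ^ 2 * lam ^ 2 * κ ^ 2) * (73 * κ / b + (S + 1) * ψ) := by
    rw [hL]; field_simp; ring
  have h3 : 73 * κ / b + (S + 1) * ψ ≤ 77 / 4 * κ * (S + 1) := by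
    have e1 : 73 * κ / b ≤ 73 / 4 * κ * (S + 1) := by
      rw [div_le_iff₀ hb0]
      nlinarith
    have e2 : (S + 1) * ψ ≤ κ * (S + 1) := by
      rw [mul_comm κ]
      exact mul_le_mul_of_nonneg_left (by linarith) (by linarith)
    linarith
  have h4 : w * (388800 / (κ * μ)) * (s ^ 2 * lam ^ 2 * κ ^ 2) * (73 * κ / b + (S + 1) * ψ)
      ≤ w * (388800 / (κ * μ)) * (μ * b * S / 5184) * (77 / 4 * κ * (S + 1)) := by
    gcongr
    linarith
  have h5 : w * (388800 / (κ * μ)) * (μ * b * S / 5184) * (77 / 4 * κ * (S + 1))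
      = 5775 / 4 * b * (w * (S * (S + 1))) := by
    field_simp; ring
  have h6 : w * (S * (S + 1)) ≤ θ :=
    (mul_le_mul_of_nonneg_left (by nlinarith) hw).trans hwS
  have h7 := mul_le_mul_of_nonneg_left h6 (by positivity : 0 ≤ 5775 / 4 * b)
  have h8 := mul_le_mul_of_nonneg_left hθ hb0.le
  linarith

/-- The quadratic weight of the noise of the averaged model. -/
lemma weight_avg_quad_le (hw : 0 ≤ w) (hn : 0 < n) (hμ : 0 < μ) (hκ : 1 ≤ κ) (hL : L = κ * μ)
    (hS : 7 ≤ S) (he : e ≤ 25 / 18 * S ^ 2) (hψ0 : 0 ≤ ψ) (hd : 0 ≤ d) (hs : 0 ≤ s2) :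
    (weightA w n (S + 1) ψ * (6 / (μ * S)) ^ 2 * L
        + weightE w L e (S + 1) * n * (6 / (μ * S)) ^ 2) * d * (s2 / n)
      ≤ 142 * w * (S + 1) * (d * s2 * κ / μ) := by
  have hS0 : 0 < S := by linarith
  have h1 : (weightA w n (S + 1) ψ * (6 / (μ * S)) ^ 2 * L
        + weightE w L e (S + 1) * n * (6 / (μ * S)) ^ 2) * d * (s2 / n)
      = 36 * w * (S + 1) * (d * s2 * κ / μ)
        * (((S + 1) ^ 2 * (1 + (1 - ψ) / 2) + e) / S ^ 2) := by
    rw [weightA, weightE, hL]; field_simp; ring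
  have h2 : ((S + 1) ^ 2 * (1 + (1 - ψ) / 2) + e) / S ^ 2 ≤ 142 / 36 := by
    rw [div_le_iff₀ (by positivity)]
    have hsq : (S + 1) ^ 2 ≤ 64 / 49 * S ^ 2 := by nlinarith
    have h3 : (S + 1) ^ 2 * (1 + (1 - ψ) / 2) ≤ (S + 1) ^ 2 * (3 / 2) :=
      mul_le_mul_of_nonneg_left (by linarith) (by positivity)
    have : 0 ≤ S ^ 2 := sq_nonneg S
    linarith
  rw [h1]
  refine (mul_le_mul_of_nonneg_left h2 (by positivity)).trans (le_of_eq ?_)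
  ring

lemma weight_avg_noise_le (hw : 0 ≤ w) (hn : 0 < n) (hμ : 0 < μ) (hκ : 1 ≤ κ) (hL : L = κ * μ)
    (hS : 7 ≤ S) (he : e ≤ 25 / 18 * S ^ 2) (hψ0 : 0 ≤ ψ) (hd : 0 ≤ d) (hs : 0 ≤ s2)
    (hwS : w * (S + 1) ^ 2 ≤ θ) (hθ : 2000 * θ ≤ 1) (hds : 17280 * d * s2 * κ ≤ μ * S) :
    24 * (weightA w n (S + 1) ψ * (6 / (μ * S)) ^ 2 * L
        + weightE w L e (S + 1) * n * (6 / (μ * S)) ^ 2) * d * (s2 / n) ≤ 1 := by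
  have hS0 : 0 < S := by linarith
  have h1 := weight_avg_quad_le hw hn hμ hκ hL hS he hψ0 hd hs
  have h2 : d * s2 * κ / μ ≤ (S + 1) / 17280 := by
    rw [div_le_iff₀ hμ]
    nlinarith
  have h3 := mul_le_mul_of_nonneg_left h2 (by positivity : 0 ≤ 142 * w * (S + 1))
  nlinarith

end WeightBounds

/-! ### From one-step bounds to the process, and Markov's inequality. -/

section Moments

variable {n d : ℕ} {Ω Ξ : Type*} [MeasurableSpace Ω] [MeasurableSpace Ξ] {P : Measure Ω}
  [IsProbabilityMeasure P] {loss : Vec d → Ξ → ℝ} {D : Fin n → Measure Ξ}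
  {ξ : ℕ → Fin n → Ω → Ξ} {W : Matrix (Fin n) (Fin n) ℝ} {x₁ : Fin n → Vec d}
  {σ : Fin n → ℝ} {L μ : ℝ}

lemma hasQuadraticBounds_localCost (hsc : SmoothStronglyConvex (localCost loss D) μ)
    (hlip : LipschitzGradients (localCost loss D) L) (i : Fin n) :
    HasQuadraticBounds (localCost loss D i) (∇ (localCost loss D i)) μ L :=
  ⟨hsc.strong i, le_add_inner_gradient ((hsc.contDiff i).differentiable (by norm_num)) (hlip i)⟩

lemma measurable_potential {f : Fin n → Vec d → ℝ} (hf : ∀ i, Continuous (f i)) (xs : Vec d)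
    (A E B : ℝ) : Measurable (potential f xs A E B) := by
  have hc : Continuous (potential f xs A E B) := by
    unfold potential netAvg
    fun_prop
  exact hc.measurable

/-- The increase of the logarithmic exponential moment over one iteration with step-size `α`. -/
noncomputable def momentIncrease (n d : ℕ) (A E B α L lam s2 H : ℝ) : ℝ :=
  B * (1 + (1 - lam) / 100) * (50 / (7 * (1 - lam)) * (lam ^ 2 * α ^ 2)) * H
    + 12 * (A * α ^ 2 * L + E * n * α ^ 2) * d * (s2 / n)
    + 3 * (B * lam ^ 2 * α ^ 2) * (n * s2)

variable {α : ℕ → ℝ} {F : ℕ → MeasurableSpace Ω}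

/-- The estimate for deterministic models X transfers to the iterates, because the models of
iteration t + 1 are independent of its samples. -/
lemma lintegral_exp_potential_dsgd_le (hloss : IsLoss loss D)
    (hor : IsSubGaussianOracle P loss D ξ F σ) {t : ℕ} (hF : F (t + 1) ≤ ‹MeasurableSpace Ω›)
    (hσ : ∀ i, 0 < σ i) (hf : ∀ i, Continuous (localCost loss D i)) {xs : Vec d}
    {A E B A' E' B' C : ℝ}
    (hstep : ∀ (X : Fin n → Vec d) (z : Fin n → Ω → Vec d), iIndepFun z P →
      (∀ i, IsSubGaussianNoise P (z i) (σ i)) →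
      ∫⁻ ω, ENNReal.ofReal (Real.exp (potential (localCost loss D) xs A E B
        (fun i => ∑ j, W i j • (X j - α (t + 1) • (∇ (localCost loss D j) (X j) + z j ω))))) ∂P
      ≤ ENNReal.ofReal (Real.exp (potential (localCost loss D) xs A' E' B' X + C))) :
    ∫⁻ ω, ENNReal.ofReal (Real.exp (potential (localCost loss D) xs A E B
        (fun i => dsgd W α loss ξ x₁ (t + 2) i ω))) ∂P
      ≤ ENNReal.ofReal (Real.exp C) * ∫⁻ ω, ENNReal.ofReal (Real.exp
        (potential (localCost loss D) xs A' E' B' (fun i => dsgd W α loss ξ x₁ (t + 1) i ω))) ∂P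
      := by
  have hX : Measurable fun ω i => dsgd W α loss ξ x₁ (t + 1) i ω :=
    measurable_pi_lambda _ fun i => hor.measurable_dsgd hloss (t + 1) i
  have hY : Measurable fun ω i => ξ (t + 1) i ω :=
    measurable_pi_lambda _ fun i => hor.measurable_sample (t + 1) (by omega) i
  have hpot := measurable_potential hf xs A E B
  have hpot' := measurable_potential hf xs A' E' B'
  have hg : ∀ j, Measurable fun p : (Fin n → Vec d) × (Fin n → Ξ) =>
      stochGrad loss (p.1 j) (p.2 j) := fun j =>
    hloss.measurable_grad.comp (Measurable.prodMk (by fun_prop) (by fun_prop))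
  have h := lintegral_le_of_indepFun hX hY (hor.indepFun_dsgd hloss t)
    (h := fun X s => ENNReal.ofReal (Real.exp (potential (localCost loss D) xs A E B
      (fun i => ∑ j, W i j • (X j - α (t + 1) • stochGrad loss (X j) (s j))))))
    (b := fun X => ENNReal.ofReal (Real.exp (potential (localCost loss D) xs A' E' B' X + C)))
    (by
      refine ENNReal.measurable_ofReal.comp (Real.measurable_exp.comp (hpot.comp ?_))
      refine measurable_pi_lambda _ fun i => Finset.measurable_fun_sum _ fun j _ => ?_
      have hx : Measurable fun p : (Fin n → Vec d) × (Fin n → Ξ) => p.1 j := by fun_prop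
      exact (hx.sub ((hg j).const_smul (α (t + 1)))).const_smul (W i j))
    (by fun_prop)
    (fun c => by
      have := hstep c _ (hor.iIndepFun_noise hloss t c fun i => ∇ (localCost loss D i) (c i))
        (fun i => hor.isSubGaussianNoise hloss hF i (hσ i) (c i))
      simpa only [add_sub_cancel] using this)
  refine h.trans (le_of_eq ?_)
  rw [← lintegral_const_mul' _ _ ENNReal.ofReal_ne_top]
  refine lintegral_congr fun ω => ?_
  rw [← ENNReal.ofReal_mul (Real.exp_pos _).le, ← Real.exp_add, add_comm]

/-- Markov's inequality for an exponential moment. -/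
lemma one_sub_le_prob_of_lintegral_exp_le {V : Ω → ℝ} (hV : Measurable V) {M δ : ℝ} (hδ : 0 < δ)
    (h : ∫⁻ ω, ENNReal.ofReal (Real.exp (V ω)) ∂P ≤ ENNReal.ofReal (Real.exp M)) :
    1 - δ ≤ P.real {ω | V ω ≤ M + Real.log (2 / δ)} := by
  have hset : MeasurableSet {ω | V ω ≤ M + Real.log (2 / δ)} := measurableSet_le hV (by fun_prop)
  have hcompl : P.real {ω | V ω ≤ M + Real.log (2 / δ)}ᶜ ≤ δ := by
    have h1 := mul_meas_ge_le_lintegral₀ (μ := P)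
      (f := fun ω => ENNReal.ofReal (Real.exp (V ω))) (by fun_prop)
      (ENNReal.ofReal (Real.exp (M + Real.log (2 / δ))))
    have h2 : P {ω | V ω ≤ M + Real.log (2 / δ)}ᶜ
        ≤ P {ω | ENNReal.ofReal (Real.exp (M + Real.log (2 / δ)))
          ≤ ENNReal.ofReal (Real.exp (V ω))} := by
      refine measure_mono fun ω hω => ?_
      simp only [Set.mem_compl_iff, Set.mem_ofPred_eq, not_le] at hω ⊢
      exact ENNReal.ofReal_le_ofReal (Real.exp_le_exp.2 hω.le)
    have h3 := (mul_le_mul_right h2 (ENNReal.ofReal (Real.exp (M + Real.log (2 / δ))))).trans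
      (h1.trans h)
    have h4 := ENNReal.toReal_mono ENNReal.ofReal_ne_top h3
    rw [ENNReal.toReal_mul, ENNReal.toReal_ofReal (Real.exp_pos _).le,
      ENNReal.toReal_ofReal (Real.exp_pos _).le, Real.exp_add, Real.exp_log (by positivity),
      mul_assoc] at h4
    have h5 : 2 / δ * P.real {ω | V ω ≤ M + Real.log (2 / δ)}ᶜ ≤ 1 := by
      have := Real.exp_pos M
      exact le_of_mul_le_mul_left (by rw [mul_one]; exact h4) this
    have h6 : 0 ≤ P.real {ω | V ω ≤ M + Real.log (2 / δ)}ᶜ := measureReal_nonneg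
    rw [div_mul_eq_mul_div, div_le_one hδ] at h5
    linarith
  rw [probReal_compl_eq_one_sub hset] at hcompl
  linarith

end Moments

/-! ### Comparison of the accumulated bound with the rate. -/

section Rate

lemma momentIncrease_le {n d : ℕ} {w S ψ L μ κ b e lam s2 H : ℝ} (hw : 0 ≤ w) (hn : 0 < n)
    (hμ : 0 < μ) (hκ : 1 ≤ κ) (hL : L = κ * μ) (hb0 : 0 < b) (hb1 : b ≤ 1) (hb : 1 - lam = b)
    (hS : 7 ≤ S) (he : e ≤ 25 / 18 * S ^ 2) (hψ0 : 0 ≤ ψ) (hs : 0 ≤ s2) (hH : 0 ≤ H) :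
    momentIncrease n d (weightA w n (S + 1) ψ) (weightE w L e (S + 1))
        (weightB w L κ b e (S + 1) ψ) (6 / (μ * S)) L lam s2 H
      ≤ w * L * lam ^ 2 * (6 / μ) ^ 2 * (73 * κ / b + (S + 1) * ψ) * (8 / b * H + 3 * (n * s2))
        + 1704 * w * (S + 1) * (d * s2 * κ / μ) := by
  have hn' : (0 : ℝ) < n := by positivity
  have h1 := weightB_quad_le (lam := lam) hw hμ hκ hL hb0 hS he hψ0
  have h2 := weight_avg_quad_le hw hn' hμ hκ hL hS he hψ0 (Nat.cast_nonneg d) hs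
  have h3 : (1 + b / 100) * (50 / (7 * b)) * H ≤ 8 / b * H := by
    refine mul_le_mul_of_nonneg_right ?_ hH
    rw [mul_div_assoc', div_le_div_iff₀ (by positivity) hb0]
    nlinarith
  have h0 : 0 ≤ w * L * lam ^ 2 * (6 / μ) ^ 2 * (73 * κ / b + (S + 1) * ψ) := by
    rw [hL]
    have : 0 ≤ S := by linarith
    positivity
  have h4 : 0 ≤ (1 + b / 100) * (50 / (7 * b)) * H := by positivity
  have h5 := mul_le_mul_of_nonneg_right h1
    (by positivity : 0 ≤ (1 + b / 100) * (50 / (7 * b)) * H + 3 * (n * s2))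
  have h6 := mul_le_mul_of_nonneg_left h3 h0
  rw [momentIncrease, hb]
  linarith

/-- A geometric series, with 50/7 ≤ 8. It is what makes the S³ part of B cost 1/b iterations instead
of T. -/
lemma sum_pow_tail_le {b : ℝ} (hb0 : 0 < b) (hb1 : b ≤ 1) (T : ℕ) :
    ∑ s ∈ Finset.Ico 1 T, (1 - 7 / 50 * b) ^ (T - (s + 1)) ≤ 8 / b := by
  have h1 : ∑ s ∈ Finset.Ico 1 T, (1 - 7 / 50 * b) ^ (T - (s + 1))
      ≤ ∑ s ∈ Finset.range T, (1 - 7 / 50 * b) ^ (T - 1 - s) := by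
    refine (Finset.sum_le_sum_of_subset_of_nonneg (t := Finset.range T) (fun s hs => ?_)
      fun s _ _ => pow_nonneg (by linarith) _).trans (le_of_eq ?_)
    · simp only [Finset.mem_Ico, Finset.mem_range] at hs ⊢; omega
    · exact Finset.sum_congr rfl fun s _ => by congr 1; omega
  refine h1.trans ?_
  rw [Finset.sum_range_reflect (fun s => (1 - 7 / 50 * b) ^ s) T, geom_sum_eq (by linarith),
    ← neg_div_neg_eq, div_le_div_iff₀ (by linarith) hb0]
  have : 0 ≤ (1 - 7 / 50 * b) ^ T := pow_nonneg (by linarith) _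
  nlinarith

lemma lastIterateRate_nonneg {n d : ℕ} {a t₀ S ν δ s2 μ L lam H R Δ : ℝ} (ha : 0 ≤ a)
    (ht : 0 ≤ t₀) (hS : 1 ≤ S) (hν : 0 ≤ ν) (hδ0 : 0 < δ) (hδ1 : δ < 1) (hs : 0 ≤ s2)
    (hμ : 0 ≤ μ) (hL : 0 ≤ L) (hlam : lam < 1) (hH : 0 ≤ H) (hR : 0 ≤ R) (hΔ : 0 ≤ Δ) :
    0 ≤ lastIterateRate n d a t₀ S ν δ s2 μ L lam H R Δ := by
  have h1 : 0 ≤ Real.log (2 / δ) := Real.log_nonneg (by rw [le_div_iff₀ hδ0]; linarith)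
  have h2 : 0 ≤ Real.log S := Real.log_nonneg hS
  have h3 : 0 ≤ 1 - lam := by linarith
  have h4 : 0 ≤ S := by linarith
  unfold lastIterateRate
  positivity

lemma bound_le_lastIterateRate {n d : ℕ} {t₀ Z ν δ s2 μ L lam H R Δ κ b w : ℝ} (hn : 0 < n)
    (ht : 0 ≤ t₀) (hZ : 1 ≤ Z) (hν : 0 < ν) (hδ0 : 0 < δ) (hδ1 : δ < 1) (hs : 0 ≤ s2)
    (hμ : 0 < μ) (hκ : 1 ≤ κ) (hL : L = κ * μ) (hb0 : 0 < b) (hb : 1 - lam = b)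
    (hH : 0 ≤ H) (hR : 0 ≤ R) (hΔ : 0 ≤ Δ) (hw : w = ν / 2000 / Z ^ 2) :
    (w * n * (1 + t₀) ^ 3 * (3 / 2) * Δ + w * L * (2000 * (κ * lam / b) ^ 2) * (1 + t₀) * R
      + (w * L * lam ^ 2 * (6 / μ) ^ 2 * ((73 * κ + 8) * (Z / b)) * (8 / b * H + 3 * (n * s2))
        + 1704 * w * Z ^ 2 * (d * s2 * κ / μ)) + Real.log (2 / δ)) / (w * n * Z ^ 3)
      ≤ 2000 * lastIterateRate n d (6 / μ) t₀ Z ν δ s2 μ L lam H R Δ := by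
  have hn' : (0 : ℝ) < n := by positivity
  have hZ0 : 0 < Z := by linarith
  have hw0 : 0 < w := by rw [hw]; positivity
  have hlog : 0 ≤ Real.log (2 / δ) := Real.log_nonneg (by rw [le_div_iff₀ hδ0]; linarith)
  have hlogZ : 0 ≤ Real.log Z := Real.log_nonneg hZ
  have hL0 : 0 < L := by rw [hL]; positivity
  have haL : 6 / μ * L = 6 * κ := by rw [hL]; field_simp
  have hLμ : L / μ = κ := by rw [hL]; field_simp
  have b1 : w * n * (1 + t₀) ^ 3 * (3 / 2) * Δ / (w * n * Z ^ 3)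
      ≤ 2000 * ((1 + t₀) ^ 3 * Δ / Z ^ 3) := by
    have e : w * n * (1 + t₀) ^ 3 * (3 / 2) * Δ / (w * n * Z ^ 3)
        = 3 / 2 * ((1 + t₀) ^ 3 * Δ / Z ^ 3) := by field_simp
    have : 0 ≤ (1 + t₀) ^ 3 * Δ / Z ^ 3 := by positivity
    rw [e]; linarith
  have b2 : w * L * (2000 * (κ * lam / b) ^ 2) * (1 + t₀) * R / (w * n * Z ^ 3)
      ≤ 2000 * (lam ^ 2 * (6 / μ) ^ 2 * L ^ 3 * (1 + 6 * κ) * (1 + t₀) * R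
        / (b ^ 2 * n * Z ^ 3)) := by
    have e : w * L * (2000 * (κ * lam / b) ^ 2) * (1 + t₀) * R / (w * n * Z ^ 3)
        = 2000 * (1 / 36) * (lam ^ 2 * (6 / μ) ^ 2 * L ^ 3 * (1 + t₀) * R
          / (b ^ 2 * n * Z ^ 3)) := by
      rw [hL]; field_simp; ring
    have e' : lam ^ 2 * (6 / μ) ^ 2 * L ^ 3 * (1 + 6 * κ) * (1 + t₀) * R / (b ^ 2 * n * Z ^ 3)
        = (1 + 6 * κ) * (lam ^ 2 * (6 / μ) ^ 2 * L ^ 3 * (1 + t₀) * R / (b ^ 2 * n * Z ^ 3)) := by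
      ring
    have h0 : 0 ≤ lam ^ 2 * (6 / μ) ^ 2 * L ^ 3 * (1 + t₀) * R / (b ^ 2 * n * Z ^ 3) := by
      positivity
    rw [e, e']
    nlinarith [mul_le_mul_of_nonneg_right (by linarith : (1 : ℝ) / 36 ≤ 1 + 6 * κ) h0]
  have b3 : w * L * lam ^ 2 * (6 / μ) ^ 2 * ((73 * κ + 8) * (Z / b)) * (8 / b * H + 3 * (n * s2))
        / (w * n * Z ^ 3)
      ≤ 2000 * (lam ^ 2 * (6 / μ) ^ 2 * L * (1 + 6 * κ) * (n * s2 + H * (1 + κ ^ 2) / b)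
        / (b * n * Z ^ 2)) := by
    have e : w * L * lam ^ 2 * (6 / μ) ^ 2 * ((73 * κ + 8) * (Z / b))
        * (8 / b * H + 3 * (n * s2)) / (w * n * Z ^ 3)
        = lam ^ 2 * (6 / μ) ^ 2 * L / (b * n * Z ^ 2)
          * ((73 * κ + 8) * (8 * (H / b) + 3 * (n * s2))) := by
      field_simp
    have e' : 2000 * (lam ^ 2 * (6 / μ) ^ 2 * L * (1 + 6 * κ) * (n * s2 + H * (1 + κ ^ 2) / b)
        / (b * n * Z ^ 2)) = lam ^ 2 * (6 / μ) ^ 2 * L / (b * n * Z ^ 2)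
          * (2000 * (1 + 6 * κ) * (n * s2 + H / b * (1 + κ ^ 2))) := by
      field_simp
    rw [e, e']
    refine mul_le_mul_of_nonneg_left ?_ (by positivity)
    have hHb : 0 ≤ H / b := by positivity
    have hns : 0 ≤ n * s2 := by positivity
    have h1 : H / b ≤ H / b * (1 + κ ^ 2) := le_mul_of_one_le_right hHb (by nlinarith)
    calc (73 * κ + 8) * (8 * (H / b) + 3 * (n * s2))
        ≤ (73 * (1 + 6 * κ)) * (8 * (n * s2 + H / b * (1 + κ ^ 2))) := by
          gcongr
          · linarith
          · linarith
      _ ≤ _ := by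
          have : 0 ≤ (1 + 6 * κ) * (n * s2 + H / b * (1 + κ ^ 2)) := by positivity
          linarith
  -- The choice of w turns 1/(w n Z³) into 2000/(ν n Z), the coefficient of the confidence term.
  have b4 : 1704 * w * Z ^ 2 * (d * s2 * κ / μ) / (w * n * Z ^ 3) + Real.log (2 / δ) / (w * n * Z ^ 3)
      ≤ 2000 * ((ν⁻¹ * Real.log (2 / δ) + d * s2 * κ / μ) / (n * Z)) := by
    have e : 1704 * w * Z ^ 2 * (d * s2 * κ / μ) / (w * n * Z ^ 3)
        = 1704 * ((d * s2 * κ / μ) / (n * Z)) := by field_simp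
    have e' : Real.log (2 / δ) / (w * n * Z ^ 3)
        = 2000 * (ν⁻¹ * Real.log (2 / δ) / (n * Z)) := by rw [hw]; field_simp
    have : 0 ≤ (d * s2 * κ / μ) / (n * Z) := by positivity
    rw [e, e', add_div]
    linarith
  -- Only the sign of the logarithmic term of the rate is needed.
  have b5 : 0 ≤ s2 * lam ^ 2 * (6 / μ) ^ 4 * L ^ 3 * (6 / μ * L * Real.log Z + 1)
      / (b ^ 2 * Z ^ 3) := by positivity
  rw [lastIterateRate, hb, hLμ, haL] at *
  rw [add_div, add_div, add_div, add_div]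
  linarith

end Rate

/-! ### Induction over the iterations up to a fixed horizon. -/

section Main

variable {n d : ℕ} {Ω Ξ : Type*} [MeasurableSpace Ω] [MeasurableSpace Ξ] {P : Measure Ω}
  [IsProbabilityMeasure P] {loss : Vec d → Ξ → ℝ} {D : Fin n → Measure Ξ}
  {ξ : ℕ → Fin n → Ω → Ξ} {W : Matrix (Fin n) (Fin n) ℝ} {x₁ : Fin n → Vec d} {xs : Vec d}
  {σ : Fin n → ℝ} {L μ t₀ κ b lam w θ : ℝ} {F : ℕ → MeasurableSpace Ω}

/-- The increase in iteration `s` of the logarithmic exponential moment of the potential with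
horizon `T`. -/
noncomputable def horizonIncrease (n d T : ℕ) (w L μ κ b lam t₀ s2 H : ℝ) (s : ℕ) : ℝ :=
  momentIncrease n d (weightA w n (s + t₀ + 1) ((1 - 7 / 50 * b) ^ (T - (s + 1))))
    (weightE w L (2000 * (κ * lam / b) ^ 2) (s + t₀ + 1))
    (weightB w L κ b (2000 * (κ * lam / b) ^ 2) (s + t₀ + 1) ((1 - 7 / 50 * b) ^ (T - (s + 1))))
    (6 / (μ * (s + t₀))) L lam s2 H

/-- The potential of the models `X` of iteration `t`, with horizon `T`. -/
noncomputable def horizonPotential (loss : Vec d → Ξ → ℝ) (D : Fin n → Measure Ξ) (xs : Vec d)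
    (T : ℕ) (w L κ b lam t₀ : ℝ) (t : ℕ) (X : Fin n → Vec d) : ℝ :=
  potential (localCost loss D) xs (weightA w n (t + t₀) ((1 - 7 / 50 * b) ^ (T - t)))
    (weightE w L (2000 * (κ * lam / b) ^ 2) (t + t₀))
    (weightB w L κ b (2000 * (κ * lam / b) ^ 2) (t + t₀) ((1 - 7 / 50 * b) ^ (T - t))) X

/-- The weights at S dominate what one iteration makes of those at S + 1, so the increments
accumulate additively. The bound θ at the horizon controls w(S+1)² at every earlier time, which
makes the noise conditions hold throughout. -/
lemma lintegral_exp_horizonPotential_le (hn : 2 ≤ n) (hloss : IsLoss loss D)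
    (hor : IsSubGaussianOracle P loss D ξ F σ) (hF : ∀ t, F t ≤ ‹MeasurableSpace Ω›)
    (hσ : ∀ i, 0 < σ i) (hW : IsNetworkMatrix W)
    (hlip : LipschitzGradients (localCost loss D) L)
    (hsc : SmoothStronglyConvex (localCost loss D) μ)
    (hmin : ∀ y, globalCost loss D xs ≤ globalCost loss D y)
    (hμ : 0 < μ) (hκ : 1 ≤ κ) (hL : L = κ * μ) (hlam : lam = secondSingularValue W)
    (hb : 1 - lam = b) (ht₀ : 6 ≤ t₀) (hκt : 12 * κ ≤ 1 + t₀)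
    (hkl : 1440 * (κ * lam / b) ^ 2 ≤ t₀ ^ 2) (hbt : 4 ≤ b * (1 + t₀))
    (hσmax : ∀ i, 5184 * σ i ^ 2 * lam ^ 2 * κ ^ 2 ≤ μ * b * t₀)
    (hds : 17280 * d * avgNoiseSq σ * κ ≤ μ * t₀) (hθ1 : 2000 * θ ≤ 1)
    (hθ2 : 864000 * θ * avgNoiseSq σ * κ ^ 2 ≤ μ) (hw : 0 ≤ w) (T : ℕ)
    (hwθ : w * (T + t₀) ^ 2 ≤ θ) (t : ℕ) (ht1 : 1 ≤ t) (htT : t ≤ T) :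
    ∫⁻ ω, ENNReal.ofReal (Real.exp (horizonPotential loss D xs T w L κ b lam t₀ t
        (fun i => dsgd W (stepSize (6 / μ) t₀) loss ξ x₁ t i ω))) ∂P
      ≤ ENNReal.ofReal (Real.exp (horizonPotential loss D xs T w L κ b lam t₀ 1 x₁
        + ∑ s ∈ Finset.Ico 1 t, horizonIncrease n d T w L μ κ b lam t₀ (avgNoiseSq σ)
            (∑ i, ‖∇ (localCost loss D i) xs‖ ^ 2) s)) := by
  have hn' : (0 : ℝ) < n := by
    have : 0 < n := by omega
    positivity
  have hl0 : 0 ≤ lam := hlam ▸ secondSingularValue_nonneg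
  have hl1 : lam < 1 := hlam ▸ (hW.secondSingularValue_bound hn).1
  have hb0 : 0 < b := by linarith
  have hb1 : b ≤ 1 := by linarith
  have hL0 : 0 < L := by rw [hL]; positivity
  have hs0 : 0 ≤ avgNoiseSq σ := by unfold avgNoiseSq; positivity
  induction t, ht1 using Nat.le_induction with
  | base => simp [dsgd]
  | succ t ht1 ih =>
    obtain ⟨k, rfl⟩ : ∃ k, t = k + 1 := ⟨t - 1, by omega⟩
    obtain ⟨S, hS⟩ : ∃ S : ℝ, S = ((k + 1 : ℕ) : ℝ) + t₀ := ⟨_, rfl⟩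
    have hk0 : (0 : ℝ) ≤ k := Nat.cast_nonneg k
    have hS1 : 1 + t₀ ≤ S := by rw [hS]; push_cast; linarith
    have hS7 : 7 ≤ S := by linarith
    have hS0 : 0 < S := by linarith
    have hcast : ((k + 1 + 1 : ℕ) : ℝ) + t₀ = S + 1 := by rw [hS]; push_cast; ring
    have hbS : 4 ≤ b * S := hbt.trans (mul_le_mul_of_nonneg_left hS1 hb0.le)
    have hklS : 1440 * (κ * lam / b) ^ 2 ≤ S ^ 2 :=
      hkl.trans (pow_le_pow_left₀ (by linarith) (by linarith) 2)
    have heS : 2000 * (κ * lam / b) ^ 2 ≤ 25 / 18 * S ^ 2 := by linarith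
    have hα : stepSize (6 / μ) t₀ (k + 1) = 6 / (μ * S) := by rw [stepSize, ← hS, div_div]
    have hαL : 6 / (μ * S) * L ≤ 1 / 2 := by
      rw [hL, div_mul_eq_mul_div, div_le_div_iff₀ (by positivity) (by norm_num)]
      nlinarith
    have hαlam : 6 / (μ * S) * L * lam ≤ 4 / 25 * (1 - lam) := by
      -- Here (75/2)² ≤ 1440, and 6/(75/2) = 4/25.
      have h1 : 75 / 2 * (κ * lam / b) ≤ S := by
        refine abs_le_of_sq_le_sq' (a := 75 / 2 * (κ * lam / b)) ?_ hS0.le |>.2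
        have : 0 ≤ (κ * lam / b) ^ 2 := sq_nonneg _
        rw [mul_pow]
        linarith
      have h2 : 6 / (μ * S) * L * lam = 6 * b * (κ * lam / b) / S := by
        rw [hL]; field_simp
      rw [h2, hb, div_le_iff₀ hS0]
      nlinarith
    have hψ0 : 0 ≤ (1 - 7 / 50 * b) ^ (T - (k + 1 + 1)) := pow_nonneg (by linarith) _
    have hψ1 : (1 - 7 / 50 * b) ^ (T - (k + 1 + 1)) ≤ 1 := pow_le_one₀ (by linarith) (by linarith)
    have hψ : (1 - 7 / 50 * b) ^ (T - (k + 1))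
        = (1 - 7 / 50 * b) * (1 - 7 / 50 * b) ^ (T - (k + 1 + 1)) := by
      rw [← pow_succ']; congr 1; omega
    have hwS : w * (S + 1) ^ 2 ≤ θ := by
      refine (mul_le_mul_of_nonneg_left ?_ hw).trans hwθ
      refine pow_le_pow_left₀ (by linarith) ?_ 2
      rw [← hcast]
      have : ((k + 1 + 1 : ℕ) : ℝ) ≤ T := by exact_mod_cast htT
      linarith
    have hstep := lintegral_exp_potential_dsgd_le (x₁ := x₁) (W := W) (α := stepSize (6 / μ) t₀)
      (xs := xs) (A := weightA w n (S + 1) ((1 - 7 / 50 * b) ^ (T - (k + 1 + 1))))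
      (E := weightE w L (2000 * (κ * lam / b) ^ 2) (S + 1))
      (B := weightB w L κ b (2000 * (κ * lam / b) ^ 2) (S + 1)
        ((1 - 7 / 50 * b) ^ (T - (k + 1 + 1))))
      (A' := weightA w n S ((1 - 7 / 50 * b) ^ (T - (k + 1))))
      (E' := weightE w L (2000 * (κ * lam / b) ^ 2) S)
      (B' := weightB w L κ b (2000 * (κ * lam / b) ^ 2) S ((1 - 7 / 50 * b) ^ (T - (k + 1))))
      (C := momentIncrease n d (weightA w n (S + 1) ((1 - 7 / 50 * b) ^ (T - (k + 1 + 1))))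
        (weightE w L (2000 * (κ * lam / b) ^ 2) (S + 1))
        (weightB w L κ b (2000 * (κ * lam / b) ^ 2) (S + 1)
          ((1 - 7 / 50 * b) ^ (T - (k + 1 + 1)))) (6 / (μ * S)) L lam (avgNoiseSq σ)
          (∑ i, ‖∇ (localCost loss D i) xs‖ ^ 2))
      hloss hor (t := k) (hF _) hσ (fun i => (hsc.contDiff i).continuous) (fun X z hind hz => by
        rw [hα]
        refine lintegral_exp_potential_step_le hn hW (hasQuadraticBounds_localCost hsc hlip) hlip
          hμ hL0 hlam (by positivity) hαL hαlam hmin (η := 1 / S) ?_ ?_ ?_ (by positivity) hind hz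
          hσ (weightA_noise_le hw hn' hμ hκ hS7 hψ0 hs0 hwS hθ2)
          (weightE_noise_le hw hμ hκ hL hS7 heS hs0 hwS hθ2) (fun i => ?_)
          (weight_avg_noise_le hw hn' hμ hκ hL hS7 heS hψ0 (Nat.cast_nonneg d) hs0 hwS hθ1 ?_)
          ?_ (weightE_step_le hw hL0.le (by positivity) hS7 hμ) ?_ X
        · have : 0 ≤ 1 - (1 - 7 / 50 * b) ^ (T - (k + 1 + 1)) := by linarith
          unfold weightA; positivity
        · unfold weightE; positivity
        · unfold weightB; positivity
        · rw [hb]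
          refine weightB_noise_le hw hμ hκ hL hb0 hS7 hbS heS hψ0 hψ1 hwS hθ1 ?_
          exact (hσmax i).trans (mul_le_mul_of_nonneg_left (by linarith) (by positivity))
        · exact hds.trans (mul_le_mul_of_nonneg_left (by linarith) hμ.le)
        · rw [hb, hψ]
          exact weightA_step_le hw hn' hμ hκ hL hb0 hb1 hS7 rfl hklS hψ0 hψ1
        · rw [hb, hψ]
          exact weightB_step_le hw hn' hμ hκ hL (by positivity) hb0 hb1 hS7 hbS hψ0 hψ1)
    have ih' := ih (by omega)
    rw [Finset.sum_Ico_succ_top ht1, ← add_assoc, Real.exp_add,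
      ENNReal.ofReal_mul (Real.exp_pos _).le, mul_comm]
    refine le_trans ?_ (mul_le_mul_right ih' _)
    simp only [horizonPotential, horizonIncrease, hcast, ← hS]
    exact hstep

/-- The terms with ψ sum geometrically to (T + t₀)·8/b. The constant terms κ/b sum to (T + t₀)κ/b,
so the disagreement noise costs one power of T + t₀ and the averaged noise two. -/
lemma sum_horizonIncrease_le (hn : 0 < n) (hw : 0 ≤ w) (hμ : 0 < μ) (hκ : 1 ≤ κ) (hL : L = κ * μ)
    (hb0 : 0 < b) (hb1 : b ≤ 1) (hb : 1 - lam = b) (ht₀ : 6 ≤ t₀)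
    (hkl : 1440 * (κ * lam / b) ^ 2 ≤ t₀ ^ 2) {s2 H : ℝ} (hs : 0 ≤ s2) (hH : 0 ≤ H) (T : ℕ) :
    ∑ s ∈ Finset.Ico 1 T, horizonIncrease n d T w L μ κ b lam t₀ s2 H s
      ≤ w * L * lam ^ 2 * (6 / μ) ^ 2 * ((73 * κ + 8) * ((T + t₀) / b))
          * (8 / b * H + 3 * (n * s2))
        + 1704 * w * (T + t₀) ^ 2 * (d * s2 * κ / μ) := by
  have hL0 : 0 < L := by rw [hL]; positivity
  have hZ0 : (0 : ℝ) ≤ T + t₀ := by positivity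
  have hY0 : 0 ≤ 8 / b * H + 3 * (n * s2) := by positivity
  have hterm : ∀ s ∈ Finset.Ico 1 T, horizonIncrease n d T w L μ κ b lam t₀ s2 H s
      ≤ w * L * lam ^ 2 * (6 / μ) ^ 2 *
          (73 * κ / b + (T + t₀) * (1 - 7 / 50 * b) ^ (T - (s + 1))) * (8 / b * H + 3 * (n * s2))
        + 1704 * w * (T + t₀) * (d * s2 * κ / μ) := by
    intro s hs'
    rw [Finset.mem_Ico] at hs'
    have hs1 : (1 : ℝ) ≤ s := by exact_mod_cast hs'.1
    have hsT : (s : ℝ) + 1 ≤ T := by exact_mod_cast hs'.2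
    have hψ0 : 0 ≤ (1 - 7 / 50 * b) ^ (T - (s + 1)) := pow_nonneg (by linarith) _
    have hsq : t₀ ^ 2 ≤ (s + t₀) ^ 2 := pow_le_pow_left₀ (by linarith) (by linarith) 2
    refine (momentIncrease_le hw hn hμ hκ hL hb0 hb1 hb (by linarith) (by linarith) hψ0 hs
      hH).trans ?_
    have hle : (s : ℝ) + t₀ + 1 ≤ T + t₀ := by linarith
    gcongr
  refine (Finset.sum_le_sum hterm).trans ?_
  have hcard : ((Finset.Ico 1 T).card : ℝ) ≤ T + t₀ := by
    rw [Nat.card_Ico]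
    have : ((T - 1 : ℕ) : ℝ) ≤ T := by exact_mod_cast Nat.sub_le T 1
    linarith
  have hpow := sum_pow_tail_le hb0 hb1 T
  rw [Finset.sum_add_distrib, ← Finset.sum_mul, ← Finset.mul_sum, Finset.sum_add_distrib,
    ← Finset.mul_sum, Finset.sum_const, Finset.sum_const, nsmul_eq_mul, nsmul_eq_mul]
  have h1 : ((Finset.Ico 1 T).card : ℝ) * (73 * κ / b)
      + (T + t₀) * ∑ s ∈ Finset.Ico 1 T, (1 - 7 / 50 * b) ^ (T - (s + 1))
      ≤ (73 * κ + 8) * ((T + t₀) / b) := by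
    have e1 := mul_le_mul_of_nonneg_right hcard (by positivity : 0 ≤ 73 * κ / b)
    have e2 := mul_le_mul_of_nonneg_left hpow hZ0
    refine (add_le_add e1 e2).trans (le_of_eq ?_)
    ring
  have h2 := mul_le_mul_of_nonneg_right hcard
    (by positivity : 0 ≤ 1704 * w * (T + t₀) * (d * s2 * κ / μ))
  refine add_le_add (mul_le_mul_of_nonneg_right
    (mul_le_mul_of_nonneg_left h1 (by positivity)) hY0) (h2.trans (le_of_eq ?_))
  ring

lemma one_le_condition_number {f : Vec d → ℝ} {g : Vec d → Vec d}
    (h : HasQuadraticBounds f g μ L) (hd : 0 < d) : μ ≤ L := by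
  have h1 := h.lower (EuclideanSpace.single ⟨0, hd⟩ 1) 0
  have h2 := h.upper (EuclideanSpace.single ⟨0, hd⟩ 1) 0
  simp at h1 h2
  linarith

end Main

/-! ### The high-probability rate. -/

theorem theorem2 :
    ∃ C : ℝ, 0 < C ∧
      ∀ (n d : ℕ) (_ : 2 ≤ n)
        (Ω : Type*) [MeasurableSpace Ω] (P : Measure Ω) [IsProbabilityMeasure P]
        (Ξ : Type*) [MeasurableSpace Ξ]
        (loss : Vec d → Ξ → ℝ) (D : Fin n → Measure Ξ) (ξ : ℕ → Fin n → Ω → Ξ)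
        (W : Matrix (Fin n) (Fin n) ℝ) (x₁ : Fin n → Vec d) (xstar : Vec d)
        (L μ t₀ : ℝ) (σ : Fin n → ℝ)
        (κ a sigmaSq sigmaMax lam ν : ℝ)
        (_ : κ = L / μ) (_ : a = 6 / μ) (_ : sigmaSq = avgNoiseSq σ)
        (_ : sigmaMax = maxNoise σ) (_ : lam = secondSingularValue W)
        (_ : ν = min 1 (min (μ / (432 * sigmaSq * κ ^ 2)) (μ / (72 * κ))))
        (x : ℕ → Fin n → Ω → Vec d)
        (_ : x = dsgd W (stepSize a t₀) loss ξ x₁),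
        0 < L → 0 < μ → (∀ i, 0 < σ i) →
        IsLoss loss D →
        IsNetworkMatrix W →
        LipschitzGradients (localCost loss D) L →
        IsSubGaussianOracle P loss D ξ (modelFiltration x) σ →
        SmoothStronglyConvex (localCost loss D) μ →
        (∀ y, globalCost loss D xstar ≤ globalCost loss D y) →
        (∀ i j, x₁ i = x₁ j) →
        6 ≤ t₀ →
        17280 * d * sigmaSq * κ / μ ≤ t₀ →
        432 * sigmaMax ^ 2 * κ ^ 2 / μ ≤ t₀ →
        12 * κ * lam * Real.sqrt 10 / (1 - lam) ≤ t₀ →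
        5184 * sigmaMax ^ 2 * lam ^ 2 * κ ^ 2 / (μ * (1 - lam)) ≤ t₀ →
        (3 + lam) / (1 - lam) ≤ t₀ →
        (∀ t : ℕ, 1 ≤ t → stepSize a t₀ t ≤ 1 / (2 * L)) →
        ∀ (T : ℕ), 1 ≤ T → ∀ δ : ℝ, 0 < δ → δ < 1 →
          1 - δ ≤ P.real {ω |
            (1 / (n : ℝ)) * ∑ i, (globalCost loss D (x T i ω) - globalCost loss D xstar) ≤
              C * lastIterateRate n d a t₀ ((T : ℝ) + t₀) ν δ sigmaSq μ L lam
                (∑ i, ‖∇ (localCost loss D i) xstar‖ ^ 2)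
                (∑ i, ‖x₁ i - xstar‖ ^ 2)
                (globalCost loss D (netAvg x₁) - globalCost loss D xstar)} := by
  refine ⟨2000, by norm_num, ?_⟩
  intro n d hn Ω _ P _ Ξ _ loss D ξ W x₁ xs L μ t₀ σ κ a s2 smax lam ν hκ ha hs2 hsmax hlam hν x hx
    hL hμ hσ hloss hW hlip hor hsc hmin heq ht₀ hds _ hkl hσmax hbt hα T hT δ hδ0 hδ1
  have hn0 : 0 < n := by omega
  have hn' : (0 : ℝ) < n := by positivity
  have hl0 : 0 ≤ lam := hlam ▸ secondSingularValue_nonneg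
  have hl1 : lam < 1 := hlam ▸ (hW.secondSingularValue_bound hn).1
  have hs0 : 0 < s2 := by
    have : Nonempty (Fin n) := ⟨⟨0, hn0⟩⟩
    rw [hs2, avgNoiseSq]
    exact mul_pos (by positivity)
      (Finset.sum_pos (fun i _ => pow_pos (hσ i) 2) Finset.univ_nonempty)
  have hκ0 : 0 < κ := by rw [hκ]; positivity
  have hν0 : 0 < ν := by
    rw [hν]
    exact lt_min one_pos (lt_min (by positivity) (by positivity))
  have hΔ : 0 ≤ globalCost loss D (netAvg x₁) - globalCost loss D xs := sub_nonneg.2 (hmin _)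
  have hT1 : (1 : ℝ) ≤ T := by exact_mod_cast hT
  have hrate : 0 ≤ lastIterateRate n d a t₀ ((T : ℝ) + t₀) ν δ s2 μ L lam
      (∑ i, ‖∇ (localCost loss D i) xs‖ ^ 2) (∑ i, ‖x₁ i - xs‖ ^ 2)
      (globalCost loss D (netAvg x₁) - globalCost loss D xs) :=
    lastIterateRate_nonneg (by rw [ha]; positivity) (by linarith) (by linarith) hν0.le hδ0 hδ1
      hs0.le hμ.le hL.le hl1 (Finset.sum_nonneg fun i _ => sq_nonneg _)
      (Finset.sum_nonneg fun i _ => sq_nonneg _) hΔ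
  -- In dimension zero μ ≤ L may fail, but there every suboptimality is zero.
  rcases Nat.eq_zero_or_pos d with rfl | hd
  · have : ∀ ω i, globalCost loss D (x T i ω) - globalCost loss D xs = 0 := fun ω i => by
      rw [Subsingleton.elim (x T i ω) xs, sub_self]
    simp only [this, Finset.sum_const_zero, mul_zero]
    have huniv : {ω : Ω | 0 ≤ 2000 * lastIterateRate n 0 a t₀ ((T : ℝ) + t₀) ν δ s2 μ L lam
      (∑ i, ‖∇ (localCost loss D i) xs‖ ^ 2) (∑ i, ‖x₁ i - xs‖ ^ 2)
      (globalCost loss D (netAvg x₁) - globalCost loss D xs)} = Set.univ :=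
      Set.eq_univ_of_forall fun ω => mul_nonneg (by norm_num) hrate
    rw [huniv, probReal_univ]
    linarith
  have hquad := hasQuadraticBounds_localCost hsc hlip
  have hκ1 : 1 ≤ κ := by
    rw [hκ, one_le_div hμ]
    exact one_le_condition_number (hquad ⟨0, hn0⟩) hd
  have hLκ : L = κ * μ := by rw [hκ]; field_simp
  obtain ⟨b, hb⟩ : ∃ b, 1 - lam = b := ⟨_, rfl⟩
  have hb0 : 0 < b := by linarith
  have hb1 : b ≤ 1 := by linarith
  have hκt : 12 * κ ≤ 1 + t₀ := by
    have h := hα 1 le_rfl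
    rw [stepSize, ha, div_div, div_le_div_iff₀ (by positivity) (by positivity), hLκ] at h
    push_cast at h
    have h' : μ * (12 * κ) ≤ μ * (1 + t₀) := by linarith
    exact le_of_mul_le_mul_left h' hμ
  -- The square of the assumption with 12√10, as 144·10 = 1440.
  have hkl' : 1440 * (κ * lam / b) ^ 2 ≤ t₀ ^ 2 := by
    rw [hb] at hkl
    have h := pow_le_pow_left₀ (by positivity) hkl 2
    rw [div_pow, mul_pow, Real.sq_sqrt (by norm_num)] at h
    refine le_trans (le_of_eq ?_) h
    rw [div_pow]; ring
  have hbt' : 4 ≤ b * (1 + t₀) := by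
    rw [hb, div_le_iff₀ hb0] at hbt
    linarith
  have hσmax' : ∀ i, 5184 * σ i ^ 2 * lam ^ 2 * κ ^ 2 ≤ μ * b * t₀ := by
    intro i
    rw [hb, div_le_iff₀ (by positivity)] at hσmax
    have h1 : σ i ≤ smax := by
      rw [hsmax, maxNoise]
      exact le_ciSup (Set.finite_range σ).bddAbove i
    have h2 := pow_le_pow_left₀ (hσ i).le h1 2
    have h3 : 5184 * σ i ^ 2 * lam ^ 2 * κ ^ 2 ≤ 5184 * smax ^ 2 * lam ^ 2 * κ ^ 2 := by gcongr
    linarith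
  have hds' : 17280 * d * avgNoiseSq σ * κ ≤ μ * t₀ := by
    rw [← hs2]
    rw [div_le_iff₀ hμ] at hds
    linarith
  have hν1 : ν ≤ 1 := by rw [hν]; exact min_le_left _ _
  have hν2 : 432 * ν * s2 * κ ^ 2 ≤ μ := by
    have h : ν ≤ μ / (432 * s2 * κ ^ 2) := by
      rw [hν]; exact (min_le_right _ _).trans (min_le_left _ _)
    rw [le_div_iff₀ (by positivity)] at h
    linarith
  have hZ0 : 0 < (T : ℝ) + t₀ := by linarith
  -- This w gives w(T + t₀)² = θ = ν/2000. The noise conditions then follow from ν ≤ 1 and ν ≤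
  -- μ/(432σ²κ²), since 864000 = 432·2000.
  obtain ⟨w, hw⟩ : ∃ w, w = ν / 2000 / ((T : ℝ) + t₀) ^ 2 := ⟨_, rfl⟩
  have hw0 : 0 < w := by rw [hw]; positivity
  have hxm : ∀ t i, Measurable (x t i) := fun t i => by
    rw [hx]; exact hor.measurable_dsgd hloss t i
  have hmom := lintegral_exp_horizonPotential_le (x₁ := x₁) (θ := ν / 2000) hn hloss hor
    (fun t => modelFiltration_le hxm t) hσ hW hlip hsc hmin hμ hκ1 hLκ hlam hb ht₀ hκt hkl' hbt'
    hσmax' hds' (by linarith) (by rw [← hs2]; linarith) hw0.le T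
    (by rw [hw]; field_simp; exact le_rfl) T hT le_rfl
  rw [← hs2, ← ha, ← hx] at hmom
  have hVm : Measurable fun ω => horizonPotential loss D xs T w L κ b lam t₀ T
      (fun i => x T i ω) :=
    (measurable_potential (fun i => (hsc.contDiff i).continuous) xs _ _ _).comp
      (measurable_pi_lambda _ fun i => hxm T i)
  refine (one_sub_le_prob_of_lintegral_exp_le hVm hδ0 hmom).trans ?_
  refine measureReal_mono fun ω hω => ?_
  simp only [Set.mem_ofPred_eq] at hω ⊢
  have hinc := sum_horizonIncrease_le (d := d) (lam := lam) hn0 hw0.le hμ hκ1 hLκ hb0 hb1 hb ht₀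
    hkl' hs0.le
    (Finset.sum_nonneg fun i _ => sq_nonneg _ : 0 ≤ ∑ i, ‖∇ (localCost loss D i) xs‖ ^ 2) T
  have hfinal := bound_le_lastIterateRate (n := n) (d := d) (lam := lam) hn0
    (by linarith : 0 ≤ t₀) (by linarith : 1 ≤ (T : ℝ) + t₀) hν0 hδ0 hδ1 hs0.le hμ hκ1 hLκ hb0 hb
    (Finset.sum_nonneg fun i _ => sq_nonneg _ : 0 ≤ ∑ i, ‖∇ (localCost loss D i) xs‖ ^ 2)
    (Finset.sum_nonneg fun i _ => sq_nonneg _ : 0 ≤ ∑ i, ‖x₁ i - xs‖ ^ 2) hΔ hw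
  rw [← ha] at hfinal hinc
  refine le_trans ?_ hfinal
  rw [le_div_iff₀ (by positivity)]
  -- Equal initial models have no disagreement, so the large weight B costs nothing at the start;
  -- the bracket in A is at most 3/2.
  have hinit : horizonPotential loss D xs T w L κ b lam t₀ 1 x₁
      ≤ w * n * (1 + t₀) ^ 3 * (3 / 2) * (globalCost loss D (netAvg x₁) - globalCost loss D xs)
        + w * L * (2000 * (κ * lam / b) ^ 2) * (1 + t₀) * ∑ i, ‖x₁ i - xs‖ ^ 2 := by
    have hcons : ∀ i, x₁ i - netAvg x₁ = 0 := by
      intro i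
      have h1 : (n : ℝ) • x₁ i = (n : ℝ) • netAvg x₁ := by
        rw [nsmul_netAvg hn0, Finset.sum_congr rfl fun j _ => heq j i, Finset.sum_const,
          Finset.card_univ, Fintype.card_fin, Nat.cast_smul_eq_nsmul]
      rw [sub_eq_zero]
      exact smul_right_injective _ hn'.ne' h1
    have hR := sum_norm_sub_sq hn0 x₁ xs
    simp only [hcons, norm_zero, ne_eq, OfNat.ofNat_ne_zero, not_false_eq_true, zero_pow,
      Finset.sum_const_zero, zero_add] at hR
    have hψ : 0 ≤ (1 - 7 / 50 * b) ^ (T - 1) := pow_nonneg (by linarith) _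
    rw [horizonPotential, potential, hR]
    simp only [hcons, norm_zero, ne_eq, OfNat.ofNat_ne_zero, not_false_eq_true, zero_pow,
      Finset.sum_const_zero, mul_zero, add_zero]
    rw [weightE, Nat.cast_one]
    refine add_le_add_left (mul_le_mul_of_nonneg_right ?_ hΔ) _
    rw [weightA]
    refine mul_le_mul_of_nonneg_left (by linarith) (by positivity)
  have hlast : ((1 / (n : ℝ)) * ∑ i, (globalCost loss D (x T i ω) - globalCost loss D xs))
      * (w * n * ((T : ℝ) + t₀) ^ 3) ≤ horizonPotential loss D xs T w L κ b lam t₀ T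
        (fun i => x T i ω) := by
    have h1 := mul_le_mul_of_nonneg_right
      (avg_cost_le hn0 hquad (fun i => x T i ω) (globalCost loss D xs))
      (by positivity : 0 ≤ w * n * ((T : ℝ) + t₀) ^ 3)
    refine h1.trans ?_
    have hE : 0 ≤ weightE w L (2000 * (κ * lam / b) ^ 2) (T + t₀)
        * (n * ‖(netAvg fun i => x T i ω) - xs‖ ^ 2) := by
      unfold weightE; positivity
    -- At the horizon ψ = 1: A is exactly w n (T+t₀)³, and the S³ part of B is exactly the price of
    -- passing from the average to the users.
    have hB : w * L * (1 / 2 * ((T : ℝ) + t₀) ^ 3)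
        ≤ weightB w L κ b (2000 * (κ * lam / b) ^ 2) (T + t₀) 1 := by
      rw [weightB, mul_one]
      exact mul_le_mul_of_nonneg_left (le_add_of_nonneg_left (by positivity)) (by positivity)
    have hQ : 0 ≤ ∑ i, ‖x T i ω - netAvg (fun i => x T i ω)‖ ^ 2 :=
      Finset.sum_nonneg fun i _ => sq_nonneg _
    have h2 := mul_le_mul_of_nonneg_right hB hQ
    rw [horizonPotential, potential, Nat.sub_self, pow_zero, weightA, add_mul]
    have h3 : L / (2 * n) * (∑ i, ‖x T i ω - netAvg (fun i => x T i ω)‖ ^ 2)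
        * (w * n * ((T : ℝ) + t₀) ^ 3) = w * L * (1 / 2 * ((T : ℝ) + t₀) ^ 3)
          * ∑ i, ‖x T i ω - netAvg (fun i => x T i ω)‖ ^ 2 := by
      field_simp
    rw [h3]
    simp only [globalCost] at hE h2 ⊢
    linarith
  linarith
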